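/- Let $n\ge 0$ be an integer, $h>0$, let $v:\mathbb R^n\to[-\infty,+\infty)$ be measurable with $v^+=\max(v,0)\in L^\infty_{\rm loc}(\mathbb R^n)$, and let $f\in L^\infty_{\rm loc}(\mathbb R^n)$. For an open set $A\subseteq\mathbb R^n$ and $u\in L^1_{\rm loc}(A)$ write $$\int_A|Du|=\sup\Big\{\int_A u\,\operatorname{div}z\,dx:\ z\in C_c^\infty(A;\mathbb R^n),\ |z|\le 1\Big\}\in[0,\infty],$$ let $BV(A)$ be the set of $u\in L^1(A)$ with $\int_A|Du|<\infty$, and let $BV_{\rm loc}(\mathbb R^n)$ be the set of functions that belong to $BV(A)$ for every bounded open $A$. Let $B_R$ be the open ball of radius $R$ centred at $0$. Functions are identified when they agree almost everywhere. For every $M>0$ the problem $$\min\Big\{\int_{B_M}|Du|+\frac1{2h}\int_{B_M}(u-f)^2\,dx:\ u\in L^2(B_M)\cap BV(B_M),\ u\ge v\text{ a.e. in }B_M\Big\}$$ has a unique minimizer, denoted $S_{h,v}(f,B_M)$. Moreover, there exists a unique function $u\in L^\infty_{\rm loc}(\mathbb R^n)\cap BV_{\rm loc}(\mathbb R^n)$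 such that, for all $R>0$ and all $p\in(n,+\infty)$, $$\lim_{M\to\infty}\|u-S_{h,v}(f,B_M)\|_{L^p(B_R)}=0 .$$ This function is characterized as follows: a function $u\in L^\infty_{\rm loc}(\mathbb R^n)\cap BV_{\rm loc}(\mathbb R^n)$ is the function above if and only if $u\ge v$ a.e. and, for every $R>0$ and every $\varphi\in BV(\mathbb R^n)$ whose (closed) support is contained in $B_R$ and which satisfies $u+\varphi\ge v$ a.e., $$\int_{B_R}|Du|+\frac1{2h}\int_{B_R}|u-f|^2\,dx\ \le\ \int_{B_R}|D(u+\varphi)|+\frac1{2h}\int_{B_R}|u+\varphi-f|^2\,dx ,$$ where the right-hand side may be $+\infty$. -/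

import Mathlib

open MeasureTheory Filter Set
open scoped ENNReal Topology

namespace TVObstacle

/-- The divergence `∑ i, ∂ᵢ zᵢ` of a vector field on `ℝⁿ`. -/
noncomputable def vdiv {n : ℕ}
    (z : EuclideanSpace ℝ (Fin n) → EuclideanSpace ℝ (Fin n))
    (x : EuclideanSpace ℝ (Fin n)) : ℝ :=
  ∑ i : Fin n, (fderiv ℝ z x (EuclideanSpace.single i 1)) i

/-- Admissible fields in the definition of the total variation on `A`: smooth, compactly
supported in `A`, with Euclidean norm at most one everywhere. -/
def testFields {n : ℕ} (A : Set (EuclideanSpace ℝ (Fin n))) :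
    Set (EuclideanSpace ℝ (Fin n) → EuclideanSpace ℝ (Fin n)) :=
  {z | ContDiff ℝ ((⊤ : ℕ∞) : WithTop ℕ∞) z ∧ HasCompactSupport z ∧ tsupport z ⊆ A ∧ ∀ x, ‖z x‖ ≤ 1}

/-- The total variation `|Du|(A) = sup { ∫_A u div z }` of a (locally integrable) function `u`
on the open set `A`, as an extended nonnegative number. The supremum is over a set of fields
that contains `0` and is stable under `z ↦ -z`, so truncating at `0` changes nothing. -/
noncomputable def totalVar {n : ℕ} (A : Set (EuclideanSpace ℝ (Fin n)))
    (u : EuclideanSpace ℝ (Fin n) → ℝ) : ℝ≥0∞ :=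
  ⨆ z ∈ testFields A, ENNReal.ofReal (∫ x in A, u x * vdiv z x)

/-- `u ∈ BV(A)`. -/
def MemBV {n : ℕ} (A : Set (EuclideanSpace ℝ (Fin n)))
    (u : EuclideanSpace ℝ (Fin n) → ℝ) : Prop :=
  IntegrableOn u A volume ∧ totalVar A u < ∞

/-- `u ∈ BV_loc(ℝⁿ)`: `u ∈ BV(A)` for every bounded open set `A`. -/
def MemBVLoc {n : ℕ} (u : EuclideanSpace ℝ (Fin n) → ℝ) : Prop :=
  ∀ A : Set (EuclideanSpace ℝ (Fin n)), IsOpen A → Bornology.IsBounded A → MemBV A u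

/-- `u ∈ L^∞_loc(ℝⁿ)`. -/
def MemLinftyLoc {n : ℕ} (u : EuclideanSpace ℝ (Fin n) → ℝ) : Prop :=
  ∀ K : Set (EuclideanSpace ℝ (Fin n)), IsCompact K → MemLp u ∞ (volume.restrict K)

/-- The energy `∫_A |Du| + (1/2h) ∫_A (u - f)² dx`, with values in `[0, ∞]`. -/
noncomputable def energy {n : ℕ} (h : ℝ) (f : EuclideanSpace ℝ (Fin n) → ℝ)
    (A : Set (EuclideanSpace ℝ (Fin n))) (u : EuclideanSpace ℝ (Fin n) → ℝ) : ℝ≥0∞ :=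
  totalVar A u +
    ENNReal.ofReal (1 / (2 * h)) * ∫⁻ x in A, ENNReal.ofReal ((u x - f x) ^ 2)

/-- The admissible class of the obstacle problem on `B`: `u ∈ L²(B) ∩ BV(B)` with
`u ≥ v` a.e. in `B`. -/
def Admissible {n : ℕ} (v : EuclideanSpace ℝ (Fin n) → EReal)
    (B : Set (EuclideanSpace ℝ (Fin n))) (u : EuclideanSpace ℝ (Fin n) → ℝ) : Prop :=
  MemLp u 2 (volume.restrict B) ∧ MemBV B u ∧ ∀ᵐ x ∂(volume.restrict B), v x ≤ (u x : EReal)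

/-- `u` minimizes the energy on `B` among the functions above the obstacle `v`. Only the
values of `u` in `B` matter. -/
def IsObstacleMin {n : ℕ} (h : ℝ) (v : EuclideanSpace ℝ (Fin n) → EReal)
    (f : EuclideanSpace ℝ (Fin n) → ℝ)
    (B : Set (EuclideanSpace ℝ (Fin n))) (u : EuclideanSpace ℝ (Fin n) → ℝ) : Prop :=
  Admissible v B u ∧ ∀ w, Admissible v B w → energy h f B u ≤ energy h f B w

open Classical in
/-- `S_{h,v}(f,B)`: a minimizer of the obstacle problem on `B` (the zero function if there
is none). -/
noncomputable def obstacleSol {n : ℕ} (h : ℝ) (v : EuclideanSpace ℝ (Fin n) → EReal)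
    (f : EuclideanSpace ℝ (Fin n) → ℝ)
    (B : Set (EuclideanSpace ℝ (Fin n))) : EuclideanSpace ℝ (Fin n) → ℝ :=
  if H : ∃ u, IsObstacleMin h v f B u then H.choose else 0

/-- `u` is the limit of `S_{h,v}(f,B_M)` as `M → ∞`, in `L^p(B_R)` for all `R > 0` and all
`p ∈ (n, ∞)`. -/
def IsGlobalLimit {n : ℕ} (h : ℝ) (v : EuclideanSpace ℝ (Fin n) → EReal)
    (f u : EuclideanSpace ℝ (Fin n) → ℝ) : Prop :=
  ∀ R : ℝ, 0 < R → ∀ p : ℝ, (n : ℝ) < p →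
    Tendsto (fun M : ℝ =>
      eLpNorm (fun x => u x - obstacleSol h v f (Metric.ball 0 M) x) (ENNReal.ofReal p)
        (volume.restrict (Metric.ball 0 R))) atTop (𝓝 0)

/-- `u` is a local minimizer on `ℝⁿ`: for every `R > 0`, its energy in the open ball `B_R` does
not decrease under perturbations `φ ∈ BV(ℝⁿ)` with (closed) support contained in `B_R` and
`u + φ ≥ v` a.e. Every class of functions whose essential support lies in `B_R` has
a representative whose topological support does, so `tsupport` loses nothing. -/
def IsLocalMin {n : ℕ} (h : ℝ) (v : EuclideanSpace ℝ (Fin n) → EReal)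
    (f u : EuclideanSpace ℝ (Fin n) → ℝ) : Prop :=
  ∀ R : ℝ, 0 < R → ∀ φ : EuclideanSpace ℝ (Fin n) → ℝ,
    MemBV univ φ → tsupport φ ⊆ Metric.ball 0 R →
    (∀ᵐ x, v x ≤ ((u x + φ x : ℝ) : EReal)) →
    energy h f (Metric.ball 0 R) u ≤ energy h f (Metric.ball 0 R) (fun x => u x + φ x)

end TVObstacle

/-! The whole proof rests on a local comparison principle for the total variation. If `u` and `w`
have bounded variation on open sets that both contain the support of a cutoff `ψ`, and `g` is
nondecreasing, `1`-Lipschitz with `g 0 = 0`, then replacing `u` by `u - ψ g(u - w)` and `w` by `w +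
ψ g(u - w)` increases the sum of the two variations by at most `2 ∫ |∇ψ| |g(u - w)|`
(`totalVar_exchange`). By duality this comes from mixing the two test fields with weight `ψ g'(u -
w)`, which keeps them admissible; smooth approximation removes the regularity assumption.

Both modified functions stay between `u` and `w`, hence above the obstacle. So if `u` and `w`
minimize with respect to perturbations supported in `B_R`, adding the two minimality inequalities
eliminates `f` and gives `∫ ψ g(W)(W - ψ g(W)) ≤ 2h ∫ |∇ψ| |g(W)|` with `W = u - w`
(`RelMin.comparison`). With `g(s)` comparable to `s^(2m+1)` and a cutoff of the form `exp(-1/(1 -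
|x|²/R²))`, Young's inequality yields `∫_{B_{R/2}} |W|^(2m+2) ≤ C R^(n-2m-2)`, where `C` depends
only on `h`, `m` and `n` (`RelMin.integral_pow_sub_le`, `exists_decay_pow`). For `2m+2 > n` the
right side tends to zero, and Hölder's inequality on a fixed ball passes to smaller exponents
(`exists_decay_eLpNorm`).

Consequently the minimizers on `B_M` are Cauchy on every fixed ball and have a limit `u`. A barrier
argument with an explicit vector field bounds them locally, uniformly in `M` (`RelMin.ae_abs_le`),
and comparison with a constant bounds their variation (`exists_totalVar_bound`), so the limit is
locally bounded and of locally bounded variation. It is a local minimizer because the minimizers on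
balls can be glued to any competitor at a vanishing cost (`IsL2Limit.isLocalMin`). Conversely, a
local minimizer above the obstacle is subject to the same decay estimate against the minimizers on
balls, hence is their limit (`IsLocalMin.relMin`, `IsLocalMin.isGlobalLimit`).

On a single ball, existence and uniqueness follow from uniform convexity in `L²`
(`renergy_midpoint_le`). -/

namespace TVObstacle

/-- Euclidean space `ℝⁿ`. -/
abbrev Eu (n : ℕ) : Type := EuclideanSpace ℝ (Fin n)

/-! ### Calculus of the divergence -/

section Divergence

variable {n : ℕ}

theorem fderiv_apply_eq_sum (L : Eu n →L[ℝ] ℝ) (y : Eu n) :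
    L y = ∑ i, y i * L (EuclideanSpace.single i 1) := by
  have h : y = ∑ i, y i • EuclideanSpace.single i (1 : ℝ) := by
    ext j
    simp [Finset.sum_apply, Pi.single_apply]
  conv_lhs => rw [h]
  simp

theorem vdiv_smul {a : Eu n → ℝ} {y : Eu n → Eu n} {x : Eu n}
    (ha : DifferentiableAt ℝ a x) (hy : DifferentiableAt ℝ y x) :
    vdiv (fun x => a x • y x) x = a x * vdiv y x + fderiv ℝ a x (y x) := by
  unfold vdiv
  rw [fderiv_fun_smul ha hy, fderiv_apply_eq_sum (fderiv ℝ a x) (y x), Finset.mul_sum,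
    ← Finset.sum_add_distrib]
  refine Finset.sum_congr rfl fun i _ => ?_
  simp
  ring

theorem vdiv_add {y z : Eu n → Eu n} {x : Eu n}
    (hy : DifferentiableAt ℝ y x) (hz : DifferentiableAt ℝ z x) :
    vdiv (fun x => y x + z x) x = vdiv y x + vdiv z x := by
  unfold vdiv
  rw [fderiv_fun_add hy hz, ← Finset.sum_add_distrib]
  simp

theorem vdiv_sub {y z : Eu n → Eu n} {x : Eu n}
    (hy : DifferentiableAt ℝ y x) (hz : DifferentiableAt ℝ z x) :
    vdiv (fun x => y x - z x) x = vdiv y x - vdiv z x := by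
  unfold vdiv
  rw [fderiv_fun_sub hy hz, ← Finset.sum_sub_distrib]
  simp

theorem vdiv_neg (z : Eu n → Eu n) (x : Eu n) :
    vdiv (fun x => - z x) x = - vdiv z x := by
  unfold vdiv
  rw [fderiv_fun_neg, ← Finset.sum_neg_distrib]
  simp

theorem vdiv_comp_add (z : Eu n → Eu n) (t x : Eu n) :
    vdiv (fun x => z (x + t)) x = vdiv z (x + t) := by
  unfold vdiv
  rw [fderiv_comp_add_right]

theorem vdiv_congr {y z : Eu n → Eu n} {x : Eu n} (h : y =ᶠ[𝓝 x] z) : vdiv y x = vdiv z x := by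
  unfold vdiv
  rw [h.fderiv_eq]

theorem continuous_vdiv {z : Eu n → Eu n} (hz : ContDiff ℝ 1 z) : Continuous (vdiv z) := by
  unfold vdiv
  have h := hz.continuous_fderiv one_ne_zero
  fun_prop

theorem vdiv_eq_zero {z : Eu n → Eu n} {x : Eu n} (hx : x ∉ tsupport z) : vdiv z x = 0 := by
  have : fderiv ℝ z x = 0 := by
    by_contra h
    exact hx (support_fderiv_subset ℝ (f := z) h)
  simp [vdiv, this]

theorem hasCompactSupport_vdiv {z : Eu n → Eu n} (hz : HasCompactSupport z) :
    HasCompactSupport (vdiv z) :=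
  HasCompactSupport.intro hz fun _ hx => vdiv_eq_zero hx

theorem integral_vdiv_eq_zero {z : Eu n → Eu n} (hz : ContDiff ℝ 1 z)
    (hc : HasCompactSupport z) : ∫ x, vdiv z x = 0 := by
  have hcont := hz.continuous_fderiv one_ne_zero
  have hint : ∀ v : Eu n, Integrable (fun x => fderiv ℝ z x v) := fun v =>
    (by fun_prop : Continuous fun x => fderiv ℝ z x v).integrable_of_hasCompactSupport
      (hc.fderiv_apply ℝ v)
  have h0 : ∀ v : Eu n, ∫ x, fderiv ℝ z x v = 0 := fun v => by
    have := integral_smul_fderiv_eq_neg_fderiv_smul_of_integrable (μ := volume) (𝕜 := ℝ)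
      (f := fun _ : Eu n => (1 : ℝ)) (g := z) (v := v) (by simp) (by simpa using hint v)
      (by simpa using hz.continuous.integrable_of_hasCompactSupport hc)
      (fun _ _ => by fun_prop) (fun _ _ => hz.differentiable one_ne_zero _)
    simpa using this
  unfold vdiv
  rw [integral_finsetSum]
  · refine Finset.sum_eq_zero fun i _ => ?_
    have := (EuclideanSpace.proj i : Eu n →L[ℝ] ℝ).integral_comp_comm
      (hint (EuclideanSpace.single i 1))
    rw [h0] at this
    simpa using this
  · intro i _
    exact (EuclideanSpace.proj i : Eu n →L[ℝ] ℝ).integrable_comp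
      (hint (EuclideanSpace.single i 1))

/-- The difference of the two integrands is the divergence of the compactly supported field `(W ψ
g'(W) - ψ g(W)) y`: the terms `ψ g'(W) ∇W · y` cancel. The derivative of `g'(W)` occurs on both
sides and need not be computed; it only has to exist. -/
theorem integral_mul_vdiv_smul_comp {W ψ : Eu n → ℝ} {g : ℝ → ℝ} {y : Eu n → Eu n}
    (hW : ContDiff ℝ 2 W) (hψ : ContDiff ℝ 2 ψ) (hg : ContDiff ℝ 2 g) (hy : ContDiff ℝ 2 y)
    (hc : HasCompactSupport y) :
    ∫ x, W x * vdiv (fun x => (ψ x * deriv g (W x)) • y x) x =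
      ∫ x, (ψ x * g (W x) * vdiv y x + g (W x) * fderiv ℝ ψ x (y x)) := by
  have hg' : ContDiff ℝ 1 (deriv g) := (contDiff_succ_iff_deriv (n := 1).1 hg).2.2
  have hW1 : ContDiff ℝ 1 W := hW.of_le one_le_two
  have hψ1 : ContDiff ℝ 1 ψ := hψ.of_le one_le_two
  have hg1 : ContDiff ℝ 1 g := hg.of_le one_le_two
  have hy1 : ContDiff ℝ 1 y := hy.of_le one_le_two
  have ha : ContDiff ℝ 1 (fun x => ψ x * deriv g (W x)) := hψ1.mul (hg'.comp hW1)
  have hb : ContDiff ℝ 1 (fun x => ψ x * g (W x)) := hψ1.mul (hg1.comp hW1)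
  have hc' : ContDiff ℝ 1 (fun x => W x * (ψ x * deriv g (W x)) - ψ x * g (W x)) :=
    (hW1.mul ha).sub hb
  have key : ∀ x, vdiv (fun x => (W x * (ψ x * deriv g (W x)) - ψ x * g (W x)) • y x) x =
      W x * vdiv (fun x => (ψ x * deriv g (W x)) • y x) x -
        (ψ x * g (W x) * vdiv y x + g (W x) * fderiv ℝ ψ x (y x)) := by
    intro x
    have dW := hW1.differentiable one_ne_zero x
    have dψ := hψ1.differentiable one_ne_zero x
    have dg := hg1.differentiable one_ne_zero (W x)
    have dgc : DifferentiableAt ℝ (fun x => g (W x)) x := dg.comp x dW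
    have dy := hy1.differentiable one_ne_zero x
    have da := ha.differentiable one_ne_zero x
    have db := hb.differentiable one_ne_zero x
    have dgW : fderiv ℝ (fun x => g (W x)) x = deriv g (W x) • fderiv ℝ W x := by
      have := (dg.hasDerivAt.comp_hasFDerivAt x dW.hasFDerivAt).fderiv
      simpa [Function.comp_def] using this
    rw [vdiv_smul (hc'.differentiable one_ne_zero x) dy, vdiv_smul da dy,
      fderiv_fun_sub (dW.fun_mul da) db, fderiv_fun_mul dW da,
      fderiv_fun_mul dψ dgc, dgW]
    simp
    ring
  have h0 := integral_vdiv_eq_zero (hc'.smul hy1) hc.smul_left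
  have i1 : Integrable (fun x => W x * vdiv (fun x => (ψ x * deriv g (W x)) • y x) x) :=
    (hW.continuous.mul (continuous_vdiv (ha.smul hy1))).integrable_of_hasCompactSupport
      (hasCompactSupport_vdiv hc.smul_left).mul_left
  have hfy : HasCompactSupport (fun x => fderiv ℝ ψ x (y x)) :=
    hc.mono fun x hx hx0 => hx (by simp [show y x = 0 from hx0])
  have i2 : Integrable (fun x => ψ x * g (W x) * vdiv y x + g (W x) * fderiv ℝ ψ x (y x)) := by
    refine Integrable.add ?_ ?_
    · exact (hb.continuous.mul (continuous_vdiv hy1)).integrable_of_hasCompactSupport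
        (hasCompactSupport_vdiv hc).mul_left
    · have := hψ1.continuous_fderiv one_ne_zero
      have h1 := hy.continuous
      exact ((hg.continuous.comp hW.continuous).mul
        (by fun_prop : Continuous fun x => fderiv ℝ ψ x (y x))).integrable_of_hasCompactSupport
        hfy.mul_left
  have : ∫ x, vdiv (fun x => (W x * (ψ x * deriv g (W x)) - ψ x * g (W x)) • y x) x = 0 := h0
  simp_rw [key] at this
  rw [integral_sub i1 i2] at this
  linarith

end Divergence

/-! ### Total variation as a supremum over test fields -/

section TotalVariation

variable {n : ℕ} {A B : Set (Eu n)} {u w : Eu n → ℝ}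

theorem testFields_mono (h : A ⊆ B) : testFields A ⊆ testFields B :=
  fun _ hz => ⟨hz.1, hz.2.1, hz.2.2.1.trans h, hz.2.2.2⟩

theorem zero_mem_testFields : (fun _ => 0 : Eu n → Eu n) ∈ testFields A :=
  ⟨contDiff_const, HasCompactSupport.zero, by
    rw [show (fun _ => 0 : Eu n → Eu n) = 0 from rfl, tsupport_zero]; exact empty_subset _, by simp⟩

theorem neg_mem_testFields {z : Eu n → Eu n} (hz : z ∈ testFields A) :
    (fun x => - z x) ∈ testFields A := by
  refine ⟨hz.1.neg, hz.2.1.neg, ?_, fun x => by simpa using hz.2.2.2 x⟩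
  have : tsupport (fun x => - z x) = tsupport z := by simp [tsupport, Function.support_fun_neg]
  rw [this]; exact hz.2.2.1

theorem contDiff_one_of_mem_testFields {z : Eu n → Eu n} (hz : z ∈ testFields A) :
    ContDiff ℝ 1 z := hz.1.of_le (by exact_mod_cast le_top)

theorem continuous_vdiv_of_mem {z : Eu n → Eu n} (hz : z ∈ testFields A) :
    Continuous (vdiv z) := continuous_vdiv (contDiff_one_of_mem_testFields hz)

theorem exists_bound_vdiv {z : Eu n → Eu n} (hz : z ∈ testFields A) :
    ∃ C, ∀ x, ‖vdiv z x‖ ≤ C :=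
  (hasCompactSupport_vdiv hz.2.1).exists_bound_of_continuous (continuous_vdiv_of_mem hz)

theorem integrable_mul_vdiv {μ : Measure (Eu n)} (hu : Integrable u μ) {z : Eu n → Eu n}
    (hz : z ∈ testFields A) : Integrable (fun x => u x * vdiv z x) μ := by
  obtain ⟨C, hC⟩ := exists_bound_vdiv hz
  exact hu.mul_bdd (c := C) (continuous_vdiv_of_mem hz).aestronglyMeasurable
    (ae_of_all _ hC)

theorem setIntegral_mul_vdiv {z : Eu n → Eu n} (hz : z ∈ testFields A) :
    ∫ x in A, u x * vdiv z x = ∫ x, u x * vdiv z x :=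
  setIntegral_eq_integral_of_forall_compl_eq_zero fun x hx => by
    rw [vdiv_eq_zero fun h => hx (hz.2.2.1 h), mul_zero]

theorem setIntegral_mul_vdiv_of_subset (hAB : A ⊆ B) {z : Eu n → Eu n} (hz : z ∈ testFields A) :
    ∫ x in B, u x * vdiv z x = ∫ x in A, u x * vdiv z x := by
  rw [setIntegral_mul_vdiv hz, setIntegral_mul_vdiv (testFields_mono hAB hz)]

theorem totalVar_mono (hAB : A ⊆ B) : totalVar A u ≤ totalVar B u :=
  iSup₂_le fun z hz => by
    rw [← setIntegral_mul_vdiv_of_subset hAB hz]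
    exact le_iSup₂ (f := fun z (_ : z ∈ testFields B) =>
      ENNReal.ofReal (∫ x in B, u x * vdiv z x)) z (testFields_mono hAB hz)

theorem integral_le_totalVar (hu : totalVar A u < ∞) {z : Eu n → Eu n} (hz : z ∈ testFields A) :
    ∫ x in A, u x * vdiv z x ≤ (totalVar A u).toReal := by
  refine (ENNReal.ofReal_le_iff_le_toReal hu.ne).1 ?_
  exact le_iSup₂ (f := fun z (_ : z ∈ testFields A) =>
      ENNReal.ofReal (∫ x in A, u x * vdiv z x)) z hz

theorem totalVar_le_ofReal {c : ℝ} (h : ∀ z ∈ testFields A, ∫ x in A, u x * vdiv z x ≤ c) :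
    totalVar A u ≤ ENNReal.ofReal c :=
  iSup₂_le fun z hz => ENNReal.ofReal_le_ofReal (h z hz)

theorem nonneg_of_forall_testFields {c : ℝ}
    (h : ∀ z ∈ testFields A, ∫ x in A, u x * vdiv z x ≤ c) : 0 ≤ c := by
  simpa [vdiv] using h _ zero_mem_testFields

theorem totalVar_lt_top {c : ℝ} (h : ∀ z ∈ testFields A, ∫ x in A, u x * vdiv z x ≤ c) :
    totalVar A u < ∞ := (totalVar_le_ofReal h).trans_lt ENNReal.ofReal_lt_top

theorem toReal_totalVar_le {c : ℝ} (h : ∀ z ∈ testFields A, ∫ x in A, u x * vdiv z x ≤ c) :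
    (totalVar A u).toReal ≤ c :=
  ENNReal.toReal_le_of_le_ofReal (nonneg_of_forall_testFields h) (totalVar_le_ofReal h)

theorem totalVar_congr (h : u =ᵐ[volume.restrict A] w) : totalVar A u = totalVar A w := by
  unfold totalVar
  congr! 4 with z hz
  refine integral_congr_ae ?_
  filter_upwards [h] with x hx
  rw [hx]

/-- Joint suprema over pairs of test fields. -/
theorem totalVar_pair {c : ℝ} (h : ∀ z₁ ∈ testFields A, ∀ z₂ ∈ testFields B,
    (∫ x in A, u x * vdiv z₁ x) + ∫ x in B, w x * vdiv z₂ x ≤ c) :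
    totalVar A u < ∞ ∧ totalVar B w < ∞ ∧
      (totalVar A u).toReal + (totalVar B w).toReal ≤ c := by
  have h1 : ∀ z₂ ∈ testFields B, ∀ z₁ ∈ testFields A,
      ∫ x in A, u x * vdiv z₁ x ≤ c - ∫ x in B, w x * vdiv z₂ x := fun z₂ h₂ z₁ h₁ => by
    linarith [h z₁ h₁ z₂ h₂]
  have h2 : ∀ z₂ ∈ testFields B, ∫ x in B, w x * vdiv z₂ x ≤ c - (totalVar A u).toReal :=
    fun z₂ h₂ => by linarith [toReal_totalVar_le (h1 z₂ h₂)]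
  exact ⟨totalVar_lt_top (h1 _ zero_mem_testFields), totalVar_lt_top h2, by
    linarith [toReal_totalVar_le h2]⟩

theorem toReal_totalVar_lincomb (a b : ℝ) (ha : 0 ≤ a) (hb : 0 ≤ b)
    (hu : MemBV A u) (hw : MemBV A w) :
    MemBV A (fun x => a * u x + b * w x) ∧ (totalVar A (fun x => a * u x + b * w x)).toReal ≤
      a * (totalVar A u).toReal + b * (totalVar A w).toReal := by
  have key : ∀ z ∈ testFields A, ∫ x in A, (a * u x + b * w x) * vdiv z x ≤
      a * (totalVar A u).toReal + b * (totalVar A w).toReal := by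
    intro z hz
    have e : (fun x => (a * u x + b * w x) * vdiv z x) =
        fun x => a * (u x * vdiv z x) + b * (w x * vdiv z x) := by ext x; ring
    rw [e, integral_add ((integrable_mul_vdiv hu.1 hz).const_mul a)
      ((integrable_mul_vdiv hw.1 hz).const_mul b), integral_const_mul, integral_const_mul]
    exact add_le_add (mul_le_mul_of_nonneg_left (integral_le_totalVar hu.2 hz) ha)
      (mul_le_mul_of_nonneg_left (integral_le_totalVar hw.2 hz) hb)
  exact ⟨⟨(hu.1.const_mul a).add (hw.1.const_mul b), totalVar_lt_top key⟩, toReal_totalVar_le key⟩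

theorem totalVar_neg : totalVar A (fun x => - u x) = totalVar A u := by
  have key : ∀ u : Eu n → ℝ, totalVar A (fun x => - u x) ≤ totalVar A u := fun u => by
    refine iSup₂_le fun z hz => ?_
    have e : ∫ x in A, - u x * vdiv z x = ∫ x in A, u x * vdiv (fun x => - z x) x := by
      refine integral_congr_ae (ae_of_all _ fun x => ?_)
      simp [vdiv_neg]
    rw [e]
    exact le_iSup₂ (f := fun z (_ : z ∈ testFields A) =>
      ENNReal.ofReal (∫ x in A, u x * vdiv z x)) _ (neg_mem_testFields hz)
  refine le_antisymm (key u) ?_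
  simpa using key (fun x => - u x)

theorem MemBV.neg (hu : MemBV A u) : MemBV A (fun x => - u x) :=
  ⟨hu.1.neg, totalVar_neg.trans_lt hu.2⟩

theorem MemBV.mono (hu : MemBV B u) (hAB : A ⊆ B) : MemBV A u :=
  ⟨hu.1.mono_set hAB, (totalVar_mono hAB).trans_lt hu.2⟩

theorem MemBV.congr (hu : MemBV A u) (h : u =ᵐ[volume.restrict A] w) : MemBV A w :=
  ⟨hu.1.congr h, totalVar_congr h ▸ hu.2⟩

theorem totalVar_const (c : ℝ) : totalVar A (fun _ => c) = 0 := by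
  refine le_antisymm (iSup₂_le fun z hz => ?_) zero_le
  rw [setIntegral_mul_vdiv (u := fun _ => c) hz, integral_const_mul,
    integral_vdiv_eq_zero (contDiff_one_of_mem_testFields hz) hz.2.1]
  simp

theorem memBV_const (hA : volume A ≠ ∞) (c : ℝ) : MemBV A (fun _ => c) :=
  ⟨by simp [hA.lt_top], by rw [totalVar_const]; exact ENNReal.zero_lt_top⟩

theorem tendsto_setIntegral_mul_of_eLpNorm {ι : Type*} {l : Filter ι} {μ : Measure (Eu n)}
    {f : ι → Eu n → ℝ} {b : Eu n → ℝ} (hb : AEStronglyMeasurable b μ) {C : ℝ}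
    (hC : ∀ x, ‖b x‖ ≤ C) (hu : Integrable u μ) (hf : ∀ᶠ i in l, Integrable (f i) μ)
    (h : Tendsto (fun i => eLpNorm (fun x => f i x - u x) 1 μ) l (𝓝 0)) :
    Tendsto (fun i => ∫ x, f i x * b x ∂μ) l (𝓝 (∫ x, u x * b x ∂μ)) := by
  refine tendsto_integral_of_L1 _ (hu.mul_bdd (c := C) hb (ae_of_all _ hC)).aestronglyMeasurable
    (hf.mono fun i hi => hi.mul_bdd (c := C) hb (ae_of_all _ hC)) ?_
  have hC0 : 0 ≤ C := (norm_nonneg _).trans (hC 0)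
  have h2 : Tendsto (fun i => ENNReal.ofReal C * eLpNorm (fun x => f i x - u x) 1 μ) l (𝓝 0) := by
    simpa using ENNReal.Tendsto.const_mul h (Or.inr ENNReal.ofReal_ne_top)
  refine tendsto_of_tendsto_of_tendsto_of_le_of_le tendsto_const_nhds h2 (fun _ => zero_le)
    fun i => ?_
  rw [eLpNorm_one_eq_lintegral_enorm, ← lintegral_const_mul' _ _ ENNReal.ofReal_ne_top]
  refine lintegral_mono fun x => ?_
  rw [← sub_mul, enorm_mul, mul_comm]
  gcongr
  rw [← ofReal_norm]
  exact ENNReal.ofReal_le_ofReal (hC x)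

/-- Lower semicontinuity: each test field gives an `L¹`-continuous functional. The bounds `c i` may
vary with `i`, so that convergent fidelity and error terms can be placed on the right-hand side. -/
theorem totalVar_le_of_tendsto {ι : Type*} {l : Filter ι} [l.NeBot] {f : ι → Eu n → ℝ}
    {c : ι → ℝ} {c₀ : ℝ} (hu : IntegrableOn u A) (hf : ∀ᶠ i in l, MemBV A (f i))
    (h : Tendsto (fun i => eLpNorm (fun x => f i x - u x) 1 (volume.restrict A)) l (𝓝 0))
    (hc : ∀ᶠ i in l, (totalVar A (f i)).toReal ≤ c i) (hc₀ : Tendsto c l (𝓝 c₀)) :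
    MemBV A u ∧ (totalVar A u).toReal ≤ c₀ := by
  have key : ∀ z ∈ testFields A, ∫ x in A, u x * vdiv z x ≤ c₀ := by
    intro z hz
    obtain ⟨C, hC⟩ := exists_bound_vdiv hz
    refine le_of_tendsto_of_tendsto (tendsto_setIntegral_mul_of_eLpNorm
      (continuous_vdiv_of_mem hz).aestronglyMeasurable hC hu (hf.mono fun i hi => hi.1) h) hc₀ ?_
    filter_upwards [hf, hc] with i hi hci
    exact (integral_le_totalVar hi.2 hz).trans hci
  exact ⟨⟨hu, totalVar_lt_top key⟩, toReal_totalVar_le key⟩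

end TotalVariation

end TVObstacle

namespace TVObstacle

/-! ### Mollification and total variation -/

section Mollification

variable {n : ℕ}

/-- A sequence of smooth bump functions shrinking to the origin. -/
noncomputable def bumpSeq (n j : ℕ) : ContDiffBump (0 : Eu n) where
  rIn := 1 / (2 * ((j : ℝ) + 1))
  rOut := 1 / ((j : ℝ) + 1)
  rIn_pos := by positivity
  rIn_lt_rOut := by
    apply one_div_lt_one_div_of_lt <;> linarith [(Nat.cast_nonneg j : (0 : ℝ) ≤ j)]

theorem tendsto_bumpSeq_rOut : Tendsto (fun j => (bumpSeq n j).rOut) atTop (𝓝 0) :=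
  tendsto_one_div_add_atTop_nhds_zero_nat

/-- Mollification at scale `1 / (j + 1)`. -/
noncomputable def moll {n : ℕ} (j : ℕ) (U : Eu n → ℝ) : Eu n → ℝ :=
  convolution ((bumpSeq n j).normed volume) U (ContinuousLinearMap.lsmul ℝ ℝ) volume

variable {U V : Eu n → ℝ}

theorem moll_apply (j : ℕ) (U : Eu n → ℝ) (x : Eu n) :
    moll j U x = ∫ t, (bumpSeq n j).normed volume t * U (x - t) := by
  simp [moll, convolution_def]

theorem contDiff_moll (hU : Integrable U) (j : ℕ) {k : ℕ∞} : ContDiff ℝ k (moll j U) :=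
  HasCompactSupport.contDiff_convolution_left _ (bumpSeq n j).hasCompactSupport_normed
    (bumpSeq n j).contDiff_normed hU.locallyIntegrable

theorem integrable_moll (hU : Integrable U) (j : ℕ) : Integrable (moll j U) :=
  (bumpSeq n j).integrable_normed.integrable_convolution _ hU

theorem integrable_moll_integrand (hU : Integrable U) (j : ℕ) (x : Eu n) :
    Integrable (fun t => (bumpSeq n j).normed volume t * U (x - t)) := by
  exact (HasCompactSupport.convolutionExists_left (ContinuousLinearMap.lsmul ℝ ℝ)
    (bumpSeq n j).hasCompactSupport_normed (bumpSeq n j).continuous_normed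
    hU.locallyIntegrable x)

theorem moll_sub (hU : Integrable U) (hV : Integrable V) (j : ℕ) (x : Eu n) :
    moll j (fun x => U x - V x) x = moll j U x - moll j V x := by
  simp only [moll_apply]
  rw [← integral_sub (integrable_moll_integrand hU j x) (integrable_moll_integrand hV j x)]
  simp [mul_sub]

theorem norm_moll_le (j : ℕ) (x : Eu n) : ‖moll j U x‖ ≤ moll j (fun x => ‖U x‖) x := by
  simp only [moll_apply]
  refine (norm_integral_le_integral_norm _).trans_eq ?_
  refine integral_congr_ae (ae_of_all _ fun t => ?_)
  simp [abs_of_nonneg ((bumpSeq n j).nonneg_normed t)]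

theorem integral_norm_moll_le (hU : Integrable U) (j : ℕ) :
    ∫ x, ‖moll j U x‖ ≤ ∫ x, ‖U x‖ := by
  refine (integral_mono (integrable_moll hU j).norm (integrable_moll hU.norm j)
    (norm_moll_le j)).trans_eq ?_
  unfold moll
  rw [integral_convolution _ (bumpSeq n j).integrable_normed hU.norm,
    (bumpSeq n j).integral_normed]
  simp

theorem tendsto_integral_norm_moll_sub_of_continuous (hU : Continuous U)
    (hc : HasCompactSupport U) :
    Tendsto (fun j => ∫ x, ‖moll j U x - U x‖) atTop (𝓝 0) := by
  have hUi : Integrable U := hU.integrable_of_hasCompactSupport hc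
  obtain ⟨C, hC⟩ := hc.exists_bound_of_continuous hU
  have hC0 : 0 ≤ C := (norm_nonneg _).trans (hC 0)
  have hlim : ∀ x, Tendsto (fun j => ‖moll j U x - U x‖) atTop (𝓝 0) := fun x => by
    have := ContDiffBump.convolution_tendsto_right_of_continuous (μ := volume)
      (tendsto_bumpSeq_rOut (n := n)) hU x
    simpa [moll] using (this.sub_const (U x)).norm
  set K := Metric.cthickening 1 (tsupport U)
  have hK : IsCompact K := hc.cthickening
  have hz : ∀ j x, x ∉ K → moll j U x = 0 := by
    intro j x hx
    rw [moll_apply]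
    refine integral_eq_zero_of_ae (ae_of_all _ fun t => ?_)
    by_cases ht : t ∈ Metric.ball (0 : Eu n) (bumpSeq n j).rOut
    · have : U (x - t) = 0 := by
        by_contra h
        refine hx (Metric.mem_cthickening_of_dist_le x (x - t) 1 _ (subset_tsupport _ h) ?_)
        rw [dist_eq_norm, sub_sub_cancel]
        have h1 : (bumpSeq n j).rOut ≤ 1 := by
          change 1 / ((j : ℝ) + 1) ≤ 1
          rw [div_le_one (by positivity)]
          linarith [(Nat.cast_nonneg j : (0 : ℝ) ≤ j)]
        linarith [mem_ball_zero_iff.1 ht]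
      simp [this]
    · rw [← (bumpSeq n j).support_normed_eq (μ := volume), Function.notMem_support] at ht
      simp [ht]
  have hb : ∀ j x, ‖moll j U x‖ ≤ C := fun j x => by
    refine (norm_moll_le j x).trans ?_
    rw [moll_apply, ← mul_one C, ← (bumpSeq n j).integral_normed (μ := volume),
      ← integral_const_mul]
    refine integral_mono (integrable_moll_integrand hUi.norm j x)
      ((bumpSeq n j).integrable_normed.const_mul C) fun t => ?_
    dsimp only
    rw [mul_comm]
    exact mul_le_mul_of_nonneg_right (hC _) ((bumpSeq n j).nonneg_normed t)
  have h0 := tendsto_integral_of_dominated_convergence (μ := volume)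
    (F := fun j x => ‖moll j U x - U x‖) (f := fun _ => 0) (K.indicator fun _ => 2 * C)
    (fun j => ((integrable_moll hUi j).sub hUi).norm.aestronglyMeasurable)
    ((integrable_indicator_iff hK.measurableSet).2
      (integrableOn_const hK.measure_lt_top.ne)) (fun j => ae_of_all _ fun x => ?_)
    (ae_of_all _ hlim)
  · simpa using h0
  · by_cases hx : x ∈ K
    · rw [indicator_of_mem hx, norm_norm]
      exact (norm_sub_le _ _).trans (by linarith [hb j x, hC x])
    · have : U x = 0 := by
        by_contra h
        exact hx (Metric.self_subset_cthickening _ (subset_tsupport _ h))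
      simp [indicator_of_notMem hx, hz j x hx, this]

theorem tendsto_integral_norm_moll_sub (hU : Integrable U) :
    Tendsto (fun j => ∫ x, ‖moll j U x - U x‖) atTop (𝓝 0) := by
  rw [Metric.tendsto_atTop]
  intro ε hε
  obtain ⟨g, hgc, hg, hgcont, hgi⟩ :=
    hU.exists_hasCompactSupport_integral_sub_le (show 0 < ε / 4 by positivity)
  obtain ⟨N, hN⟩ := Metric.tendsto_atTop.1
    (tendsto_integral_norm_moll_sub_of_continuous hgcont hgc) (ε / 4) (by positivity)
  refine ⟨N, fun j hj => ?_⟩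
  have h1 := hN j hj
  rw [dist_zero_right, Real.norm_of_nonneg (integral_nonneg fun _ => norm_nonneg _)] at h1 ⊢
  have hUg := hU.sub hgi
  have h2 := integral_norm_moll_le (j := j) hUg
  have i1 : Integrable fun x => ‖moll j (U - g) x‖ := (integrable_moll hUg j).norm
  have i2 : Integrable fun x => ‖moll j g x - g x‖ := ((integrable_moll hgi j).sub hgi).norm
  have i3 : Integrable fun x => ‖U x - g x‖ := hUg.norm
  have : ∫ x, ‖moll j U x - U x‖ ≤
      ∫ x, (‖moll j (U - g) x‖ + ‖moll j g x - g x‖ + ‖U x - g x‖) := by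
    refine integral_mono ((integrable_moll hU j).sub hU).norm ((i1.add i2).add hUg.norm)
      fun x => ?_
    dsimp only
    have e : moll j U x - U x = moll j (U - g) x + (moll j g x - g x) - (U x - g x) := by
      have := moll_sub hU hgi j x
      change moll j (U - g) x = _ at this
      rw [this]; ring
    rw [e]
    exact (norm_sub_le _ _).trans (add_le_add_left (norm_add_le _ _) _)
  have e3 : ∫ x, (‖moll j (U - g) x‖ + ‖moll j g x - g x‖ + ‖U x - g x‖) =
      (∫ x, ‖moll j (U - g) x‖) + (∫ x, ‖moll j g x - g x‖) + ∫ x, ‖U x - g x‖ := by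
    have i12 : Integrable fun x => ‖moll j (U - g) x‖ + ‖moll j g x - g x‖ := i1.add i2
    rw [← integral_add i1 i2, ← integral_add i12 i3]
  simp only [Pi.sub_apply] at h2
  linarith

theorem tendsto_eLpNorm_moll_sub (hU : Integrable U) :
    Tendsto (fun j => eLpNorm (fun x => moll j U x - U x) 1 volume) atTop (𝓝 0) := by
  have h := ENNReal.tendsto_ofReal (tendsto_integral_norm_moll_sub hU)
  rw [ENNReal.ofReal_zero] at h
  refine h.congr fun j => ?_
  rw [eLpNorm_one_eq_lintegral_enorm]
  exact ofReal_integral_norm_eq_lintegral_enorm ((integrable_moll hU j).sub hU)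

/-- By Fubini, testing a mollification against `z` averages the tests of `U` against translates of
`z`. Once the scale is smaller than the distance from `K` to the complement of `A`, all these
translates are test fields in `A`. The threshold depends only on `K`, so the estimate is uniform in
`z`; this matters because it is later applied to fields that depend on `j`. -/
theorem eventually_integral_moll_mul_vdiv_le {A K : Set (Eu n)} (hA : IsOpen A)
    (hK : IsCompact K) (hKA : K ⊆ A) (hU : Integrable U) (hTV : totalVar A U < ∞) :
    ∀ᶠ j in atTop, ∀ z ∈ testFields K,
      ∫ x, moll j U x * vdiv z x ≤ (totalVar A U).toReal := by
  obtain ⟨δ, hδ, hδA⟩ := hK.exists_thickening_subset_open hA hKA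
  filter_upwards [(tendsto_order.1 (tendsto_bumpSeq_rOut (n := n))).2 δ hδ] with j hj z hz
  set ρ := (bumpSeq n j).normed (volume : Measure (Eu n))
  have hρ : Integrable ρ := (bumpSeq n j).integrable_normed
  obtain ⟨C, hC⟩ := exists_bound_vdiv hz
  have hF : Integrable (fun p : Eu n × Eu n => ρ p.2 * U (p.1 - p.2) * vdiv z p.1)
      (volume.prod volume) := by
    have := hρ.convolution_integrand (ContinuousLinearMap.lsmul ℝ ℝ) hU
    exact this.mul_bdd (c := C) ((continuous_vdiv_of_mem hz).comp
      continuous_fst).aestronglyMeasurable (ae_of_all _ fun p => hC p.1)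
  have e1 : ∫ x, moll j U x * vdiv z x = ∫ t, ρ t * ∫ x, U x * vdiv z (x + t) := by
    calc ∫ x, moll j U x * vdiv z x = ∫ x, ∫ t, ρ t * U (x - t) * vdiv z x := by
          simp_rw [moll_apply, integral_mul_const]; rfl
      _ = ∫ t, ∫ x, ρ t * U (x - t) * vdiv z x := integral_integral_swap hF
      _ = _ := by
          refine integral_congr_ae (ae_of_all _ fun t => ?_)
          dsimp only
          rw [← integral_const_mul,
            ← integral_sub_right_eq_self (fun x => ρ t * (U x * vdiv z (x + t))) t]
          simp [mul_assoc]
  have hle : ∀ t, ρ t * (∫ x, U x * vdiv z (x + t)) ≤ ρ t * (totalVar A U).toReal := by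
    intro t
    by_cases ht : ρ t = 0
    · simp [ht]
    · refine mul_le_mul_of_nonneg_left ?_ ((bumpSeq n j).nonneg_normed t)
      have ht' : ‖t‖ < δ := by
        have h1 : t ∈ Function.support ρ := ht
        rw [(bumpSeq n j).support_normed_eq, mem_ball_zero_iff] at h1
        exact h1.trans hj
      have hsupp : tsupport (fun x => z (x + t)) = (fun x => x + t) ⁻¹' tsupport z := by
        have := (Homeomorph.addRight t).isOpenMap.preimage_closure_eq_closure_preimage
          (Homeomorph.addRight t).continuous (Function.support z)
        exact this.symm
      have hz' : (fun x => z (x + t)) ∈ testFields A := by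
        refine ⟨hz.1.comp (contDiff_id.add contDiff_const),
          hz.2.1.comp_homeomorph (Homeomorph.addRight t), ?_, fun x => hz.2.2.2 _⟩
        rw [hsupp]
        intro x hx
        refine hδA (Metric.mem_thickening_iff.2 ⟨x + t, hz.2.2.1 hx, ?_⟩)
        simpa [dist_eq_norm] using ht'
      have := integral_le_totalVar hTV hz'
      rw [setIntegral_mul_vdiv hz'] at this
      simpa only [vdiv_comp_add] using this
  rw [e1]
  have i1 : Integrable (fun t => ρ t * ∫ x, U x * vdiv z (x + t)) := by
    refine hρ.mul_bdd (c := C * ∫ x, ‖U x‖) ?_ (ae_of_all _ fun t => ?_)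
    · have hc : Continuous fun p : Eu n × Eu n => vdiv z (p.2 + p.1) :=
        (continuous_vdiv_of_mem hz).comp (by fun_prop)
      exact AEStronglyMeasurable.integral_prod_right'
        (f := fun p : Eu n × Eu n => U p.2 * vdiv z (p.2 + p.1))
        (hU.aestronglyMeasurable.comp_snd.mul hc.aestronglyMeasurable)
    · rw [← integral_const_mul]
      refine norm_integral_le_of_norm_le (hU.norm.const_mul C) (ae_of_all _ fun x => ?_)
      rw [norm_mul, mul_comm]
      exact mul_le_mul_of_nonneg_right (hC _) (norm_nonneg _)
  calc ∫ t, ρ t * ∫ x, U x * vdiv z (x + t) ≤ ∫ t, ρ t * (totalVar A U).toReal :=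
        integral_mono i1 (hρ.mul_const _) hle
    _ = (totalVar A U).toReal := by
        rw [integral_mul_const, (bumpSeq n j).integral_normed, one_mul]

end Mollification

end TVObstacle

/-! ### Profiles, cutoffs and the exchange inequality -/

namespace TVObstacle

/-- Smooth nondecreasing `1`-Lipschitz functions vanishing at `0`. -/
structure IsProfile (g : ℝ → ℝ) : Prop where
  contDiff : ContDiff ℝ ((⊤ : ℕ∞) : WithTop ℕ∞) g
  map_zero : g 0 = 0
  deriv_nonneg : ∀ s, 0 ≤ deriv g s
  deriv_le_one : ∀ s, deriv g s ≤ 1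

namespace IsProfile

variable {g : ℝ → ℝ} (hg : IsProfile g)
include hg

theorem differentiable : Differentiable ℝ g := hg.contDiff.differentiable (by simp)

theorem continuous : Continuous g := hg.contDiff.continuous

theorem monotone : Monotone g := monotone_of_deriv_nonneg hg.differentiable hg.deriv_nonneg

theorem abs_sub_le (a b : ℝ) : |g a - g b| ≤ |a - b| := by
  have h : LipschitzWith 1 g := lipschitzWith_of_nnnorm_deriv_le hg.differentiable fun s => by
    rw [← NNReal.coe_le_coe, coe_nnnorm, Real.norm_of_nonneg (hg.deriv_nonneg s)]
    exact hg.deriv_le_one s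
  simpa [Real.dist_eq] using h.dist_le_mul a b

theorem abs_le (a : ℝ) : |g a| ≤ |a| := by simpa [hg.map_zero] using hg.abs_sub_le a 0

theorem nonneg {a : ℝ} (ha : 0 ≤ a) : 0 ≤ g a := hg.map_zero ▸ hg.monotone ha

theorem nonpos {a : ℝ} (ha : a ≤ 0) : g a ≤ 0 := hg.map_zero ▸ hg.monotone ha

theorem le_self {a : ℝ} (ha : 0 ≤ a) : g a ≤ a := by
  simpa [abs_of_nonneg ha] using (le_abs_self _).trans (hg.abs_le a)

theorem self_le {a : ℝ} (ha : a ≤ 0) : a ≤ g a := by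
  have := (neg_abs_le _).trans' (neg_le_neg (hg.abs_le a))
  rwa [abs_of_nonpos ha, neg_neg] at this

end IsProfile

theorem isProfile_id : IsProfile (fun s => s) :=
  ⟨contDiff_id, rfl, by simp, by simp⟩

section Exchange

variable {n : ℕ} {A B : Set (Eu n)} {ψ : Eu n → ℝ} {g : ℝ → ℝ}

/-- Smooth cutoffs with compact support and values in `[0, 1]`. -/
structure IsCutoff (ψ : Eu n → ℝ) : Prop where
  contDiff : ContDiff ℝ ((⊤ : ℕ∞) : WithTop ℕ∞) ψ
  hasCompactSupport : HasCompactSupport ψ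
  nonneg : ∀ x, 0 ≤ ψ x
  le_one : ∀ x, ψ x ≤ 1

theorem IsCutoff.contDiff_one (hψ : IsCutoff ψ) : ContDiff ℝ 1 ψ :=
  hψ.contDiff.of_le (by exact_mod_cast le_top)

theorem IsCutoff.continuous_fderiv (hψ : IsCutoff ψ) : Continuous (fderiv ℝ ψ) :=
  hψ.contDiff_one.continuous_fderiv one_ne_zero

theorem IsCutoff.exists_bound_fderiv (hψ : IsCutoff ψ) : ∃ C, ∀ x, ‖fderiv ℝ ψ x‖ ≤ C :=
  (hψ.hasCompactSupport.fderiv ℝ).exists_bound_of_continuous hψ.continuous_fderiv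

theorem fderiv_eq_zero_of_notMem_tsupport {x : Eu n} (hx : x ∉ tsupport ψ) :
    fderiv ℝ ψ x = 0 := by
  by_contra h
  exact hx (support_fderiv_subset ℝ (f := ψ) h)

/-- At each point the new field is a convex combination of `z₁` and `z₂`, so its norm stays at most
one. Its support lies in a compact set that does not depend on `θ`. -/
theorem exchange_field_mem {z₁ z₂ : Eu n → Eu n} {θ : Eu n → ℝ}
    (hz₁ : z₁ ∈ testFields A) (hz₂ : z₂ ∈ testFields B)
    (hθ : ContDiff ℝ ((⊤ : ℕ∞) : WithTop ℕ∞) θ) (hθ0 : ∀ x, 0 ≤ θ x) (hθ1 : ∀ x, θ x ≤ 1)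
    (hc : HasCompactSupport ψ) (hθψ : ∀ x, x ∉ tsupport ψ → θ x = 0) :
    (fun x => z₁ x + θ x • (z₂ x - z₁ x)) ∈ testFields (tsupport z₁ ∪ tsupport ψ) := by
  have hK : IsClosed (tsupport z₁ ∪ tsupport ψ) :=
    (isClosed_tsupport _).union (isClosed_tsupport _)
  have hs : tsupport (fun x => z₁ x + θ x • (z₂ x - z₁ x)) ⊆ tsupport z₁ ∪ tsupport ψ := by
    refine closure_minimal (fun x hx => ?_) hK
    by_contra h
    rw [mem_union, not_or] at h
    refine hx ?_
    simp [image_eq_zero_of_notMem_tsupport h.1, hθψ x h.2]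
  refine ⟨hz₁.1.add (hθ.smul (hz₂.1.sub hz₁.1)),
    (hz₁.2.1.isCompact.union hc.isCompact).of_isClosed_subset (isClosed_tsupport _) hs, hs,
    fun x => ?_⟩
  have e : z₁ x + θ x • (z₂ x - z₁ x) = (1 - θ x) • z₁ x + θ x • z₂ x := by
    rw [smul_sub, sub_smul, one_smul]; abel
  dsimp only
  rw [e]
  refine (norm_add_le _ _).trans ?_
  rw [norm_smul, norm_smul, Real.norm_of_nonneg (hθ0 x),
    Real.norm_of_nonneg (sub_nonneg.2 (hθ1 x))]
  nlinarith [hz₁.2.2.2 x, hz₂.2.2.2 x, hθ0 x, hθ1 x]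

theorem integrable_profile_comp {μ : Measure (Eu n)} {W : Eu n → ℝ} (hg : IsProfile g)
    (hW : Integrable W μ) : Integrable (fun x => g (W x)) μ :=
  hW.mono (hg.continuous.comp_aestronglyMeasurable hW.aestronglyMeasurable)
    (ae_of_all _ fun x => hg.abs_le (W x))

theorem tendsto_eLpNorm_profile_comp {μ : Measure (Eu n)} (hg : IsProfile g)
    {U V : Eu n → ℝ} {F G : ℕ → Eu n → ℝ}
    (hFm : ∀ j, AEStronglyMeasurable (fun x => F j x - U x) μ)
    (hGm : ∀ j, AEStronglyMeasurable (fun x => G j x - V x) μ)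
    (hF : Tendsto (fun j => eLpNorm (fun x => F j x - U x) 1 μ) atTop (𝓝 0))
    (hG : Tendsto (fun j => eLpNorm (fun x => G j x - V x) 1 μ) atTop (𝓝 0)) :
    Tendsto (fun j => eLpNorm (fun x => g (F j x - G j x) - g (U x - V x)) 1 μ) atTop (𝓝 0) := by
  have h := hF.add hG
  rw [add_zero] at h
  refine tendsto_of_tendsto_of_tendsto_of_le_of_le tendsto_const_nhds h (fun _ => zero_le)
    fun j => ?_
  refine (eLpNorm_mono (g := fun x => (F j x - U x) - (G j x - V x)) fun x => ?_).trans
    (eLpNorm_sub_le (hFm j) (hGm j) le_rfl)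
  refine (hg.abs_sub_le _ _).trans_eq ?_
  rw [Real.norm_eq_abs]
  congr 1
  ring

/-- Take `θ = ψ g'(P - Q)`, which lies in `[0, 1]`, and test `P` with `z₁ + θ (z₂ - z₁)` and `Q`
with `z₂ + θ (z₁ - z₂)`. The extra terms add up to the integral of `(P - Q) div (θ (z₂ - z₁))`, and
`integral_mul_vdiv_smul_comp` turns this into an expression in `g(P - Q)` without derivatives of `P`
or `Q`, ready for passage to nonsmooth functions. -/
theorem exchange_smooth {P Q : Eu n → ℝ} (hP : ContDiff ℝ ((⊤ : ℕ∞) : WithTop ℕ∞) P)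
    (hQ : ContDiff ℝ ((⊤ : ℕ∞) : WithTop ℕ∞) Q) (iP : Integrable P) (iQ : Integrable Q)
    (hψ : IsCutoff ψ) (hg : IsProfile g) {z₁ z₂ : Eu n → Eu n} (hz₁ : z₁ ∈ testFields A)
    (hz₂ : z₂ ∈ testFields B) {p q : ℝ}
    (h1 : ∀ z ∈ testFields (tsupport z₁ ∪ tsupport ψ), ∫ x, P x * vdiv z x ≤ p)
    (h2 : ∀ z ∈ testFields (tsupport z₂ ∪ tsupport ψ), ∫ x, Q x * vdiv z x ≤ q) :
    (∫ x, P x * vdiv z₁ x) + (∫ x, Q x * vdiv z₂ x) +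
      ∫ x, g (P x - Q x) * (ψ x * (vdiv z₂ x - vdiv z₁ x) + fderiv ℝ ψ x (z₂ x - z₁ x)) ≤
    p + q := by
  set W : Eu n → ℝ := fun x => P x - Q x
  have hW : ContDiff ℝ ((⊤ : ℕ∞) : WithTop ℕ∞) W := hP.sub hQ
  have hg' : ContDiff ℝ ((⊤ : ℕ∞) : WithTop ℕ∞) (deriv g) :=
    (contDiff_infty_iff_deriv.1 hg.contDiff).2
  set θ : Eu n → ℝ := fun x => ψ x * deriv g (W x)
  have hθ : ContDiff ℝ ((⊤ : ℕ∞) : WithTop ℕ∞) θ := hψ.contDiff.mul (hg'.comp hW)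
  have hθ0 : ∀ x, 0 ≤ θ x := fun x => mul_nonneg (hψ.nonneg x) (hg.deriv_nonneg _)
  have hθ1 : ∀ x, θ x ≤ 1 := fun x =>
    mul_le_one₀ (hψ.le_one x) (hg.deriv_nonneg _) (hg.deriv_le_one _)
  have hθψ : ∀ x, x ∉ tsupport ψ → θ x = 0 := fun x hx => by
    simp [θ, image_eq_zero_of_notMem_tsupport hx]
  have k1 := h1 _ (exchange_field_mem hz₁ hz₂ hθ hθ0 hθ1 hψ.hasCompactSupport hθψ)
  have k2 := h2 _ (exchange_field_mem hz₂ hz₁ hθ hθ0 hθ1 hψ.hasCompactSupport hθψ)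
  set y : Eu n → Eu n := fun x => z₂ x - z₁ x
  have hy : ContDiff ℝ ((⊤ : ℕ∞) : WithTop ℕ∞) y := hz₂.1.sub hz₁.1
  have hyc : HasCompactSupport y := by
    have := hz₂.2.1.sub hz₁.2.1
    exact this
  have hdθ : Differentiable ℝ θ := hθ.differentiable (by simp)
  have hdy : Differentiable ℝ y := hy.differentiable (by simp)
  have hdz₁ : Differentiable ℝ z₁ := hz₁.1.differentiable (by simp)
  have hdz₂ : Differentiable ℝ z₂ := hz₂.1.differentiable (by simp)
  have hdθy : Differentiable ℝ (fun x => θ x • y x) := hdθ.smul hdy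
  have e1 : ∀ x, vdiv (fun x => z₁ x + θ x • (z₂ x - z₁ x)) x =
      vdiv z₁ x + vdiv (fun x => θ x • y x) x := fun x => vdiv_add (hdz₁ x) (hdθy x)
  have e2 : ∀ x, vdiv (fun x => z₂ x + θ x • (z₁ x - z₂ x)) x =
      vdiv z₂ x - vdiv (fun x => θ x • y x) x := fun x => by
    rw [← vdiv_sub (hdz₂ x) (hdθy x)]
    congr 1
    ext1 x
    simp only [y]
    rw [← neg_sub (z₂ x) (z₁ x), smul_neg, ← sub_eq_add_neg]
  have hθyc : HasCompactSupport (fun x => θ x • y x) := HasCompactSupport.smul_left (f := θ) hyc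
  have hθyd : ContDiff ℝ 1 (fun x => θ x • y x) := (hθ.smul hy).of_le (by exact_mod_cast le_top)
  obtain ⟨C, hC⟩ := (hasCompactSupport_vdiv hθyc).exists_bound_of_continuous (continuous_vdiv hθyd)
  have iθ : ∀ V : Eu n → ℝ, Integrable V →
      Integrable (fun x => V x * vdiv (fun x => θ x • y x) x) := fun V hV =>
    hV.mul_bdd (c := C) (continuous_vdiv hθyd).aestronglyMeasurable (ae_of_all _ hC)
  simp_rw [e1, mul_add] at k1
  simp_rw [e2, mul_sub] at k2
  rw [integral_add (integrable_mul_vdiv iP hz₁) (iθ _ iP)] at k1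
  rw [integral_sub (integrable_mul_vdiv iQ hz₂) (iθ _ iQ)] at k2
  have key := integral_mul_vdiv_smul_comp (contDiff_infty.1 hW 2) (contDiff_infty.1 hψ.contDiff 2)
    (contDiff_infty.1 hg.contDiff 2) (contDiff_infty.1 hy 2) hyc
  have e3 : ∫ x, W x * vdiv (fun x => (ψ x * deriv g (W x)) • y x) x =
      (∫ x, P x * vdiv (fun x => θ x • y x) x) - ∫ x, Q x * vdiv (fun x => θ x • y x) x := by
    rw [← integral_sub (iθ _ iP) (iθ _ iQ)]
    refine integral_congr_ae (ae_of_all _ fun x => ?_)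
    simp only [W, θ]
    ring
  have e4 : ∫ x, (ψ x * g (W x) * vdiv y x + g (W x) * fderiv ℝ ψ x (y x)) =
      ∫ x, g (W x) * (ψ x * (vdiv z₂ x - vdiv z₁ x) + fderiv ℝ ψ x (y x)) := by
    refine integral_congr_ae (ae_of_all _ fun x => ?_)
    dsimp only
    rw [show vdiv y x = vdiv z₂ x - vdiv z₁ x from vdiv_sub (hdz₂ x) (hdz₁ x)]
    ring
  rw [e3, e4] at key
  linarith

/-- Mollify both functions and pass to the limit. The mixed fields change with the mollification
scale, but their supports stay in a fixed compact set, where `eventually_integral_moll_mul_vdiv_le`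
is uniform. -/
theorem exchange_fields {U U' : Eu n → ℝ} (hA : IsOpen A) (hB : IsOpen B)
    (hU : Integrable U) (hU' : Integrable U') (hTU : totalVar A U < ∞) (hTU' : totalVar B U' < ∞)
    (hψ : IsCutoff ψ) (hψA : tsupport ψ ⊆ A) (hψB : tsupport ψ ⊆ B) (hg : IsProfile g)
    {z₁ z₂ : Eu n → Eu n} (hz₁ : z₁ ∈ testFields A) (hz₂ : z₂ ∈ testFields B) :
    (∫ x, U x * vdiv z₁ x) + (∫ x, U' x * vdiv z₂ x) +
      ∫ x, g (U x - U' x) * (ψ x * (vdiv z₂ x - vdiv z₁ x) + fderiv ℝ ψ x (z₂ x - z₁ x)) ≤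
    (totalVar A U).toReal + (totalVar B U').toReal := by
  set b : Eu n → ℝ := fun x => ψ x * (vdiv z₂ x - vdiv z₁ x) + fderiv ℝ ψ x (z₂ x - z₁ x)
  have hbc : Continuous b := by
    have h1 := continuous_vdiv_of_mem hz₁
    have h2 := continuous_vdiv_of_mem hz₂
    have h3 := hψ.continuous_fderiv
    have h4 := hψ.contDiff.continuous
    have h5 := hz₁.1.continuous
    have h6 := hz₂.1.continuous
    fun_prop
  have hbs : HasCompactSupport b := HasCompactSupport.intro hψ.hasCompactSupport fun x hx => by
    simp [b, image_eq_zero_of_notMem_tsupport hx, fderiv_eq_zero_of_notMem_tsupport hx]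
  obtain ⟨Cb, hCb⟩ := hbs.exists_bound_of_continuous hbc
  obtain ⟨C₁, hC₁⟩ := exists_bound_vdiv hz₁
  obtain ⟨C₂, hC₂⟩ := exists_bound_vdiv hz₂
  have l1 := tendsto_setIntegral_mul_of_eLpNorm (l := atTop)
    (continuous_vdiv_of_mem hz₁).aestronglyMeasurable hC₁ hU
    (Eventually.of_forall fun j => integrable_moll hU j) (tendsto_eLpNorm_moll_sub hU)
  have l2 := tendsto_setIntegral_mul_of_eLpNorm (l := atTop)
    (continuous_vdiv_of_mem hz₂).aestronglyMeasurable hC₂ hU'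
    (Eventually.of_forall fun j => integrable_moll hU' j) (tendsto_eLpNorm_moll_sub hU')
  have l3 := tendsto_setIntegral_mul_of_eLpNorm (l := atTop)
    (u := fun x => g (U x - U' x)) (f := fun j x => g (moll j U x - moll j U' x))
    hbc.aestronglyMeasurable hCb (integrable_profile_comp hg (hU.sub hU'))
    (Eventually.of_forall fun j =>
      integrable_profile_comp hg ((integrable_moll hU j).sub (integrable_moll hU' j)))
    (tendsto_eLpNorm_profile_comp hg
      (fun j => ((integrable_moll hU j).sub hU).aestronglyMeasurable)
      (fun j => ((integrable_moll hU' j).sub hU').aestronglyMeasurable)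
      (tendsto_eLpNorm_moll_sub hU) (tendsto_eLpNorm_moll_sub hU'))
  refine le_of_tendsto ((l1.add l2).add l3) ?_
  filter_upwards [eventually_integral_moll_mul_vdiv_le hA
      (hz₁.2.1.isCompact.union hψ.hasCompactSupport.isCompact) (union_subset hz₁.2.2.1 hψA) hU hTU,
    eventually_integral_moll_mul_vdiv_le hB
      (hz₂.2.1.isCompact.union hψ.hasCompactSupport.isCompact) (union_subset hz₂.2.2.1 hψB)
      hU' hTU'] with j h1 h2
  exact exchange_smooth (contDiff_moll hU j) (contDiff_moll hU' j) (integrable_moll hU j)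
    (integrable_moll hU' j) hψ hg hz₁ hz₂ h1 h2

/-- The gradient term is kept in the form `∇ψ · (z₁ - z₂)` instead of being bounded by `2 |∇ψ|`: the
barrier argument exploits a special choice of `z₂` there. -/
theorem exchange {u w : Eu n → ℝ} (hA : IsOpen A) (hB : IsOpen B) (hu : MemBV A u)
    (hw : MemBV B w) (hψ : IsCutoff ψ) (hψA : tsupport ψ ⊆ A) (hψB : tsupport ψ ⊆ B)
    (hg : IsProfile g) {z₁ z₂ : Eu n → Eu n} (hz₁ : z₁ ∈ testFields A)
    (hz₂ : z₂ ∈ testFields B) :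
    (∫ x in A, (u x - ψ x * g (u x - w x)) * vdiv z₁ x) +
      (∫ x in B, (w x + ψ x * g (u x - w x)) * vdiv z₂ x) ≤
    (totalVar A u).toReal + (totalVar B w).toReal +
      ∫ x, g (u x - w x) * fderiv ℝ ψ x (z₁ x - z₂ x) := by
  set U := A.indicator u
  set V := B.indicator w
  have hU : Integrable U := hu.1.integrable_indicator hA.measurableSet
  have hV : Integrable V := hw.1.integrable_indicator hB.measurableSet
  have eU : U =ᵐ[volume.restrict A] u := indicator_ae_eq_restrict hA.measurableSet
  have eV : V =ᵐ[volume.restrict B] w := indicator_ae_eq_restrict hB.measurableSet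
  have key := exchange_fields hA hB hU hV ((totalVar_congr eU).trans_lt hu.2)
    ((totalVar_congr eV).trans_lt hw.2) hψ hψA hψB hg hz₁ hz₂
  rw [totalVar_congr eU, totalVar_congr eV] at key
  have hUx : ∀ x ∈ tsupport ψ, U x = u x := fun x hx => indicator_of_mem (hψA hx) u
  have hVx : ∀ x ∈ tsupport ψ, V x = w x := fun x hx => indicator_of_mem (hψB hx) w
  have hψ0 : ∀ x, x ∉ tsupport ψ → ψ x = 0 := fun x => image_eq_zero_of_notMem_tsupport
  have e1 : ∫ x in A, (u x - ψ x * g (u x - w x)) * vdiv z₁ x =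
      ∫ x, (U x - ψ x * g (U x - V x)) * vdiv z₁ x := by
    rw [← setIntegral_mul_vdiv (u := fun x => U x - ψ x * g (U x - V x)) hz₁]
    refine setIntegral_congr_fun hA.measurableSet fun x hx => ?_
    by_cases h : x ∈ tsupport ψ
    · simp only [hUx x h, hVx x h]
    · simp [hψ0 x h, U, indicator_of_mem hx]
  have e2 : ∫ x in B, (w x + ψ x * g (u x - w x)) * vdiv z₂ x =
      ∫ x, (V x + ψ x * g (U x - V x)) * vdiv z₂ x := by
    rw [← setIntegral_mul_vdiv (u := fun x => V x + ψ x * g (U x - V x)) hz₂]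
    refine setIntegral_congr_fun hB.measurableSet fun x hx => ?_
    by_cases h : x ∈ tsupport ψ
    · simp only [hUx x h, hVx x h]
    · simp [hψ0 x h, V, indicator_of_mem hx]
  have e3 : ∫ x, g (u x - w x) * fderiv ℝ ψ x (z₁ x - z₂ x) =
      ∫ x, g (U x - V x) * fderiv ℝ ψ x (z₁ x - z₂ x) := by
    refine integral_congr_ae (ae_of_all _ fun x => ?_)
    by_cases h : x ∈ tsupport ψ
    · simp only [hUx x h, hVx x h]
    · simp [fderiv_eq_zero_of_notMem_tsupport h]
  have iG : Integrable fun x => g (U x - V x) := integrable_profile_comp hg (hU.sub hV)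
  have iψG : Integrable fun x => ψ x * g (U x - V x) :=
    iG.bdd_mul (c := 1) hψ.contDiff.continuous.aestronglyMeasurable (ae_of_all _ fun x => by
      rw [Real.norm_of_nonneg (hψ.nonneg x)]; exact hψ.le_one x)
  obtain ⟨C, hC⟩ := hψ.exists_bound_fderiv
  have iF : Integrable fun x => g (U x - V x) * fderiv ℝ ψ x (z₁ x - z₂ x) := by
    have h3 := hψ.continuous_fderiv
    have h5 := hz₁.1.continuous
    have h6 := hz₂.1.continuous
    refine iG.mul_bdd (c := C * 2) (by fun_prop : Continuous fun x =>
      fderiv ℝ ψ x (z₁ x - z₂ x)).aestronglyMeasurable (ae_of_all _ fun x => ?_)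
    refine (ContinuousLinearMap.le_opNorm _ _).trans ?_
    exact mul_le_mul (hC x) ((norm_sub_le _ _).trans
      (by linarith [hz₁.2.2.2 x, hz₂.2.2.2 x])) (norm_nonneg _) ((norm_nonneg _).trans (hC x))
  rw [e1, e2, e3]
  have i1 := integrable_mul_vdiv hU hz₁
  have i2 := integrable_mul_vdiv hV hz₂
  have j1 := integrable_mul_vdiv iψG hz₁
  have j2 := integrable_mul_vdiv iψG hz₂
  simp_rw [sub_mul, add_mul]
  rw [integral_sub i1 j1, integral_add i2 j2]
  have e4 : ∫ x, g (U x - V x) * (ψ x * (vdiv z₂ x - vdiv z₁ x) +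
      fderiv ℝ ψ x (z₂ x - z₁ x)) = (∫ x, ψ x * g (U x - V x) * vdiv z₂ x) -
      (∫ x, ψ x * g (U x - V x) * vdiv z₁ x) -
      ∫ x, g (U x - V x) * fderiv ℝ ψ x (z₁ x - z₂ x) := by
    have j12 : Integrable fun x => ψ x * g (U x - V x) * vdiv z₂ x -
      ψ x * g (U x - V x) * vdiv z₁ x := j2.sub j1
    rw [← integral_sub j2 j1, ← integral_sub j12 iF]
    refine integral_congr_ae (ae_of_all _ fun x => ?_)
    simp only [map_sub]
    ring
  rw [e4] at key
  linarith

theorem totalVar_exchange {u w : Eu n → ℝ} (hA : IsOpen A) (hB : IsOpen B) (hu : MemBV A u)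
    (hw : MemBV B w) (hψ : IsCutoff ψ) (hψA : tsupport ψ ⊆ A) (hψB : tsupport ψ ⊆ B)
    (hg : IsProfile g) :
    MemBV A (fun x => u x - ψ x * g (u x - w x)) ∧ MemBV B (fun x => w x + ψ x * g (u x - w x)) ∧
    (totalVar A (fun x => u x - ψ x * g (u x - w x))).toReal +
      (totalVar B (fun x => w x + ψ x * g (u x - w x))).toReal ≤
    (totalVar A u).toReal + (totalVar B w).toReal +
      2 * ∫ x, ‖fderiv ℝ ψ x‖ * |g (u x - w x)| := by
  have hT : MeasurableSet (tsupport ψ) := (isClosed_tsupport _).measurableSet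
  have hW : IntegrableOn (fun x => u x - w x) (tsupport ψ) :=
    (hu.1.mono_set hψA).sub (hw.1.mono_set hψB)
  have hG : IntegrableOn (fun x => g (u x - w x)) (tsupport ψ) := integrable_profile_comp hg hW
  have iψG : Integrable fun x => ψ x * g (u x - w x) := by
    refine (integrableOn_iff_integrable_of_support_subset (s := tsupport ψ) ?_).1 ?_
    · exact (Function.support_mul_subset_left _ _).trans (subset_tsupport _)
    · exact hG.bdd_mul (c := 1) hψ.contDiff.continuous.aestronglyMeasurable
        (ae_of_all _ fun x => by rw [Real.norm_of_nonneg (hψ.nonneg x)]; exact hψ.le_one x)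
  obtain ⟨C, hC⟩ := hψ.exists_bound_fderiv
  have iF : Integrable fun x => ‖fderiv ℝ ψ x‖ * |g (u x - w x)| := by
    refine (integrableOn_iff_integrable_of_support_subset (s := tsupport ψ) ?_).1 ?_
    · refine (Function.support_mul_subset_left _ _).trans fun x hx => ?_
      by_contra h
      exact hx (by simp [fderiv_eq_zero_of_notMem_tsupport h])
    · exact hG.abs.bdd_mul (c := C) hψ.continuous_fderiv.norm.aestronglyMeasurable
        (ae_of_all _ fun x => by simpa using hC x)
  obtain ⟨t1, t2, t3⟩ := totalVar_pair (A := A) (B := B)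
    (u := fun x => u x - ψ x * g (u x - w x)) (w := fun x => w x + ψ x * g (u x - w x))
    (c := (totalVar A u).toReal + (totalVar B w).toReal +
      2 * ∫ x, ‖fderiv ℝ ψ x‖ * |g (u x - w x)|) fun z₁ hz₁ z₂ hz₂ => by
    refine (exchange hA hB hu hw hψ hψA hψB hg hz₁ hz₂).trans ?_
    gcongr
    rw [← integral_const_mul]
    refine (Real.le_norm_self _).trans (norm_integral_le_of_norm_le (iF.const_mul 2)
      (ae_of_all _ fun x => ?_))
    rw [norm_mul, Real.norm_eq_abs]
    have h1 := (ContinuousLinearMap.le_opNorm (fderiv ℝ ψ x) (z₁ x - z₂ x)).trans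
      (mul_le_mul_of_nonneg_left ((norm_sub_le _ _).trans
        (add_le_add (hz₁.2.2.2 x) (hz₂.2.2.2 x))) (norm_nonneg _))
    nlinarith [mul_le_mul_of_nonneg_left h1 (abs_nonneg (g (u x - w x)))]
  exact ⟨⟨hu.1.sub iψG.integrableOn, t1⟩, ⟨hw.1.add iψG.integrableOn, t2⟩, t3⟩

end Exchange

end TVObstacle

namespace TVObstacle

/-! ### Auxiliary facts on `L^p` convergence -/

section LpTools

variable {α : Type*} [MeasurableSpace α] {μ : Measure α}

theorem exists_tendsto_eLpNorm_of_cauchy {p : ℝ≥0∞} [Fact (1 ≤ p)] {F : ℕ → α → ℝ}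
    (hF : ∀ j, MemLp (F j) p μ)
    (hc : ∀ ε : ℝ, 0 < ε → ∃ N, ∀ i ≥ N, ∀ j ≥ N,
      eLpNorm (fun x => F i x - F j x) p μ ≤ ENNReal.ofReal ε) :
    ∃ u, MemLp u p μ ∧ Tendsto (fun j => eLpNorm (fun x => F j x - u x) p μ) atTop (𝓝 0) := by
  have hcs : CauchySeq fun j => (hF j).toLp (F j) := by
    rw [Metric.cauchySeq_iff]
    intro ε hε
    obtain ⟨N, hN⟩ := hc (ε / 2) (by positivity)
    refine ⟨N, fun i hi j hj => ?_⟩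
    rw [Lp.dist_def]
    have e : eLpNorm (⇑((hF i).toLp (F i)) - ⇑((hF j).toLp (F j))) p μ =
        eLpNorm (fun x => F i x - F j x) p μ :=
      eLpNorm_congr_ae ((hF i).coeFn_toLp.sub (hF j).coeFn_toLp)
    rw [e]
    exact (ENNReal.toReal_le_of_le_ofReal (by positivity) (hN i hi j hj)).trans_lt (by linarith)
  obtain ⟨u, hu⟩ := cauchySeq_tendsto_of_complete hcs
  refine ⟨u, Lp.memLp u, ?_⟩
  have := (Lp.tendsto_Lp_iff_tendsto_eLpNorm'' F hF u (Lp.memLp u)).1 (by simpa using hu)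
  exact this

/-- Hölder's inequality on a finite measure space. -/
theorem tendsto_eLpNorm_of_exponent_le [IsFiniteMeasure μ] {ι : Type*} {l : Filter ι}
    {p q : ℝ≥0∞} (hpq : p ≤ q) (hp : p ≠ 0) {F : ι → α → ℝ}
    (hF : ∀ᶠ i in l, AEStronglyMeasurable (F i) μ)
    (h : Tendsto (fun i => eLpNorm (F i) q μ) l (𝓝 0)) :
    Tendsto (fun i => eLpNorm (F i) p μ) l (𝓝 0) := by
  by_cases hpt : p = ∞
  · have : q = ∞ := top_le_iff.1 (hpt ▸ hpq)
    rw [hpt]; rwa [this] at h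
  have hc : μ univ ^ (1 / p.toReal - 1 / q.toReal) ≠ ∞ := by
    refine ENNReal.rpow_ne_top_of_nonneg ?_ (measure_ne_top _ _)
    by_cases hqt : q = ∞
    · simp [hqt]
    · exact sub_nonneg.2 (one_div_le_one_div_of_le (ENNReal.toReal_pos hp hpt)
        ((ENNReal.toReal_le_toReal hpt hqt).2 hpq))
  have h2 := ENNReal.Tendsto.mul_const (b := μ univ ^ (1 / p.toReal - 1 / q.toReal)) h
    (Or.inr hc)
  rw [zero_mul] at h2
  refine tendsto_of_tendsto_of_tendsto_of_le_of_le' tendsto_const_nhds h2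
    (Eventually.of_forall fun _ => zero_le) ?_
  filter_upwards [hF] with i hi
  exact eLpNorm_le_eLpNorm_mul_rpow_measure_univ hpq hi

theorem eLpNorm_nat_eq {q : ℕ} (hq : q ≠ 0) {g : α → ℝ} (hg : MemLp g q μ) :
    eLpNorm g q μ = ENNReal.ofReal ((∫ x, |g x| ^ q ∂μ) ^ (1 / (q : ℝ))) := by
  rw [hg.eLpNorm_eq_integral_rpow_norm (by exact_mod_cast hq) (ENNReal.natCast_ne_top q)]
  simp

theorem eLpNorm_nat_le {q : ℕ} (hq : q ≠ 0) {g : α → ℝ} (hg : MemLp g q μ) {c : ℝ}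
    (h : ∫ x, |g x| ^ q ∂μ ≤ c) : eLpNorm g q μ ≤ ENNReal.ofReal (c ^ (1 / (q : ℝ))) := by
  rw [eLpNorm_nat_eq hq hg]
  refine ENNReal.ofReal_le_ofReal (Real.rpow_le_rpow ?_ h (by positivity))
  exact integral_nonneg fun x => by positivity

theorem integral_sq_eq {g : α → ℝ} (hg : MemLp g 2 μ) :
    ∫ x, g x ^ 2 ∂μ = (eLpNorm g 2 μ).toReal ^ 2 := by
  have := eLpNorm_nat_eq two_ne_zero (g := g) (μ := μ) (by simpa using hg)
  have h0 : 0 ≤ ∫ x, g x ^ 2 ∂μ := integral_nonneg fun x => by positivity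
  simp only [Nat.cast_ofNat, sq_abs] at this
  rw [this, ENNReal.toReal_ofReal (by positivity), ← Real.sqrt_eq_rpow, Real.sq_sqrt h0]

theorem tendsto_integral_sq {ι : Type*} {l : Filter ι} {F : ι → α → ℝ} {u : α → ℝ}
    (hF : ∀ᶠ i in l, MemLp (F i) 2 μ) (hu : MemLp u 2 μ)
    (h : Tendsto (fun i => eLpNorm (fun x => F i x - u x) 2 μ) l (𝓝 0)) :
    Tendsto (fun i => ∫ x, F i x ^ 2 ∂μ) l (𝓝 (∫ x, u x ^ 2 ∂μ)) := by
  have hr : Tendsto (fun i => (eLpNorm (fun x => F i x - u x) 2 μ).toReal) l (𝓝 0) := by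
    simpa [Function.comp_def] using (ENNReal.tendsto_toReal ENNReal.zero_ne_top).comp h
  have h1 : Tendsto (fun i => (eLpNorm (F i) 2 μ).toReal) l (𝓝 (eLpNorm u 2 μ).toReal) := by
    rw [tendsto_iff_dist_tendsto_zero]
    refine squeeze_zero' (Eventually.of_forall fun _ => dist_nonneg) ?_ hr
    filter_upwards [hF] with i hi
    have hd := hi.sub hu
    have a1 : eLpNorm (F i) 2 μ ≤ eLpNorm (fun x => F i x - u x) 2 μ + eLpNorm u 2 μ := by
      have := eLpNorm_add_le hd.1 hu.1 one_le_two
      rw [sub_add_cancel] at this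
      exact this
    have a2 : eLpNorm u 2 μ ≤ eLpNorm (fun x => F i x - u x) 2 μ + eLpNorm (F i) 2 μ := by
      have := eLpNorm_sub_le hi.1 hd.1 one_le_two
      rw [sub_sub_cancel, add_comm] at this
      exact this
    have b1 := ENNReal.toReal_mono (ENNReal.add_ne_top.2 ⟨hd.2.ne, hu.2.ne⟩) a1
    have b2 := ENNReal.toReal_mono (ENNReal.add_ne_top.2 ⟨hd.2.ne, hi.2.ne⟩) a2
    rw [ENNReal.toReal_add hd.2.ne hu.2.ne] at b1
    rw [ENNReal.toReal_add hd.2.ne hi.2.ne] at b2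
    rw [Real.dist_eq, abs_le]
    change _ ≤ (eLpNorm (F i - u) 2 μ).toReal + _ at b1
    change _ ≤ (eLpNorm (F i - u) 2 μ).toReal + _ at b2
    change - (eLpNorm (F i - u) 2 μ).toReal ≤ _ ∧ _ ≤ (eLpNorm (F i - u) 2 μ).toReal
    constructor <;> linarith
  rw [integral_sq_eq hu]
  refine (h1.pow 2).congr' ?_
  filter_upwards [hF] with i hi
  rw [integral_sq_eq hi]

theorem ae_le_of_tendsto_eLpNorm {ι : Type*} {l : Filter ι} [l.NeBot] [l.IsCountablyGenerated]
    {p : ℝ≥0∞} (hp : p ≠ 0) {v : α → EReal} {F : ι → α → ℝ} {u : α → ℝ}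
    (hF : ∀ᶠ i in l, AEStronglyMeasurable (F i) μ) (hu : AEStronglyMeasurable u μ)
    (h : Tendsto (fun i => eLpNorm (fun x => F i x - u x) p μ) l (𝓝 0))
    (hv : ∀ᶠ i in l, ∀ᵐ x ∂μ, v x ≤ (F i x : EReal)) : ∀ᵐ x ∂μ, v x ≤ (u x : EReal) := by
  obtain ⟨s, hs⟩ := exists_seq_tendsto l
  obtain ⟨N, hN⟩ := eventually_atTop.1 (hs.eventually (hF.and hv))
  have hs' : Tendsto (fun k => s (k + N)) atTop l := hs.comp (tendsto_add_atTop_nat N)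
  have hm : TendstoInMeasure μ (fun k => F (s (k + N))) atTop u :=
    tendstoInMeasure_of_tendsto_eLpNorm hp (fun k => (hN _ (Nat.le_add_left N k)).1) hu
      (h.comp hs')
  obtain ⟨ns, -, hns⟩ := hm.exists_seq_tendsto_ae
  filter_upwards [hns, ae_all_iff.2 fun k => (hN _ (Nat.le_add_left N k)).2] with x hx hx2
  exact ge_of_tendsto' ((continuous_coe_real_ereal.tendsto _).comp hx) fun k => hx2 (ns k)

end LpTools

/-! ### Existence and uniqueness of minimizers on a fixed set -/

section Energy

variable {n : ℕ} {h : ℝ} {v : Eu n → EReal} {f : Eu n → ℝ} {A : Set (Eu n)} {u w : Eu n → ℝ}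

/-- The real-valued energy. -/
noncomputable def renergy (h : ℝ) (f : Eu n → ℝ) (A : Set (Eu n)) (u : Eu n → ℝ) : ℝ :=
  (totalVar A u).toReal + 1 / (2 * h) * ∫ x in A, (u x - f x) ^ 2

theorem energy_eq_ofReal (hh : 0 < h) (hu : totalVar A u < ∞)
    (hf : MemLp (fun x => u x - f x) 2 (volume.restrict A)) :
    energy h f A u = ENNReal.ofReal (renergy h f A u) := by
  unfold energy renergy
  rw [ENNReal.ofReal_add ENNReal.toReal_nonneg
    (mul_nonneg (by positivity) (integral_nonneg fun x => by positivity)),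
    ENNReal.ofReal_toReal hu.ne, ENNReal.ofReal_mul (by positivity),
    ofReal_integral_eq_lintegral_ofReal hf.integrable_sq (ae_of_all _ fun x => by positivity)]

theorem renergy_nonneg (hh : 0 < h) : 0 ≤ renergy h f A u :=
  add_nonneg ENNReal.toReal_nonneg
    (mul_nonneg (by positivity) (integral_nonneg fun x => by positivity))

theorem Admissible.sub_memLp (hu : Admissible v A u) (hf : MemLp f 2 (volume.restrict A)) :
    MemLp (fun x => u x - f x) 2 (volume.restrict A) := hu.1.sub hf

theorem Admissible.energy_eq (hh : 0 < h) (hf : MemLp f 2 (volume.restrict A))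
    (hu : Admissible v A u) : energy h f A u = ENNReal.ofReal (renergy h f A u) :=
  energy_eq_ofReal hh hu.2.1.2 (hu.sub_memLp hf)

theorem Admissible.energy_le_iff (hh : 0 < h) (hf : MemLp f 2 (volume.restrict A))
    (hu : Admissible v A u) (hw : Admissible v A w) :
    energy h f A u ≤ energy h f A w ↔ renergy h f A u ≤ renergy h f A w := by
  rw [hu.energy_eq hh hf, hw.energy_eq hh hf, ENNReal.ofReal_le_ofReal_iff (renergy_nonneg hh)]

theorem Admissible.midpoint (hu : Admissible v A u) (hw : Admissible v A w) :
    Admissible v A (fun x => 1 / 2 * u x + 1 / 2 * w x) := by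
  refine ⟨(hu.1.const_mul _).add (hw.1.const_mul _),
    (toReal_totalVar_lincomb _ _ (by norm_num) (by norm_num) hu.2.1 hw.2.1).1, ?_⟩
  filter_upwards [hu.2.2, hw.2.2] with x h1 h2
  rcases le_total (u x) (w x) with h3 | h3
  · exact h1.trans (EReal.coe_le_coe_iff.2 (by linarith))
  · exact h2.trans (EReal.coe_le_coe_iff.2 (by linarith))

/-- Convexity of the variation plus the parallelogram identity for the quadratic term. The
quantitative gain drives both existence and uniqueness. -/
theorem renergy_midpoint_le (hh : 0 < h) (hf : MemLp f 2 (volume.restrict A))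
    (hu : Admissible v A u) (hw : Admissible v A w) :
    renergy h f A (fun x => 1 / 2 * u x + 1 / 2 * w x) ≤
      (renergy h f A u + renergy h f A w) / 2 -
        1 / (8 * h) * ∫ x in A, (u x - w x) ^ 2 := by
  have h1 := (toReal_totalVar_lincomb (1 / 2) (1 / 2) (by norm_num) (by norm_num)
    hu.2.1 hw.2.1).2
  have i1 := (hu.sub_memLp hf).integrable_sq
  have i2 := (hw.sub_memLp hf).integrable_sq
  have i3 : Integrable (fun x => (u x - w x) ^ 2) (volume.restrict A) :=
    (hu.1.sub hw.1).integrable_sq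
  have e : ∫ x in A, (1 / 2 * u x + 1 / 2 * w x - f x) ^ 2 =
      1 / 2 * (∫ x in A, (u x - f x) ^ 2) + 1 / 2 * (∫ x in A, (w x - f x) ^ 2) -
        1 / 4 * ∫ x in A, (u x - w x) ^ 2 := by
    have i12 : Integrable (fun x => 1 / 2 * (u x - f x) ^ 2 + 1 / 2 * (w x - f x) ^ 2)
      (volume.restrict A) := (i1.const_mul _).add (i2.const_mul _)
    rw [← integral_const_mul, ← integral_const_mul, ← integral_const_mul,
      ← integral_add (i1.const_mul _) (i2.const_mul _), ← integral_sub i12 (i3.const_mul _)]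
    refine integral_congr_ae (ae_of_all _ fun x => ?_)
    ring
  unfold renergy
  rw [e]
  have e2 : 1 / (2 * h) * (1 / 4 * ∫ x in A, (u x - w x) ^ 2) =
    1 / (8 * h) * ∫ x in A, (u x - w x) ^ 2 := by field_simp; ring
  rw [mul_sub, e2]
  linarith

/-- By uniform convexity a minimizing sequence is Cauchy in `L²`, so no compactness theorem in `BV`
is needed; lower semicontinuity finishes. -/
theorem exists_isObstacleMin (hh : 0 < h) (hA : volume A ≠ ∞)
    (hf : MemLp f 2 (volume.restrict A)) (hne : ∃ w, Admissible v A w) :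
    ∃ u, IsObstacleMin h v f A u := by
  have : IsFiniteMeasure (volume.restrict A) := ⟨by simpa using hA.lt_top⟩
  set S : Set ℝ := renergy h f A '' {w | Admissible v A w}
  have hSb : BddBelow S := ⟨0, by rintro _ ⟨w, -, rfl⟩; exact renergy_nonneg hh⟩
  have hSn : S.Nonempty := let ⟨w, hw⟩ := hne; ⟨_, w, hw, rfl⟩
  set m := sInf S
  have hm : ∀ w, Admissible v A w → m ≤ renergy h f A w := fun w hw => csInf_le hSb ⟨w, hw, rfl⟩
  have hex : ∀ j : ℕ, ∃ w, Admissible v A w ∧ renergy h f A w < m + 1 / ((j : ℝ) + 1) := fun j => by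
    obtain ⟨_, ⟨w, hw, rfl⟩, hlt⟩ := exists_lt_of_csInf_lt hSn
      (show m < m + 1 / ((j : ℝ) + 1) by linarith [Nat.one_div_pos_of_nat (α := ℝ) (n := j)])
    exact ⟨w, hw, hlt⟩
  choose F hF hFe using hex
  have hFm : ∀ i j, MemLp (fun x => F i x - F j x) 2 (volume.restrict A) := fun i j =>
    (hF i).1.sub (hF j).1
  have hsq : ∀ i j, ∫ x in A, (F i x - F j x) ^ 2 ≤
      4 * h * (1 / ((i : ℝ) + 1) + 1 / ((j : ℝ) + 1)) := fun i j => by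
    have h1 := renergy_midpoint_le hh hf (hF i) (hF j)
    have h2 := hm _ ((hF i).midpoint (hF j))
    have h3 : 1 / (8 * h) * (∫ x in A, (F i x - F j x) ^ 2) ≤
      (1 / ((i : ℝ) + 1) + 1 / ((j : ℝ) + 1)) / 2 := by linarith [hFe i, hFe j]
    rw [one_div_mul_eq_div, div_le_iff₀ (by positivity)] at h3
    linarith
  obtain ⟨u, hu, hlim⟩ := exists_tendsto_eLpNorm_of_cauchy (fun j => (hF j).1) (fun ε hε => by
    -- For `i, j ≥ N` the bound `hsq` is at most `8h / (N + 1)`, which has to stay below `ε²`.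
    obtain ⟨N, hN⟩ := exists_nat_one_div_lt (show 0 < ε ^ 2 / (8 * h) by positivity)
    refine ⟨N, fun i hi j hj => ?_⟩
    have hi' : 1 / ((i : ℝ) + 1) ≤ 1 / ((N : ℝ) + 1) := Nat.one_div_le_one_div hi
    have hj' : 1 / ((j : ℝ) + 1) ≤ 1 / ((N : ℝ) + 1) := Nat.one_div_le_one_div hj
    have h1 : ∫ x in A, |F i x - F j x| ^ 2 ≤ ε ^ 2 := by
      simp only [sq_abs]
      refine (hsq i j).trans ?_
      rw [lt_div_iff₀ (by positivity)] at hN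
      nlinarith
    have h2 := eLpNorm_nat_le two_ne_zero (μ := volume.restrict A)
      (g := fun x => F i x - F j x) (by simpa using hFm i j) h1
    rw [Nat.cast_ofNat, Nat.cast_ofNat, ← Real.sqrt_eq_rpow, Real.sqrt_sq hε.le] at h2
    exact h2)
  have hlim1 : Tendsto (fun j => eLpNorm (fun x => F j x - u x) 1 (volume.restrict A)) atTop
      (𝓝 0) :=
    tendsto_eLpNorm_of_exponent_le one_le_two one_ne_zero
      (Eventually.of_forall fun j => (hF j).1.1.sub hu.1) hlim
  have hQ : Tendsto (fun j => ∫ x in A, (F j x - f x) ^ 2) atTop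
      (𝓝 (∫ x in A, (u x - f x) ^ 2)) := by
    refine tendsto_integral_sq (Eventually.of_forall fun j => (hF j).sub_memLp hf)
      (hu.sub hf) ?_
    simpa using hlim
  -- The fidelity terms converge, so they are moved into the bound on the variation.
  obtain ⟨hBV, hTV⟩ := totalVar_le_of_tendsto (l := atTop) (f := F)
    (c := fun j : ℕ => m + 1 / ((j : ℝ) + 1) - 1 / (2 * h) * ∫ x in A, (F j x - f x) ^ 2)
    (hu.integrable one_le_two)
    (Eventually.of_forall fun j => (hF j).2.1) hlim1
    (Eventually.of_forall fun j => by have := hFe j; unfold renergy at this; linarith)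
    ((tendsto_const_nhds.add tendsto_one_div_add_atTop_nhds_zero_nat).sub (hQ.const_mul _))
  have hadm : Admissible v A u := ⟨hu, hBV, ae_le_of_tendsto_eLpNorm two_ne_zero
    (Eventually.of_forall fun j => (hF j).1.1) hu.1 hlim
    (Eventually.of_forall fun j => (hF j).2.2)⟩
  refine ⟨u, hadm, fun w hw => (hadm.energy_le_iff hh hf hw).2 ((hm w hw).trans' ?_)⟩
  unfold renergy
  linarith

theorem IsObstacleMin.ae_eq (hh : 0 < h) (hf : MemLp f 2 (volume.restrict A))
    (hu : IsObstacleMin h v f A u) (hw : IsObstacleMin h v f A w) :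
    u =ᵐ[volume.restrict A] w := by
  have h1 := renergy_midpoint_le hh hf hu.1 hw.1
  have h2 := (hu.1.energy_le_iff hh hf (hu.1.midpoint hw.1)).1 (hu.2 _ (hu.1.midpoint hw.1))
  have h3 := (hw.1.energy_le_iff hh hf (hu.1.midpoint hw.1)).1 (hw.2 _ (hu.1.midpoint hw.1))
  have i3 : Integrable (fun x => (u x - w x) ^ 2) (volume.restrict A) :=
    (hu.1.1.sub hw.1.1).integrable_sq
  have h4 : ∫ x in A, (u x - w x) ^ 2 = 0 := by
    refine le_antisymm ?_ (integral_nonneg fun x => by positivity)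
    have : 1 / (8 * h) * (∫ x in A, (u x - w x) ^ 2) ≤ 0 := by linarith
    exact nonpos_of_mul_nonpos_right this (by positivity)
  rw [integral_eq_zero_iff_of_nonneg (fun x => by positivity) i3] at h4
  filter_upwards [h4] with x hx
  have : (u x - w x) ^ 2 = 0 := hx
  exact sub_eq_zero.1 (pow_eq_zero_iff two_ne_zero |>.1 this)

theorem isObstacleMin_obstacleSol (H : ∃ u, IsObstacleMin h v f A u) :
    IsObstacleMin h v f A (obstacleSol h v f A) := by
  unfold obstacleSol
  rw [dif_pos H]
  exact H.choose_spec

end Energy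

end TVObstacle

namespace TVObstacle

/-! ### Relative minimizers and their comparison -/

section RelMin

variable {n : ℕ} {h M M' ρ : ℝ} {v : Eu n → EReal} {f u w d ψ : Eu n → ℝ} {g : ℝ → ℝ}

/-- `u` minimizes the energy on `B_M` above the obstacle, among competitors that agree with `u`
outside the closed ball of radius `ρ < M`. -/
structure RelMin (h : ℝ) (v : Eu n → EReal) (f : Eu n → ℝ) (M ρ : ℝ) (u : Eu n → ℝ) : Prop where
  lt : ρ < M
  adm : Admissible v (Metric.ball 0 M) u
  le : ∀ w, Admissible v (Metric.ball 0 M) w → (∀ x, x ∉ Metric.closedBall 0 ρ → w x = u x) →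
    renergy h f (Metric.ball 0 M) u ≤ renergy h f (Metric.ball 0 M) w

theorem RelMin.closedBall_subset (hu : RelMin h v f M ρ u) :
    Metric.closedBall (0 : Eu n) ρ ⊆ Metric.ball 0 M := Metric.closedBall_subset_ball hu.lt

theorem IsObstacleMin.relMin (hh : 0 < h) (hf : MemLp f 2 (volume.restrict (Metric.ball 0 M)))
    (hu : IsObstacleMin h v f (Metric.ball 0 M) u) (hρ : ρ < M) : RelMin h v f M ρ u :=
  ⟨hρ, hu.1, fun w hw _ => (hu.1.energy_le_iff hh hf hw).1 (hu.2 w hw)⟩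

/-- The first-order information contained in minimality. -/
theorem RelMin.variation (hf : MemLp f 2 (volume.restrict (Metric.ball 0 M)))
    (hu : RelMin h v f M ρ u) (hd : ∀ x, x ∉ Metric.closedBall 0 ρ → d x = 0)
    (hadm : Admissible v (Metric.ball 0 M) (fun x => u x - d x)) :
    Integrable (fun x => d x * (2 * (u x - f x) - d x)) ∧
    (totalVar (Metric.ball 0 M) u).toReal +
      1 / (2 * h) * ∫ x, d x * (2 * (u x - f x) - d x) ≤
    (totalVar (Metric.ball 0 M) (fun x => u x - d x)).toReal := by
  have i1 := (hu.adm.sub_memLp hf).integrable_sq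
  have i2 := (hadm.sub_memLp hf).integrable_sq
  have e : (fun x => (u x - f x) ^ 2 - (u x - d x - f x) ^ 2) =
      fun x => d x * (2 * (u x - f x) - d x) := by ext x; ring
  have i3 : IntegrableOn (fun x => d x * (2 * (u x - f x) - d x)) (Metric.ball 0 M) := by
    rw [← e]; exact i1.sub i2
  have hs : ∀ x, x ∉ Metric.ball 0 M → d x * (2 * (u x - f x) - d x) = 0 := fun x hx => by
    rw [hd x fun h => hx (hu.closedBall_subset h), zero_mul]
  refine ⟨(integrableOn_iff_integrable_of_support_subset fun x hx => ?_).1 i3, ?_⟩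
  · by_contra h
    exact hx (hs x h)
  · have h1 := hu.le _ hadm fun x hx => by rw [hd x hx, sub_zero]
    unfold renergy at h1
    have e2 : ∫ x, d x * (2 * (u x - f x) - d x) = (∫ x in Metric.ball 0 M, (u x - f x) ^ 2) -
        ∫ x in Metric.ball 0 M, (u x - d x - f x) ^ 2 := by
      rw [← integral_sub i1 i2, e, setIntegral_eq_integral_of_forall_compl_eq_zero hs]
    rw [e2, mul_sub]
    linarith

theorem memLp_cutoff_mul_profile {p : ℝ≥0∞} {A : Set (Eu n)} (hψ : IsCutoff ψ)
    (hg : IsProfile g) {W : Eu n → ℝ} (hA : tsupport ψ ⊆ A) (hW : MemLp W p (volume.restrict A)) :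
    MemLp (fun x => ψ x * g (W x)) p volume := by
  have h0 : (fun x => ψ x * g (W x)) =
      (tsupport ψ).indicator fun x => ψ x * g (W x) := by
    refine (indicator_eq_self.2 ?_).symm
    exact (Function.support_mul_subset_left _ _).trans (subset_tsupport _)
  rw [h0, memLp_indicator_iff_restrict (isClosed_tsupport _).measurableSet]
  have hW' : MemLp W p (volume.restrict (tsupport ψ)) := hW.mono_measure
    (Measure.restrict_mono hA le_rfl)
  refine hW'.mono (hψ.contDiff.continuous.aestronglyMeasurable.mul
    (hg.continuous.comp_aestronglyMeasurable hW'.1)) (ae_of_all _ fun x => ?_)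
  rw [norm_mul, Real.norm_of_nonneg (hψ.nonneg x)]
  have := hg.abs_le (W x)
  simp only [Real.norm_eq_abs]
  nlinarith [hψ.le_one x, hψ.nonneg x, abs_nonneg (g (W x))]

/-- Applied with `s = u - w`, this says that subtracting `ψ g(s)` from `u` moves it towards `w`
without crossing it, which is why exchanges respect the obstacle. -/
theorem cutoff_mul_profile_mem (hψ : IsCutoff ψ) (hg : IsProfile g) (x : Eu n) (s : ℝ) :
    (0 ≤ s → 0 ≤ ψ x * g s ∧ ψ x * g s ≤ s) ∧ (s ≤ 0 → s ≤ ψ x * g s ∧ ψ x * g s ≤ 0) := by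
  have h1 := hψ.nonneg x
  have h2 := hψ.le_one x
  refine ⟨fun hs => ?_, fun hs => ?_⟩
  · have h3 := hg.nonneg hs
    have h4 := hg.le_self hs
    exact ⟨mul_nonneg h1 h3, by nlinarith⟩
  · have h3 := hg.nonpos hs
    have h4 := hg.self_le hs
    exact ⟨by nlinarith, by nlinarith⟩

/-- The new function lies between `u` and `w`. The obstacle condition on `w` is imposed only on the
support of `ψ`, so `w` may also be a constant that dominates `v` there. -/
theorem admissible_exchange {A B : Set (Eu n)} (hA : IsOpen A) (hB : IsOpen B)
    (hu : Admissible v A u) (hw : MemBV B w) (hwB : MemLp w 2 (volume.restrict B))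
    (hwv : ∀ᵐ x ∂(volume.restrict (tsupport ψ)), v x ≤ (w x : EReal))
    (hψ : IsCutoff ψ) (hψA : tsupport ψ ⊆ A) (hψB : tsupport ψ ⊆ B) (hg : IsProfile g) :
    Admissible v A (fun x => u x - ψ x * g (u x - w x)) := by
  have hW : MemLp (fun x => u x - w x) 2 (volume.restrict (tsupport ψ)) :=
    (hu.1.mono_measure (Measure.restrict_mono hψA le_rfl)).sub
      (hwB.mono_measure (Measure.restrict_mono hψB le_rfl))
  have hd := memLp_cutoff_mul_profile hψ hg subset_rfl hW
  refine ⟨hu.1.sub (hd.mono_measure Measure.restrict_le_self),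
    (totalVar_exchange hA hB hu.2.1 hw hψ hψA hψB hg).1, ?_⟩
  have hwv' := ae_restrict_of_ae (s := A)
    ((ae_restrict_iff' (isClosed_tsupport ψ).measurableSet).1 hwv)
  filter_upwards [hu.2.2, hwv'] with x h1 h2
  by_cases hx : x ∈ tsupport ψ
  · have key := cutoff_mul_profile_mem hψ hg x (u x - w x)
    rcases le_total 0 (u x - w x) with hs | hs
    · exact (h2 hx).trans (EReal.coe_le_coe_iff.2 (by linarith [(key.1 hs).2]))
    · exact h1.trans (EReal.coe_le_coe_iff.2 (by linarith [(key.2 hs).2]))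
  · simpa [image_eq_zero_of_notMem_tsupport hx] using h1

theorem Admissible.symm_exchange {A B : Set (Eu n)} (hA : IsOpen A) (hB : IsOpen B)
    (hu : Admissible v A u) (hw : Admissible v B w)
    (hψ : IsCutoff ψ) (hψA : tsupport ψ ⊆ A) (hψB : tsupport ψ ⊆ B) (hg : IsProfile g) :
    Admissible v B (fun x => w x + ψ x * g (u x - w x)) := by
  have hW : MemLp (fun x => u x - w x) 2 (volume.restrict (tsupport ψ)) :=
    (hu.1.mono_measure (Measure.restrict_mono hψA le_rfl)).sub
      (hw.1.mono_measure (Measure.restrict_mono hψB le_rfl))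
  have hd := memLp_cutoff_mul_profile hψ hg subset_rfl hW
  refine ⟨hw.1.add (hd.mono_measure Measure.restrict_le_self),
    (totalVar_exchange hA hB hu.2.1 hw.2.1 hψ hψA hψB hg).2.1, ?_⟩
  have huv : ∀ᵐ x ∂(volume.restrict (tsupport ψ)), v x ≤ (u x : EReal) :=
    ae_restrict_of_ae_restrict_of_subset hψA hu.2.2
  have huv' := ae_restrict_of_ae (s := B)
    ((ae_restrict_iff' (isClosed_tsupport ψ).measurableSet).1 huv)
  filter_upwards [hw.2.2, huv'] with x h1 h2
  by_cases hx : x ∈ tsupport ψ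
  · have key := cutoff_mul_profile_mem hψ hg x (u x - w x)
    rcases le_total 0 (u x - w x) with hs | hs
    · exact h1.trans (EReal.coe_le_coe_iff.2 (by linarith [(key.1 hs).1]))
    · exact (h2 hx).trans (EReal.coe_le_coe_iff.2 (by linarith [(key.2 hs).1]))
  · simpa [image_eq_zero_of_notMem_tsupport hx] using h1

/-- Local comparison of two relative minimizers. -/
theorem RelMin.comparison (hh : 0 < h) (hf : MemLp f 2 (volume.restrict (Metric.ball 0 M)))
    (hf' : MemLp f 2 (volume.restrict (Metric.ball 0 M')))
    (hu : RelMin h v f M ρ u) (hw : RelMin h v f M' ρ w) (hψ : IsCutoff ψ)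
    (hψρ : tsupport ψ ⊆ Metric.closedBall 0 ρ) (hg : IsProfile g) :
    Integrable (fun x => ψ x * g (u x - w x) * ((u x - w x) - ψ x * g (u x - w x))) ∧
    ∫ x, ψ x * g (u x - w x) * ((u x - w x) - ψ x * g (u x - w x)) ≤
      2 * h * ∫ x, ‖fderiv ℝ ψ x‖ * |g (u x - w x)| := by
  have hA := Metric.isOpen_ball (x := (0 : Eu n)) (ε := M)
  have hB := Metric.isOpen_ball (x := (0 : Eu n)) (ε := M')
  have hψA := hψρ.trans hu.closedBall_subset
  have hψB := hψρ.trans hw.closedBall_subset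
  have hd0 : ∀ x, x ∉ Metric.closedBall 0 ρ → ψ x * g (u x - w x) = 0 := fun x hx => by
    rw [image_eq_zero_of_notMem_tsupport fun h => hx (hψρ h), zero_mul]
  have a1 := admissible_exchange hA hB hu.adm hw.adm.2.1 hw.adm.1
    (ae_restrict_of_ae_restrict_of_subset hψB hw.adm.2.2) hψ hψA hψB hg
  have a2 := hu.adm.symm_exchange hA hB hw.adm hψ hψA hψB hg
  obtain ⟨i1, v1⟩ := hu.variation hf hd0 a1
  obtain ⟨i2, v2⟩ := hw.variation hf' (d := fun x => - (ψ x * g (u x - w x)))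
    (fun x hx => by rw [hd0 x hx, neg_zero]) (by simpa only [sub_neg_eq_add] using a2)
  simp only [sub_neg_eq_add] at i2 v2
  obtain ⟨-, -, t⟩ := totalVar_exchange hA hB hu.adm.2.1 hw.adm.2.1 hψ hψA hψB hg
  -- Adding the two variations eliminates `f`: only `u - w` is left.
  have e : (fun x => 1 / 2 * (ψ x * g (u x - w x) * (2 * (u x - f x) - ψ x * g (u x - w x)) +
      -(ψ x * g (u x - w x)) * (2 * (w x - f x) + ψ x * g (u x - w x)))) =
      fun x => ψ x * g (u x - w x) * ((u x - w x) - ψ x * g (u x - w x)) := by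
    ext x; ring
  have i3 := (i1.add i2).const_mul (1 / 2)
  simp only [Pi.add_apply] at i3
  rw [e] at i3
  refine ⟨i3, ?_⟩
  rw [← e, integral_const_mul, integral_add i1 i2]
  have h1 : 1 / (2 * h) * ((∫ x, ψ x * g (u x - w x) * (2 * (u x - f x) - ψ x * g (u x - w x))) +
      ∫ x, -(ψ x * g (u x - w x)) * (2 * (w x - f x) + ψ x * g (u x - w x))) ≤
      2 * ∫ x, ‖fderiv ℝ ψ x‖ * |g (u x - w x)| := by
    rw [mul_add]; linarith
  rw [one_div_mul_eq_div, div_le_iff₀ (by positivity)] at h1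
  linarith

end RelMin

end TVObstacle

/-! ### Explicit profiles, cutoffs and a calibrating field -/

namespace TVObstacle

theorem hasDerivAt_expNegInvGlue (s : ℝ) :
    HasDerivAt expNegInvGlue (s⁻¹ ^ 2 * expNegInvGlue s) s := by
  simpa using expNegInvGlue.hasDerivAt_polynomial_eval_inv_mul 1 s

theorem expNegInvGlue_of_pos {s : ℝ} (hs : 0 < s) : expNegInvGlue s = Real.exp (-s⁻¹) := by
  simp [expNegInvGlue, not_le.2 hs]

/-- With `t = 1/s` this is `t^k e^(-t) ≤ k!`, a single term of the exponential series. It absorbs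
every negative power of the distance to the boundary that differentiating the cutoff produces. -/
theorem inv_pow_mul_expNegInvGlue_le (k : ℕ) (s : ℝ) :
    s⁻¹ ^ k * expNegInvGlue s ≤ k.factorial := by
  rcases le_or_gt s 0 with hs | hs
  · simp [expNegInvGlue.zero_of_nonpos hs]
  · rw [expNegInvGlue_of_pos hs, Real.exp_neg, ← div_eq_mul_inv, div_le_iff₀ (Real.exp_pos _)]
    have := Real.pow_div_factorial_le_exp s⁻¹ (inv_nonneg.2 hs.le) k
    rwa [div_le_iff₀ (by exact_mod_cast k.factorial_pos), mul_comm] at this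

theorem expNegInvGlue_le_one (s : ℝ) : expNegInvGlue s ≤ 1 := by
  simpa using inv_pow_mul_expNegInvGlue_le 0 s

/-- A profile that is positive exactly on the positive half line. -/
theorem isProfile_half_expNegInvGlue : IsProfile (fun s => 1 / 2 * expNegInvGlue s) := by
  have hd : ∀ s, deriv (fun s => 1 / 2 * expNegInvGlue s) s =
      1 / 2 * (s⁻¹ ^ 2 * expNegInvGlue s) := fun s =>
    ((hasDerivAt_expNegInvGlue s).const_mul _).deriv
  refine ⟨contDiff_const.mul expNegInvGlue.contDiff, by simp, fun s => ?_, fun s => ?_⟩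
  · rw [hd]
    have := expNegInvGlue.nonneg s
    positivity
  · rw [hd]
    -- The derivative is at most `2!/2 = 1`; this is what the factor `1/2` in the profile is for.
    have := inv_pow_mul_expNegInvGlue_le 2 s
    rw [Nat.factorial_two, Nat.cast_ofNat] at this
    linarith

/-- The profile `s ↦ s ^ (2m+1) / ((2m+1) (L² + s²) ^ m)`. -/
noncomputable def powProfile (m : ℕ) (L : ℝ) (s : ℝ) : ℝ :=
  s * (s ^ 2 / (L ^ 2 + s ^ 2)) ^ m / (2 * m + 1)

/-! ### Profiles that behave like an odd power -/

section PowProfile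

variable {m : ℕ} {L s : ℝ}

/-- With `κ = s²/(L² + s²) ∈ [0, 1]` the derivative equals `κ^m (1 + 2m(1 - κ)) / (2m + 1)`, and
both `κ^m` and the remaining factor lie in `[0, 1]`. -/
theorem isProfile_powProfile (hL : 0 < L) : IsProfile (powProfile m L) := by
  have hpos : ∀ s : ℝ, 0 < L ^ 2 + s ^ 2 := fun s => by positivity
  have hk : ∀ s : ℝ, HasDerivAt (fun s : ℝ => s ^ 2 / (L ^ 2 + s ^ 2))
      (2 * s * L ^ 2 / (L ^ 2 + s ^ 2) ^ 2) s := fun s => by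
    have h1 : HasDerivAt (fun s : ℝ => s ^ 2) (2 * s) s := by simpa using hasDerivAt_pow 2 s
    exact (h1.fun_div (h1.const_add (L ^ 2)) (hpos s).ne').congr_deriv (by ring)
  have hd : ∀ s, deriv (powProfile m L) s = (s ^ 2 / (L ^ 2 + s ^ 2)) ^ m *
      (1 + 2 * m * (1 - s ^ 2 / (L ^ 2 + s ^ 2))) / (2 * m + 1) := fun s => by
    have h3 := (((hasDerivAt_id s).mul ((hk s).pow m)).div_const (2 * (m : ℝ) + 1)).deriv
    refine h3.trans ?_
    congr 1
    rcases m with - | m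
    · simp
    · have := (hpos s).ne'
      simp only [id, Nat.add_sub_cancel, Nat.cast_add, Nat.cast_one, Pi.pow_apply]
      rw [pow_succ]
      field_simp
      ring
  have hk0 : ∀ s : ℝ, 0 ≤ s ^ 2 / (L ^ 2 + s ^ 2) := fun s => by positivity
  have hk1 : ∀ s : ℝ, s ^ 2 / (L ^ 2 + s ^ 2) ≤ 1 := fun s => by
    rw [div_le_one (hpos s)]; nlinarith
  refine ⟨?_, by simp [powProfile], fun s => ?_, fun s => ?_⟩
  · unfold powProfile
    exact (contDiff_id.mul (((contDiff_id.pow 2).div (contDiff_const.add (contDiff_id.pow 2))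
      fun s => (hpos s).ne').pow m)).div_const _
  · rw [hd]
    have h1 : 0 ≤ 1 - s ^ 2 / (L ^ 2 + s ^ 2) := sub_nonneg.2 (hk1 s)
    have h2 := hk0 s
    positivity
  · rw [hd, div_le_one (by positivity)]
    have h1 := pow_le_one₀ (n := m) (hk0 s) (hk1 s)
    have h2 : 1 + 2 * (m : ℝ) * (1 - s ^ 2 / (L ^ 2 + s ^ 2)) ≤ 2 * m + 1 := by
      nlinarith [hk0 s, (Nat.cast_nonneg m : (0 : ℝ) ≤ m)]
    have h3 : 0 ≤ 1 + 2 * (m : ℝ) * (1 - s ^ 2 / (L ^ 2 + s ^ 2)) := by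
      have : 0 ≤ 1 - s ^ 2 / (L ^ 2 + s ^ 2) := sub_nonneg.2 (hk1 s)
      positivity
    nlinarith

theorem powProfile_le (hL : 0 < L) :
    |powProfile m L s| ≤ |s| ^ (2 * m + 1) / (L ^ (2 * m) * (2 * m + 1)) := by
  unfold powProfile
  rw [abs_div, abs_mul, abs_of_nonneg (by positivity : (0 : ℝ) ≤ 2 * m + 1),
    abs_of_nonneg (by positivity : 0 ≤ (s ^ 2 / (L ^ 2 + s ^ 2)) ^ m), ← div_div]
  gcongr
  have e : |s| ^ (2 * m + 1) / L ^ (2 * m) = |s| * (s ^ 2 / L ^ 2) ^ m := by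
    rw [pow_succ', mul_div_assoc, div_pow, pow_mul, sq_abs, pow_mul]
  rw [e]
  gcongr
  nlinarith [sq_nonneg s]

/-- For `|s| ≤ L` the denominator `L² + s²` is at most `2L²`. Together with `powProfile_le` this
makes the profile comparable to `s^(2m+1)` up to a factor `2^m`; the powers of `L` are the same in
both bounds and cancel later. -/
theorem le_powProfile_mul (hL : 0 < L) (hs : |s| ≤ L) :
    |s| ^ (2 * m + 2) / ((2 * L ^ 2) ^ m * (2 * m + 1)) ≤ powProfile m L s * s := by
  unfold powProfile
  have e : s * (s ^ 2 / (L ^ 2 + s ^ 2)) ^ m / (2 * m + 1) * s =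
      s ^ 2 * (s ^ 2 / (L ^ 2 + s ^ 2)) ^ m / (2 * m + 1) := by ring
  rw [e, ← div_div]
  gcongr
  rw [pow_add, pow_mul, sq_abs, mul_comm, mul_div_assoc, ← div_pow]
  have h2 : s ^ 2 ≤ L ^ 2 := sq_le_sq' (neg_le_of_abs_le hs) (le_of_abs_le hs)
  gcongr
  linarith

/-- The normalization `2m + 1 ≥ 2` provides the factor. It serves to absorb the quadratic term `ψ
g(W)²` in the comparison inequality. -/
theorem abs_powProfile_le (hL : 0 < L) (hm : 1 ≤ m) : |powProfile m L s| ≤ |s| / 2 := by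
  unfold powProfile
  have h1 : (1 : ℝ) ≤ m := by exact_mod_cast hm
  rw [abs_div, abs_mul, abs_of_nonneg (by positivity : (0 : ℝ) ≤ 2 * m + 1),
    abs_of_nonneg (by positivity : 0 ≤ (s ^ 2 / (L ^ 2 + s ^ 2)) ^ m)]
  have h2 : (s ^ 2 / (L ^ 2 + s ^ 2)) ^ m ≤ 1 := by
    refine pow_le_one₀ (by positivity) ?_
    rw [div_le_one (by positivity)]; nlinarith
  gcongr
  · nlinarith [abs_nonneg s]
  · linarith

end PowProfile

/-! ### The radial cutoff and the calibrating field -/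

section RadialCutoff

variable {n : ℕ} {R : ℝ}

/-- The radial cutoff `exp (-1 / (1 - |x|² / R²))` on `B_R`. -/
noncomputable def radialCutoff (n : ℕ) (R : ℝ) (x : Eu n) : ℝ :=
  expNegInvGlue (1 - ‖x‖ ^ 2 / R ^ 2)

theorem hasFDerivAt_radialCutoff (x : Eu n) :
    HasFDerivAt (radialCutoff n R)
      ((-(2 / R ^ 2) * ((1 - ‖x‖ ^ 2 / R ^ 2)⁻¹ ^ 2 * radialCutoff n R x)) • innerSL ℝ x) x := by
  have h1 : HasFDerivAt (fun x : Eu n => 1 - ‖x‖ ^ 2 / R ^ 2)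
      ((-(2 / R ^ 2)) • innerSL ℝ x) x := by
    have := ((hasStrictFDerivAt_norm_sq x).hasFDerivAt.const_mul (R ^ 2)⁻¹).const_sub 1
    simp only [div_eq_inv_mul]
    exact this.congr_fderiv (by ext y; simp; ring)
  have := (hasDerivAt_expNegInvGlue (1 - ‖x‖ ^ 2 / R ^ 2)).comp_hasFDerivAt x h1
  refine this.congr_fderiv ?_
  rw [smul_smul, mul_comm]
  rfl

theorem radialCutoff_eq_zero (hR : 0 < R) {x : Eu n} (hx : R ≤ ‖x‖) : radialCutoff n R x = 0 := by
  refine expNegInvGlue.zero_of_nonpos (sub_nonpos.2 ?_)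
  rw [le_div_iff₀ (by positivity), one_mul]
  exact pow_le_pow_left₀ hR.le hx 2

theorem radialCutoff_pos (hR : 0 < R) {x : Eu n} (hx : ‖x‖ < R) : 0 < radialCutoff n R x := by
  refine expNegInvGlue.pos_of_pos (sub_pos.2 ?_)
  rw [div_lt_one (by positivity)]
  exact pow_lt_pow_left₀ hx (norm_nonneg x) two_ne_zero

theorem tsupport_radialCutoff (hR : 0 < R) :
    tsupport (radialCutoff n R) ⊆ Metric.closedBall 0 R := by
  refine closure_minimal (fun x hx => ?_) Metric.isClosed_closedBall
  rw [mem_closedBall_zero_iff]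
  by_contra h
  exact hx (radialCutoff_eq_zero hR (not_le.1 h).le)

theorem isCutoff_radialCutoff (hR : 0 < R) : IsCutoff (radialCutoff n R) :=
  ⟨expNegInvGlue.contDiff.comp (contDiff_const.sub ((contDiff_norm_sq ℝ).div_const _)),
    (isCompact_closedBall 0 R).of_isClosed_subset (isClosed_tsupport _) (tsupport_radialCutoff hR),
    fun _ => expNegInvGlue.nonneg _, fun _ => expNegInvGlue_le_one _⟩

theorem norm_fderiv_radialCutoff_le (hR : 0 < R) (x : Eu n) :
    ‖fderiv ℝ (radialCutoff n R) x‖ ≤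
      2 / R ^ 2 * ((1 - ‖x‖ ^ 2 / R ^ 2)⁻¹ ^ 2 * radialCutoff n R x) * ‖x‖ := by
  have h0 := (isCutoff_radialCutoff (n := n) hR).nonneg x
  rw [(hasFDerivAt_radialCutoff x).fderiv, norm_smul, innerSL_apply_norm, norm_mul, norm_neg,
    Real.norm_of_nonneg (by positivity), Real.norm_of_nonneg (by positivity)]

theorem le_radialCutoff (hR : 0 < R) {x : Eu n} (hx : ‖x‖ < R / 2) :
    Real.exp (-2) ≤ radialCutoff n R x := by
  have h1 : ‖x‖ ^ 2 / R ^ 2 ≤ 1 / 4 := by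
    rw [div_le_iff₀ (by positivity)]
    nlinarith [norm_nonneg x]
  have h2 : (1 : ℝ) / 2 ≤ 1 - ‖x‖ ^ 2 / R ^ 2 := by linarith
  unfold radialCutoff
  rw [expNegInvGlue_of_pos (by linarith)]
  refine Real.exp_le_exp.2 (neg_le_neg ?_)
  refine (inv_anti₀ (by norm_num) h2).trans (by norm_num)

/-- Young's inequality adapted to the radial cutoff. -/
theorem mul_norm_fderiv_radialCutoff_le (hR : 0 < R) {K a : ℝ} (hK : 0 ≤ K) (ha : 0 ≤ a) (k : ℕ)
    (x : Eu n) : K * (‖fderiv ℝ (radialCutoff n R) x‖ * a ^ k) ≤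
      1 / 2 * (radialCutoff n R x * a ^ (k + 1)) +
        (2 * (k + 1)).factorial * (4 * K / R) ^ (k + 1) := by
  have hψ0 := (isCutoff_radialCutoff (n := n) hR).nonneg x
  have hr : (0 : ℝ) ≤ (2 * (k + 1)).factorial * (4 * K / R) ^ (k + 1) := by positivity
  rcases le_or_gt R ‖x‖ with hx | hx
  · have h1 := norm_fderiv_radialCutoff_le hR x
    rw [radialCutoff_eq_zero hR hx] at h1 ⊢
    have h2 : ‖fderiv ℝ (radialCutoff n R) x‖ = 0 :=
      le_antisymm (by simpa using h1) (norm_nonneg _)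
    rw [h2]
    simpa using hr
  have hs : 0 < 1 - ‖x‖ ^ 2 / R ^ 2 := by
    rw [sub_pos, div_lt_one (by positivity)]
    exact pow_lt_pow_left₀ hx (norm_nonneg x) two_ne_zero
  set y := (1 - ‖x‖ ^ 2 / R ^ 2)⁻¹ with hy
  have hy0 : 0 < y := inv_pos.2 hs
  have h1 : ‖fderiv ℝ (radialCutoff n R) x‖ ≤ 2 / R * (y ^ 2 * radialCutoff n R x) := by
    refine (norm_fderiv_radialCutoff_le hR x).trans ?_
    rw [← hy]
    calc 2 / R ^ 2 * (y ^ 2 * radialCutoff n R x) * ‖x‖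
        ≤ 2 / R ^ 2 * (y ^ 2 * radialCutoff n R x) * R := by gcongr
      _ = _ := by field_simp
  have h2 : K * (‖fderiv ℝ (radialCutoff n R) x‖ * a ^ k) ≤
      1 / 2 * radialCutoff n R x * ((4 * K / R * y ^ 2) * a ^ k) := by
    calc K * (‖fderiv ℝ (radialCutoff n R) x‖ * a ^ k)
        ≤ K * (2 / R * (y ^ 2 * radialCutoff n R x) * a ^ k) := by gcongr
      _ = _ := by ring
  refine h2.trans ?_
  -- Either `a` dominates `4K y²/R` and the term is absorbed by the first summand, or `a` is at most
  -- this quantity and the resulting power `y^(2(k+1))` is tamed by the exponential cutoff.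
  rcases le_total (4 * K / R * y ^ 2) a with hc | hc
  · have : 1 / 2 * radialCutoff n R x * ((4 * K / R * y ^ 2) * a ^ k) ≤
      1 / 2 * radialCutoff n R x * (a * a ^ k) := by gcongr
    refine this.trans ?_
    rw [← pow_succ', mul_assoc]
    linarith
  · have h3 : 1 / 2 * radialCutoff n R x * ((4 * K / R * y ^ 2) * a ^ k) ≤
        1 / 2 * radialCutoff n R x * ((4 * K / R * y ^ 2) * (4 * K / R * y ^ 2) ^ k) := by
      gcongr
    have h4 : 1 / 2 * radialCutoff n R x * ((4 * K / R * y ^ 2) * (4 * K / R * y ^ 2) ^ k) =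
        1 / 2 * ((y ^ (2 * (k + 1)) * radialCutoff n R x) * (4 * K / R) ^ (k + 1)) := by
      rw [← pow_succ', mul_pow, ← pow_mul]; ring
    have h5 : y ^ (2 * (k + 1)) * radialCutoff n R x ≤ (2 * (k + 1)).factorial :=
      inv_pow_mul_expNegInvGlue_le _ _
    have h6 : y ^ (2 * (k + 1)) * radialCutoff n R x * (4 * K / R) ^ (k + 1) ≤
        (2 * (k + 1)).factorial * (4 * K / R) ^ (k + 1) := by gcongr
    have h7 : 0 ≤ 1 / 2 * (radialCutoff n R x * a ^ (k + 1)) := by positivity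
    linarith

/-- A field that calibrates the boundary of `B_R` from inside. -/
noncomputable def ballField (n : ℕ) (R : ℝ) (x : Eu n) : Eu n :=
  (-(3 - ‖x‖ ^ 2 / R ^ 2) / (2 * R)) • x

theorem contDiff_ballField : ContDiff ℝ ((⊤ : ℕ∞) : WithTop ℕ∞) (ballField n R) :=
  ((contDiff_const.sub ((contDiff_norm_sq ℝ).div_const _)).neg.div_const _).smul contDiff_id

/-- With `r = |x|/R` the norm is `|3r - r³|/2`. The two bounds are `(2 - r)(r + 1)² ≥ 0` and `(r +
2)(r - 1)² ≥ 0`; the second shows that the value one is attained to second order at `r = 1`. -/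
theorem norm_ballField_le (hR : 0 < R) {x : Eu n} (hx : ‖x‖ ≤ 2 * R) : ‖ballField n R x‖ ≤ 1 := by
  unfold ballField
  rw [norm_smul, Real.norm_eq_abs]
  obtain ⟨r, hr⟩ : ∃ r, r = ‖x‖ / R := ⟨_, rfl⟩
  have hxr : ‖x‖ = r * R := by rw [hr]; field_simp
  have hr0 : 0 ≤ r := hr ▸ by positivity
  have hr2 : r ≤ 2 := by rw [hr, div_le_iff₀ hR]; exact hx
  have e : |-(3 - ‖x‖ ^ 2 / R ^ 2) / (2 * R)| * ‖x‖ = |(3 - r ^ 2) * r / 2| := by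
    rw [hxr, ← abs_of_nonneg (show 0 ≤ r * R by positivity), ← abs_mul, ← abs_neg,
      abs_of_nonneg (show 0 ≤ r * R by positivity)]
    congr 1
    field_simp
  rw [e, abs_le]
  constructor
  · nlinarith [mul_nonneg (sub_nonneg.2 hr2) (sq_nonneg (r + 1))]
  · nlinarith [mul_nonneg (show 0 ≤ r + 2 by linarith) (sq_nonneg (r - 1))]

theorem le_vdiv_ballField (hR : 0 < R) (x : Eu n) :
    -(3 * n / (2 * R)) ≤ vdiv (ballField n R) x := by
  have hd : HasFDerivAt (fun x : Eu n => -(3 - ‖x‖ ^ 2 / R ^ 2) / (2 * R))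
      ((1 / (R ^ 2 * R)) • innerSL ℝ x) x := by
    have := ((((hasStrictFDerivAt_norm_sq x).hasFDerivAt.const_mul (R ^ 2)⁻¹).const_sub
      3).const_mul (-(2 * R)⁻¹))
    have e : (fun x : Eu n => -(3 - ‖x‖ ^ 2 / R ^ 2) / (2 * R)) =
        fun x => -(2 * R)⁻¹ * (3 - (R ^ 2)⁻¹ * ‖x‖ ^ 2) := by ext x; field_simp
    rw [e]
    exact this.congr_fderiv (by ext y; simp; field_simp)
  have hid : vdiv (fun x : Eu n => x) x = n := by simp [vdiv]
  have := vdiv_smul hd.differentiableAt (differentiableAt_fun_id (x := x) (𝕜 := ℝ))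
  rw [hid, hd.fderiv] at this
  unfold ballField
  rw [this]
  simp only [_root_.smul_apply, innerSL_apply_apply, real_inner_self_eq_norm_sq,
    smul_eq_mul]
  have h1 : 0 ≤ ‖x‖ ^ 2 / R ^ 2 / (2 * R) * n := by positivity
  have h2 : 0 ≤ 1 / (R ^ 2 * R) * ‖x‖ ^ 2 := by positivity
  have e : -(3 - ‖x‖ ^ 2 / R ^ 2) / (2 * R) * n =
    -(3 * n / (2 * R)) + ‖x‖ ^ 2 / R ^ 2 / (2 * R) * n := by ring
  linarith

/-- The field points in the direction of `∇ψ`, so the first two terms are `|∇ψ| (1 - |z|)`. Relative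
to `ψ`, the gradient blows up like `(1 - r)^(-2)` at the boundary, and `1 - |z| = (1 - r)²(r + 2)/2`
cancels exactly this singularity. The divergence contributes the summand `3n/2`. -/
theorem radialCutoff_barrier (hR : 0 < R) {x : Eu n} (hx : ‖x‖ < R) :
    ‖fderiv ℝ (radialCutoff n R) x‖ - fderiv ℝ (radialCutoff n R) x (ballField n R x) -
      radialCutoff n R x * vdiv (ballField n R) x ≤ (1 + 3 * n / 2) / R * radialCutoff n R x := by
  have hψ0 := (radialCutoff_pos hR hx).le
  have h1 := norm_fderiv_radialCutoff_le hR x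
  have h2 := mul_le_mul_of_nonneg_left (le_vdiv_ballField hR x) hψ0
  rw [(hasFDerivAt_radialCutoff x).fderiv] at h1 ⊢
  obtain ⟨r, hr⟩ : ∃ r, r = ‖x‖ / R := ⟨_, rfl⟩
  have hxr : ‖x‖ = r * R := by rw [hr]; field_simp
  have hr0 : 0 ≤ r := hr ▸ by positivity
  have hr1 : r < 1 := by rw [hr, div_lt_one hR]; exact hx
  have hs : 0 < 1 - r := by linarith
  have hq : ‖x‖ ^ 2 / R ^ 2 = r ^ 2 := by rw [hxr]; field_simp
  simp only [_root_.smul_apply, innerSL_apply_apply, ballField, real_inner_smul_right,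
    real_inner_self_eq_norm_sq, smul_eq_mul, hq] at h1 ⊢
  set ψ := radialCutoff n R x
  have e : 2 / R ^ 2 * ((1 - r ^ 2)⁻¹ ^ 2 * ψ) * ‖x‖ -
      -(2 / R ^ 2) * ((1 - r ^ 2)⁻¹ ^ 2 * ψ) * (-(3 - r ^ 2) / (2 * R) * ‖x‖ ^ 2) =
      ψ / R * (r * (2 + r) / (1 + r) ^ 2) := by
    have h3 : 1 - r ^ 2 = (1 - r) * (1 + r) := by ring
    have h4 : 1 + r ≠ 0 := by positivity
    rw [hxr, h3]
    field_simp
    ring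
  have h5 : r * (2 + r) / (1 + r) ^ 2 ≤ 1 := by
    rw [div_le_one (by positivity)]; nlinarith
  have h6 : ψ / R * (r * (2 + r) / (1 + r) ^ 2) ≤ ψ / R * 1 := by gcongr
  have e2 : (1 + 3 * (n : ℝ) / 2) / R * ψ = ψ / R * 1 + ψ * (3 * n / (2 * R)) := by
    field_simp
  rw [e2]
  linarith

end RadialCutoff

end TVObstacle

namespace TVObstacle

/-! ### Local bounds and the decay estimate -/

section Bounds

variable {n : ℕ} {h M M' R : ℝ} {v : Eu n → EReal} {f u w : Eu n → ℝ} {g : ℝ → ℝ}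

instance isFiniteMeasure_restrict_ball (x : Eu n) (r : ℝ) :
    IsFiniteMeasure (volume.restrict (Metric.ball x r)) :=
  ⟨by simpa using measure_ball_lt_top⟩

theorem integrable_mul_of_eq_zero {K : Set (Eu n)} (hK : IsCompact K) {G b : Eu n → ℝ}
    (hG : IntegrableOn G K) (hb : Continuous b) (h0 : ∀ x, x ∉ K → b x = 0) :
    Integrable (fun x => G x * b x) := by
  refine (integrableOn_iff_integrable_of_support_subset (s := K) fun x hx => ?_).1
    (hG.mul_continuousOn hb.continuousOn hK)
  by_contra h
  exact hx (by simp [h0 x h])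

theorem integral_const_mul_vdiv {A : Set (Eu n)} {z : Eu n → Eu n} (hz : z ∈ testFields A)
    (c : ℝ) : ∫ x in A, c * vdiv z x = 0 := by
  rw [setIntegral_mul_vdiv (u := fun _ => c) hz, integral_const_mul,
    integral_vdiv_eq_zero (contDiff_one_of_mem_testFields hz) hz.2.1, mul_zero]

/-- Cut the field off outside `B_R`. The outer radius must be at most `2R`, where the norm bound
holds, and below `M`, where test fields live. -/
theorem exists_testField_eq_ballField (hR : 0 < R) (hRM : R < M) :
    ∃ z ∈ testFields (Metric.ball (0 : Eu n) M), ∀ x, ‖x‖ < R → z =ᶠ[𝓝 x] ballField n R := by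
  let χ : ContDiffBump (0 : Eu n) := ⟨R, min (2 * R) ((R + M) / 2), hR, by
    rw [lt_min_iff]; constructor <;> linarith⟩
  have h1 : χ.rOut ≤ 2 * R := min_le_left _ _
  have h2 : χ.rOut ≤ (R + M) / 2 := min_le_right _ _
  have hsub : tsupport (fun x => χ x • ballField n R x) ⊆ Metric.closedBall 0 χ.rOut := by
    rw [← χ.tsupport_eq]
    exact closure_mono fun x hx hx0 => hx (by simp [hx0])
  refine ⟨fun x => χ x • ballField n R x, ⟨χ.contDiff.smul contDiff_ballField,
    χ.hasCompactSupport.smul_right, hsub.trans (Metric.closedBall_subset_ball (by linarith)),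
    fun x => ?_⟩, fun x hx => ?_⟩
  · by_cases hx : ‖x‖ ≤ 2 * R
    · rw [norm_smul, Real.norm_of_nonneg χ.nonneg]
      exact mul_le_one₀ χ.le_one (norm_nonneg _) (norm_ballField_le hR hx)
    · have : χ x = 0 := χ.zero_of_le_dist (by rw [dist_zero_right]; linarith [not_le.1 hx])
      simp [this]
  · have : Metric.ball (0 : Eu n) R ∈ 𝓝 x :=
      Metric.isOpen_ball.mem_nhds (mem_ball_zero_iff.2 hx)
    filter_upwards [this] with y hy
    rw [χ.one_of_mem_closedBall (Metric.ball_subset_closedBall hy), one_smul]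

/-- Use `exchange` with the constant `k` as second function. Its variation is zero, so the second
test field may be chosen freely; the calibrating field replaces the gradient of the cutoff by the
cutoff itself, thanks to `radialCutoff_barrier` and `g ≥ 0`. -/
theorem totalVar_sub_radialCutoff_le (hR : 0 < R) (hRM : R < M) (hu : MemBV (Metric.ball 0 M) u)
    (hg : IsProfile g) (hg0 : ∀ s, 0 ≤ g s) (k : ℝ) :
    MemBV (Metric.ball 0 M) (fun x => u x - radialCutoff n R x * g (u x - k)) ∧
    Integrable (fun x => radialCutoff n R x * g (u x - k)) ∧
    (totalVar (Metric.ball 0 M) (fun x => u x - radialCutoff n R x * g (u x - k))).toReal ≤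
      (totalVar (Metric.ball 0 M) u).toReal +
        (1 + 3 * n / 2) / R * ∫ x, radialCutoff n R x * g (u x - k) := by
  set ψ := radialCutoff n R
  have hψ : IsCutoff ψ := isCutoff_radialCutoff hR
  have hψR : tsupport ψ ⊆ Metric.closedBall 0 R := tsupport_radialCutoff hR
  have hψA : tsupport ψ ⊆ Metric.ball 0 M := hψR.trans (Metric.closedBall_subset_ball hRM)
  have hA := Metric.isOpen_ball (x := (0 : Eu n)) (ε := M)
  have hk : MemBV (Metric.ball (0 : Eu n) M) (fun _ => k) := memBV_const measure_ball_lt_top.ne k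
  obtain ⟨z₂, hz₂, hz₂e⟩ := exists_testField_eq_ballField (n := n) hR hRM
  have hKc := hψ.hasCompactSupport.isCompact
  have iW : IntegrableOn (fun x => u x - k) (tsupport ψ) := (hu.1.sub hk.1).mono_set hψA
  have iG : IntegrableOn (fun x => g (u x - k)) (tsupport ψ) := integrable_profile_comp hg iW
  have iψG : Integrable (fun x => ψ x * g (u x - k)) := by
    simp_rw [mul_comm (ψ _)]
    exact integrable_mul_of_eq_zero hKc iG hψ.contDiff.continuous
      fun x => image_eq_zero_of_notMem_tsupport
  have key : ∀ z₁ ∈ testFields (Metric.ball (0 : Eu n) M),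
      ∫ x in Metric.ball 0 M, (u x - ψ x * g (u x - k)) * vdiv z₁ x ≤
      (totalVar (Metric.ball 0 M) u).toReal +
        (1 + 3 * n / 2) / R * ∫ x, ψ x * g (u x - k) := by
    intro z₁ hz₁
    have h1 := exchange hA hA hu hk hψ hψA hψA hg hz₁ hz₂
    rw [totalVar_const, ENNReal.toReal_zero, add_zero] at h1
    have j2 := integrable_mul_vdiv iψG hz₂
    have e1 : ∫ x in Metric.ball 0 M, (k + ψ x * g (u x - k)) * vdiv z₂ x =
        ∫ x, ψ x * g (u x - k) * vdiv z₂ x := by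
      simp_rw [add_mul]
      rw [integral_add (integrable_mul_vdiv hk.1 hz₂) j2.integrableOn,
        integral_const_mul_vdiv hz₂, zero_add,
        setIntegral_mul_vdiv (u := fun x => ψ x * g (u x - k)) hz₂]
    rw [e1] at h1
    have iF : Integrable (fun x => g (u x - k) * fderiv ℝ ψ x (z₁ x - z₂ x)) := by
      have h3 := hψ.continuous_fderiv
      have h5 := hz₁.1.continuous
      have h6 := hz₂.1.continuous
      exact integrable_mul_of_eq_zero hKc iG (by fun_prop)
        fun x hx => by simp [fderiv_eq_zero_of_notMem_tsupport hx]
    have h2 : (∫ x, g (u x - k) * fderiv ℝ ψ x (z₁ x - z₂ x)) -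
        ∫ x, ψ x * g (u x - k) * vdiv z₂ x ≤
        (1 + 3 * n / 2) / R * ∫ x, ψ x * g (u x - k) := by
      rw [← integral_sub iF j2, ← integral_const_mul]
      refine integral_mono (iF.sub j2) (iψG.const_mul _) fun x => ?_
      dsimp only
      rcases lt_or_ge ‖x‖ R with hx | hx
      · have e2 : z₂ x = ballField n R x := (hz₂e x hx).self_of_nhds
        have e3 : vdiv z₂ x = vdiv (ballField n R) x := vdiv_congr (hz₂e x hx)
        have h3 := radialCutoff_barrier (n := n) hR hx
        have h4 : fderiv ℝ ψ x (z₁ x) ≤ ‖fderiv ℝ ψ x‖ :=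
          (Real.le_norm_self _).trans ((ContinuousLinearMap.le_opNorm _ _).trans
            (mul_le_of_le_one_right (norm_nonneg _) (hz₁.2.2.2 x)))
        rw [e2, e3, map_sub]
        have h5 := mul_le_mul_of_nonneg_left ((sub_le_sub_right (sub_le_sub_right h4 _) _).trans h3)
          (hg0 (u x - k))
        change g (u x - k) * (fderiv ℝ ψ x (z₁ x) - fderiv ℝ ψ x (ballField n R x) -
          ψ x * vdiv (ballField n R) x) ≤ g (u x - k) * ((1 + 3 * n / 2) / R * ψ x) at h5
        linarith
      · have h0 : ψ x = 0 := radialCutoff_eq_zero hR hx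
        have h1 : fderiv ℝ ψ x = 0 := by
          have h3 := norm_fderiv_radialCutoff_le hR x
          rw [radialCutoff_eq_zero hR hx] at h3
          exact norm_le_zero_iff.1 (by simpa using h3)
        simp [h0, h1]
    linarith
  exact ⟨⟨hu.1.sub iψG.integrableOn, totalVar_lt_top key⟩, iψG, toReal_totalVar_le key⟩

/-- Where `u > k`, the second factor of the first integrand is at least `2(k - f) ≥ 2hc + 2`,
whereas the hypothesis `hle` permits only `2hc` on average. The extra `2` forces `∫ ψ g(u - k) = 0`.
-/
theorem ae_le_of_barrier {k c : ℝ} (hh : 0 < h) (hR : 0 < R)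
    (hg : IsProfile g) (hg0 : ∀ s, s ≤ 0 → g s = 0) (hg1 : ∀ s, 0 < s → 0 < g s)
    (hk : ∀ᵐ x ∂(volume.restrict (Metric.ball 0 R)), f x + h * c + 1 ≤ k)
    (i1 : Integrable (fun x => radialCutoff n R x * g (u x - k) *
      (2 * (u x - f x) - radialCutoff n R x * g (u x - k))))
    (i2 : Integrable (fun x => radialCutoff n R x * g (u x - k)))
    (hle : 1 / (2 * h) * ∫ x, radialCutoff n R x * g (u x - k) *
      (2 * (u x - f x) - radialCutoff n R x * g (u x - k)) ≤
      c * ∫ x, radialCutoff n R x * g (u x - k)) :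
    ∀ᵐ x ∂(volume.restrict (Metric.ball 0 R)), u x ≤ k := by
  have hψ : IsCutoff (radialCutoff n R) := isCutoff_radialCutoff hR
  have hgnn : ∀ s, 0 ≤ g s := fun s => by
    rcases le_or_gt s 0 with hs | hs
    · exact (hg0 s hs).ge
    · exact (hg1 s hs).le
  have hd0 : ∀ x, 0 ≤ radialCutoff n R x * g (u x - k) := fun x =>
    mul_nonneg (hψ.nonneg x) (hgnn _)
  rw [ae_restrict_iff' measurableSet_ball] at hk ⊢
  have h1 : (2 * h * c + 2) * ∫ x, radialCutoff n R x * g (u x - k) ≤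
      ∫ x, radialCutoff n R x * g (u x - k) *
      (2 * (u x - f x) - radialCutoff n R x * g (u x - k)) := by
    rw [← integral_const_mul]
    refine integral_mono_ae (i2.const_mul _) i1 ?_
    filter_upwards [hk] with x hx
    rcases lt_or_ge ‖x‖ R with hxR | hxR
    · have h2 := hx (mem_ball_zero_iff.2 hxR)
      rcases le_or_gt (u x - k) 0 with hs | hs
      · simp [hg0 _ hs]
      · have h3 := ((cutoff_mul_profile_mem hψ hg x (u x - k)).1 hs.le).2
        rw [mul_comm]
        exact mul_le_mul_of_nonneg_left (by linarith) (hd0 x)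
    · simp [radialCutoff_eq_zero hR hxR]
  have h2 : ∫ x, radialCutoff n R x * g (u x - k) = 0 := by
    refine le_antisymm ?_ (integral_nonneg hd0)
    rw [one_div_mul_eq_div, div_le_iff₀ (by positivity)] at hle
    linarith
  rw [integral_eq_zero_iff_of_nonneg hd0 i2] at h2
  filter_upwards [h2] with x hx hxR
  by_contra hlt
  have := mul_pos (radialCutoff_pos (n := n) hR (mem_ball_zero_iff.1 hxR))
    (hg1 (u x - k) (by linarith))
  exact this.ne' hx

/-- Local boundedness of relative minimizers. -/
theorem RelMin.ae_abs_le (hh : 0 < h) (hf : MemLp f 2 (volume.restrict (Metric.ball 0 M)))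
    (hR : 0 < R) (hu : RelMin h v f M R u) {K : ℝ}
    (hfK : ∀ᵐ x ∂(volume.restrict (Metric.closedBall 0 R)), |f x| ≤ K)
    (hvK : ∀ᵐ x ∂(volume.restrict (Metric.closedBall 0 R)), v x ≤ (K : EReal)) :
    ∀ᵐ x ∂(volume.restrict (Metric.ball 0 R)),
      |u x| ≤ K + h * ((1 + 3 * n / 2) / R) + 1 := by
  set c := (1 + 3 * (n : ℝ) / 2) / R
  have hc : 0 ≤ c := by positivity
  set k := K + h * c + 1
  have hkK : K ≤ k := by
    have : 0 ≤ h * c := by positivity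
    simp only [k]; linarith
  have hg := isProfile_half_expNegInvGlue
  set g : ℝ → ℝ := fun s => 1 / 2 * expNegInvGlue s
  have hg0 : ∀ s, s ≤ 0 → g s = 0 := fun s hs => by simp [g, expNegInvGlue.zero_of_nonpos hs]
  have hg1 : ∀ s, 0 < s → 0 < g s := fun s hs => by
    have := expNegInvGlue.pos_of_pos hs
    simp only [g]; positivity
  have hgnn : ∀ s, 0 ≤ g s := fun s => by
    have := expNegInvGlue.nonneg s
    simp only [g]; positivity
  have hψ : IsCutoff (radialCutoff n R) := isCutoff_radialCutoff hR
  have hψR : tsupport (radialCutoff n R) ⊆ Metric.closedBall 0 R := tsupport_radialCutoff hR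
  have hψA := hψR.trans hu.closedBall_subset
  have hA := Metric.isOpen_ball (x := (0 : Eu n)) (ε := M)
  have hd0 : ∀ (W : Eu n → ℝ) x, x ∉ Metric.closedBall 0 R →
      radialCutoff n R x * g (W x) = 0 := fun W x hx => by
    rw [image_eq_zero_of_notMem_tsupport fun h => hx (hψR h), zero_mul]
  have hfb : ∀ᵐ x ∂(volume.restrict (Metric.ball 0 R)), |f x| ≤ K :=
    ae_restrict_of_ae_restrict_of_subset Metric.ball_subset_closedBall hfK
  have upper : ∀ᵐ x ∂(volume.restrict (Metric.ball 0 R)), u x ≤ k := by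
    obtain ⟨-, t2, t3⟩ := totalVar_sub_radialCutoff_le hR hu.lt hu.adm.2.1 hg hgnn k
    have adm := admissible_exchange (w := fun _ => k) hA hA hu.adm
      (memBV_const measure_ball_lt_top.ne k) (memLp_const k)
      ((ae_restrict_of_ae_restrict_of_subset hψR hvK).mono fun x hx =>
        hx.trans (EReal.coe_le_coe_iff.2 hkK)) hψ hψA hψA hg
    obtain ⟨i1, v1⟩ := hu.variation hf (hd0 fun x => u x - k) adm
    refine ae_le_of_barrier (c := c) hh hR hg hg0 hg1 ?_ i1 t2 (by linarith)
    filter_upwards [hfb] with x hx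
    have := le_of_abs_le hx
    simp only [k]; linarith
  -- The barrier for `-u` pushes `u` upwards, so the obstacle condition is automatic.
  have lower : ∀ᵐ x ∂(volume.restrict (Metric.ball 0 R)), - u x ≤ k := by
    obtain ⟨t1, t2, t3⟩ := totalVar_sub_radialCutoff_le hR hu.lt hu.adm.2.1.neg hg hgnn k
    have e : (fun x => u x - -(radialCutoff n R x * g (- u x - k))) =
        fun x => -(- u x - radialCutoff n R x * g (- u x - k)) := by ext x; ring
    have adm : Admissible v (Metric.ball 0 M)
        (fun x => u x - -(radialCutoff n R x * g (- u x - k))) := by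
      refine ⟨?_, by rw [e]; exact t1.neg, ?_⟩
      · have := memLp_cutoff_mul_profile hψ hg hψA
          (hu.adm.1.neg.sub (memLp_const (μ := volume.restrict (Metric.ball 0 M)) k))
        exact hu.adm.1.sub (this.mono_measure Measure.restrict_le_self).neg
      · filter_upwards [hu.adm.2.2] with x hx
        refine hx.trans (EReal.coe_le_coe_iff.2 ?_)
        have := mul_nonneg (hψ.nonneg x) (hgnn (- u x - k))
        linarith
    obtain ⟨i1, v1⟩ := hu.variation hf
      (fun x hx => by rw [hd0 (fun x => - u x - k) x hx, neg_zero]) adm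
    rw [e, totalVar_neg] at v1
    rw [totalVar_neg] at t3
    have e2 : (fun x => -(radialCutoff n R x * g (- u x - k)) *
        (2 * (u x - f x) - -(radialCutoff n R x * g (- u x - k)))) =
        fun x => radialCutoff n R x * g (- u x - k) *
        (2 * (- u x - - f x) - radialCutoff n R x * g (- u x - k)) := by ext x; ring
    rw [e2] at i1 v1
    refine ae_le_of_barrier (c := c) (u := fun x => - u x) (f := fun x => - f x) hh hR hg hg0 hg1
      ?_ i1 t2 (by linarith)
    filter_upwards [hfb] with x hx
    have := neg_le_of_abs_le hx
    simp only [k]; linarith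
  filter_upwards [upper, lower] with x h1 h2
  exact abs_le.2 ⟨by linarith, h1⟩

theorem integrable_mul_of_ae_bound {b F : Eu n → ℝ} (hb : Continuous b)
    (hb0 : ∀ x, x ∉ Metric.ball 0 R → b x = 0)
    (hFm : AEStronglyMeasurable F (volume.restrict (Metric.ball 0 R))) {C : ℝ}
    (hF : ∀ᵐ x ∂(volume.restrict (Metric.ball 0 R)), |F x| ≤ C) :
    Integrable (fun x => b x * F x) := by
  refine (integrableOn_iff_integrable_of_support_subset (s := Metric.ball 0 R)
    fun x hx => ?_).1 ?_
  · by_contra h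
    exact hx (by simp [hb0 x h])
  · have h1 : IntegrableOn b (Metric.ball 0 R) :=
      (hb.continuousOn.integrableOn_compact (isCompact_closedBall 0 R)).mono_set
        Metric.ball_subset_closedBall
    exact h1.mul_bdd (c := C) hFm hF

/-- Decay estimate for the difference of two relative minimizers. -/
theorem RelMin.integral_pow_sub_le (hh : 0 < h)
    (hf : MemLp f 2 (volume.restrict (Metric.ball 0 M)))
    (hf' : MemLp f 2 (volume.restrict (Metric.ball 0 M'))) (hR : 0 < R)
    (hu : RelMin h v f M R u) (hw : RelMin h v f M' R w) {L : ℝ}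
    (huL : ∀ᵐ x ∂(volume.restrict (Metric.ball 0 R)), |u x| ≤ L)
    (hwL : ∀ᵐ x ∂(volume.restrict (Metric.ball 0 R)), |w x| ≤ L) {m : ℕ} (hm : 1 ≤ m) :
    ∫ x in Metric.ball 0 (R / 2), |u x - w x| ^ (2 * m + 2) ≤
      2 * Real.exp 2 * ((2 * (2 * m + 2)).factorial * (4 * (4 * h * 2 ^ m) / R) ^ (2 * m + 2)) *
        volume.real (Metric.ball (0 : Eu n) R) := by
  set ψ := radialCutoff n R
  have hψ : IsCutoff ψ := isCutoff_radialCutoff hR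
  have hψ0 : ∀ x, x ∉ Metric.ball 0 R → ψ x = 0 := fun x hx =>
    radialCutoff_eq_zero hR (by simpa using hx)
  have hdψ0 : ∀ x, x ∉ Metric.ball 0 R → ‖fderiv ℝ ψ x‖ = 0 := fun x hx => by
    have h3 := norm_fderiv_radialCutoff_le hR x
    rw [radialCutoff_eq_zero hR (by simpa using hx)] at h3
    exact le_antisymm (by simpa using h3) (norm_nonneg _)
  -- Any positive bound for `|u - w|` would do: it enters only through `D`, which cancels in
  -- `h_comp`.
  set Λ := 2 * |L| + 1
  have hΛ : 0 < Λ := by positivity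
  have hWL : ∀ᵐ x ∂(volume.restrict (Metric.ball 0 R)), |u x - w x| ≤ Λ := by
    filter_upwards [huL, hwL] with x h1 h2
    have := abs_sub (u x) (w x)
    have := le_abs_self L
    simp only [Λ]; linarith
  have hWm : AEStronglyMeasurable (fun x => u x - w x) (volume.restrict (Metric.ball 0 R)) :=
    (hu.adm.1.1.mono_measure (Measure.restrict_mono (Metric.ball_subset_ball hu.lt.le) le_rfl)).sub
    (hw.adm.1.1.mono_measure (Measure.restrict_mono (Metric.ball_subset_ball hw.lt.le) le_rfl))
  have hg := isProfile_powProfile (m := m) hΛ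
  obtain ⟨i0, hcomp⟩ := hu.comparison hh hf hf' hw hψ (tsupport_radialCutoff hR) hg
  have hpm : ∀ j : ℕ, AEStronglyMeasurable (fun x => |u x - w x| ^ j)
      (volume.restrict (Metric.ball 0 R)) := fun j => hWm.norm.pow j
  have hpb : ∀ j : ℕ, ∀ᵐ x ∂(volume.restrict (Metric.ball 0 R)), abs (|u x - w x| ^ j) ≤ Λ ^ j :=
    fun j => by
      filter_upwards [hWL] with x hx
      rw [abs_of_nonneg (by positivity)]
      exact pow_le_pow_left₀ (abs_nonneg _) hx j
  have iP : Integrable (fun x => ψ x * |u x - w x| ^ (2 * m + 2)) :=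
    integrable_mul_of_ae_bound hψ.contDiff.continuous hψ0 (hpm _) (hpb _)
  have iD : Integrable (fun x => ‖fderiv ℝ ψ x‖ * |u x - w x| ^ (2 * m + 1)) :=
    integrable_mul_of_ae_bound hψ.continuous_fderiv.norm hdψ0 (hpm _) (hpb _)
  set D : ℝ := Λ ^ (2 * m) * (2 * m + 1)
  have hD : 0 < D := by positivity
  have h_deriv : 1 / (2 * 2 ^ m * D) * (∫ x, ψ x * |u x - w x| ^ (2 * m + 2)) ≤
      ∫ x, ψ x * powProfile m Λ (u x - w x) *
        ((u x - w x) - ψ x * powProfile m Λ (u x - w x)) := by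
    rw [← integral_const_mul]
    refine integral_mono_ae (iP.const_mul _) i0 ?_
    filter_upwards [(ae_restrict_iff' measurableSet_ball).1 hWL] with x hx
    by_cases hxR : x ∈ Metric.ball 0 R
    · set s := u x - w x
      have a1 := le_powProfile_mul (m := m) hΛ (hx hxR)
      have a2 := abs_powProfile_le (s := s) hΛ hm
      -- The quadratic term costs at most half of the leading one.
      have a3 : ψ x * powProfile m Λ s ^ 2 ≤ 1 / 2 * (powProfile m Λ s * s) := by
        have b1 : powProfile m Λ s ^ 2 ≤ 1 / 2 * (powProfile m Λ s * s) := by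
          have b2 : 0 ≤ powProfile m Λ s * s := le_trans (by positivity) a1
          rw [← sq_abs, ← abs_of_nonneg b2, abs_mul]
          nlinarith [abs_nonneg (powProfile m Λ s)]
        exact (mul_le_of_le_one_left (sq_nonneg _) (hψ.le_one x)).trans b1
      have a4 : 1 / (2 * 2 ^ m * D) * |s| ^ (2 * m + 2) =
          1 / 2 * (|s| ^ (2 * m + 2) / ((2 * Λ ^ 2) ^ m * (2 * m + 1))) := by
        simp only [D]
        rw [mul_pow, ← pow_mul]
        field_simp
      calc 1 / (2 * 2 ^ m * D) * (ψ x * |s| ^ (2 * m + 2))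
          = ψ x * (1 / (2 * 2 ^ m * D) * |s| ^ (2 * m + 2)) := by ring
        _ ≤ ψ x * (powProfile m Λ s * s - ψ x * powProfile m Λ s ^ 2) := by
            refine mul_le_mul_of_nonneg_left ?_ (hψ.nonneg x)
            rw [a4]; linarith
        _ = _ := by ring
    · simp [hψ0 x hxR]
  have h_grad : ∫ x, ‖fderiv ℝ ψ x‖ * |powProfile m Λ (u x - w x)| ≤
      1 / D * ∫ x, ‖fderiv ℝ ψ x‖ * |u x - w x| ^ (2 * m + 1) := by
    rw [← integral_const_mul]
    refine integral_mono_of_nonneg (ae_of_all _ fun x => by positivity) (iD.const_mul _)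
      (ae_of_all _ fun x => ?_)
    have := powProfile_le (m := m) (s := u x - w x) hΛ
    calc ‖fderiv ℝ ψ x‖ * |powProfile m Λ (u x - w x)|
        ≤ ‖fderiv ℝ ψ x‖ * (|u x - w x| ^ (2 * m + 1) / D) := by gcongr
      _ = _ := by ring
  set I := ∫ x, ψ x * |u x - w x| ^ (2 * m + 2)
  set J := ∫ x, ‖fderiv ℝ ψ x‖ * |u x - w x| ^ (2 * m + 1)
  have h_comp : I ≤ 4 * h * 2 ^ m * J := by
    have a1 : 1 / (2 * 2 ^ m * D) * I ≤ 2 * h * (1 / D * J) :=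
      h_deriv.trans (hcomp.trans (mul_le_mul_of_nonneg_left h_grad (by positivity)))
    rw [one_div_mul_eq_div, div_le_iff₀ (by positivity)] at a1
    refine a1.trans_eq ?_
    field_simp
    ring
  set c : ℝ := (2 * (2 * m + 2)).factorial * (4 * (4 * h * 2 ^ m) / R) ^ (2 * m + 2)
  -- Half of `I` is absorbed on the left afterwards, since `I` is finite by the local bounds.
  have h_young : 4 * h * 2 ^ m * J ≤ 1 / 2 * I + c * volume.real (Metric.ball (0 : Eu n) R) := by
    have e : c * volume.real (Metric.ball (0 : Eu n) R) =
        ∫ x, (Metric.ball (0 : Eu n) R).indicator (fun _ => c) x := by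
      rw [integral_indicator measurableSet_ball, setIntegral_const, smul_eq_mul, mul_comm]
    have ii : Integrable ((Metric.ball (0 : Eu n) R).indicator fun _ => c) :=
      (integrable_indicator_iff measurableSet_ball).2 (integrableOn_const measure_ball_lt_top.ne)
    rw [e, ← integral_const_mul, ← integral_const_mul, ← integral_add (iP.const_mul _) ii]
    refine integral_mono (iD.const_mul _) ((iP.const_mul _).add ii) fun x => ?_
    by_cases hxR : x ∈ Metric.ball 0 R
    · rw [indicator_of_mem hxR]
      exact mul_norm_fderiv_radialCutoff_le hR (by positivity) (abs_nonneg _) (2 * m + 1) x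
    · rw [indicator_of_notMem hxR, hψ0 x hxR, hdψ0 x hxR]
      simp
  have h_inner : Real.exp (-2) * ∫ x in Metric.ball 0 (R / 2), |u x - w x| ^ (2 * m + 2) ≤ I := by
    have hsub : Metric.ball (0 : Eu n) (R / 2) ⊆ Metric.ball 0 R :=
      Metric.ball_subset_ball (by linarith)
    rw [← integral_const_mul]
    refine le_trans ?_ (setIntegral_le_integral (s := Metric.ball 0 (R / 2)) iP
      (ae_of_all _ fun x => mul_nonneg (hψ.nonneg x) (by positivity)))
    refine integral_mono_of_nonneg (ae_of_all _ fun x => by positivity) iP.integrableOn ?_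
    filter_upwards [ae_restrict_mem measurableSet_ball] with x hx
    exact mul_le_mul_of_nonneg_right (le_radialCutoff hR (mem_ball_zero_iff.1 hx)) (by positivity)
  rw [Real.exp_neg, inv_mul_le_iff₀ (Real.exp_pos _)] at h_inner
  refine h_inner.trans ?_
  have : I ≤ 2 * (c * volume.real (Metric.ball (0 : Eu n) R)) := by linarith
  calc Real.exp 2 * I ≤ Real.exp 2 * (2 * (c * volume.real (Metric.ball (0 : Eu n) R))) := by
        gcongr
    _ = _ := by ring

end Bounds

end TVObstacle

namespace TVObstacle

/-! ### Uniform estimates in terms of the data -/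

section Data

variable {n : ℕ} {h M M' R ρ : ℝ} {v : Eu n → EReal} {f u w χ : Eu n → ℝ}

theorem MemLinftyLoc.exists_bound (hf : MemLinftyLoc f) (R : ℝ) :
    ∃ K : ℝ, 0 ≤ K ∧ ∀ᵐ x ∂(volume.restrict (Metric.closedBall 0 R)), |f x| ≤ K := by
  have h1 := hf _ (isCompact_closedBall 0 R)
  refine ⟨(eLpNorm f ∞ (volume.restrict (Metric.closedBall 0 R))).toReal,
    ENNReal.toReal_nonneg, ?_⟩
  have h2 := enorm_ae_le_eLpNormEssSup f (volume.restrict (Metric.closedBall 0 R))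
  filter_upwards [h2] with x hx
  rw [← eLpNorm_exponent_top] at hx
  have := ENNReal.toReal_mono h1.2.ne hx
  simpa using this

theorem MemLinftyLoc.memLp_ball (hf : MemLinftyLoc f) (p : ℝ≥0∞) (R : ℝ) :
    MemLp f p (volume.restrict (Metric.ball 0 R)) :=
  ((hf _ (isCompact_closedBall 0 R)).mono_measure
    (Measure.restrict_mono Metric.ball_subset_closedBall le_rfl)).mono_exponent le_top

theorem exists_obstacle_bound (hv_top : ∀ x, v x < ⊤)
    (hv : MemLinftyLoc (fun x => (max (v x) 0).toReal)) (R : ℝ) :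
    ∃ K : ℝ, ∀ᵐ x ∂(volume.restrict (Metric.closedBall 0 R)), v x ≤ (K : EReal) := by
  obtain ⟨K, -, hK⟩ := hv.exists_bound R
  refine ⟨K, ?_⟩
  filter_upwards [hK] with x hx
  have h1 : max (v x) 0 ≠ ⊤ := (max_lt (hv_top x) EReal.zero_lt_top).ne
  have h2 : max (v x) 0 ≠ ⊥ := ((EReal.bot_lt_zero).trans_le (le_max_right _ _)).ne'
  calc v x ≤ max (v x) 0 := le_max_left _ _
    _ = ((max (v x) 0).toReal : EReal) := (EReal.coe_toReal h1 h2).symm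
    _ ≤ K := EReal.coe_le_coe_iff.2 ((le_abs_self _).trans hx)

theorem exists_admissible {K : ℝ}
    (hK : ∀ᵐ x ∂(volume.restrict (Metric.closedBall 0 M)), v x ≤ (K : EReal)) :
    Admissible v (Metric.ball 0 M) (fun _ => K) :=
  ⟨memLp_const K, memBV_const measure_ball_lt_top.ne K,
    ae_restrict_of_ae_restrict_of_subset Metric.ball_subset_closedBall hK⟩

theorem isObstacleMin_ball (hh : 0 < h) (hv_top : ∀ x, v x < ⊤)
    (hv : MemLinftyLoc (fun x => (max (v x) 0).toReal)) (hf : MemLinftyLoc f) (M : ℝ) :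
    IsObstacleMin h v f (Metric.ball 0 M) (obstacleSol h v f (Metric.ball 0 M)) := by
  obtain ⟨K, hK⟩ := exists_obstacle_bound hv_top hv M
  exact isObstacleMin_obstacleSol
    (exists_isObstacleMin hh measure_ball_lt_top.ne (hf.memLp_ball 2 M) ⟨_, exists_admissible hK⟩)

theorem RelMin.mono (hu : RelMin h v f M R u) (hρ : ρ ≤ R) : RelMin h v f M ρ u :=
  ⟨hρ.trans_lt hu.lt, hu.adm, fun w hw he => hu.le w hw fun x hx =>
    he x fun hx' => hx (Metric.closedBall_subset_closedBall hρ hx')⟩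

theorem relMin_obstacleSol (hh : 0 < h) (hv_top : ∀ x, v x < ⊤)
    (hv : MemLinftyLoc (fun x => (max (v x) 0).toReal)) (hf : MemLinftyLoc f) (hR : R < M) :
    RelMin h v f M R (obstacleSol h v f (Metric.ball 0 M)) :=
  (isObstacleMin_ball hh hv_top hv hf M).relMin hh (hf.memLp_ball 2 M) hR

theorem exists_relMin_bound (hh : 0 < h) (hv_top : ∀ x, v x < ⊤)
    (hv : MemLinftyLoc (fun x => (max (v x) 0).toReal)) (hf : MemLinftyLoc f) (hR : 0 < R) :
    ∃ L : ℝ, ∀ M u, RelMin h v f M R u →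
      ∀ᵐ x ∂(volume.restrict (Metric.ball 0 R)), |u x| ≤ L := by
  obtain ⟨K₁, -, hK₁⟩ := hf.exists_bound R
  obtain ⟨K₂, hK₂⟩ := exists_obstacle_bound hv_top hv R
  refine ⟨max K₁ K₂ + h * ((1 + 3 * n / 2) / R) + 1, fun M u hu =>
    hu.ae_abs_le hh (hf.memLp_ball 2 M) hR (hK₁.mono fun x hx => hx.trans (le_max_left _ _))
      (hK₂.mono fun x hx => hx.trans (EReal.coe_le_coe_iff.2 (le_max_right _ _)))⟩

theorem RelMin.memLp_of_bound (hu : RelMin h v f M R u) {L : ℝ}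
    (hL : ∀ᵐ x ∂(volume.restrict (Metric.ball 0 R)), |u x| ≤ L) (p : ℝ≥0∞) :
    MemLp u p (volume.restrict (Metric.ball 0 R)) :=
  MemLp.of_bound (hu.adm.1.1.mono_measure
    (Measure.restrict_mono (Metric.ball_subset_ball hu.lt.le) le_rfl)) L hL

theorem exists_decay_pow (hh : 0 < h) (hv_top : ∀ x, v x < ⊤)
    (hv : MemLinftyLoc (fun x => (max (v x) 0).toReal)) (hf : MemLinftyLoc f) {m : ℕ}
    (hm : 1 ≤ m) : ∃ C : ℝ, 0 ≤ C ∧ ∀ R, 0 < R → ∀ M M' u w, RelMin h v f M R u →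
      RelMin h v f M' R w →
      ∫ x in Metric.ball 0 (R / 2), |u x - w x| ^ (2 * m + 2) ≤ C * (R ^ n / R ^ (2 * m + 2)) := by
  refine ⟨2 * Real.exp 2 * ((2 * (2 * m + 2)).factorial * (4 * (4 * h * 2 ^ m)) ^ (2 * m + 2)) *
    volume.real (Metric.ball (0 : Eu n) 1), by positivity, fun R hR M M' u w hu hw => ?_⟩
  obtain ⟨L, hL⟩ := exists_relMin_bound hh hv_top hv hf hR
  refine (hu.integral_pow_sub_le hh (hf.memLp_ball 2 M) (hf.memLp_ball 2 M') hR hw (hL _ _ hu)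
    (hL _ _ hw) hm).trans_eq ?_
  have e : volume.real (Metric.ball (0 : Eu n) R) =
      R ^ n * volume.real (Metric.ball (0 : Eu n) 1) := by
    have := Measure.addHaar_ball_of_pos (volume : Measure (Eu n)) (0 : Eu n) hR
    rw [measureReal_def, this, ENNReal.toReal_mul, ENNReal.toReal_ofReal (by positivity)]
    simp [measureReal_def]
  rw [e, div_pow]
  ring

theorem exists_decay_eLpNorm (hh : 0 < h) (hv_top : ∀ x, v x < ⊤)
    (hv : MemLinftyLoc (fun x => (max (v x) 0).toReal)) (hf : MemLinftyLoc f) {p : ℝ}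
    (hp : 0 < p) (r : ℝ) {ε : ℝ} (hε : 0 < ε) :
    ∃ R : ℝ, 0 < R ∧ r ≤ R ∧ ∀ M M' u w, RelMin h v f M R u → RelMin h v f M' R w →
      eLpNorm (fun x => u x - w x) (ENNReal.ofReal p) (volume.restrict (Metric.ball 0 r)) ≤
        ENNReal.ofReal ε := by
  -- The exponent `q = 2m + 2` must exceed `n`, for decay, and be at least `p`, for Hölder's
  -- inequality on the fixed ball.
  obtain ⟨m, hm1, hm2⟩ : ∃ m : ℕ, 1 ≤ m ∧ n + ⌈p⌉₊ ≤ m := ⟨n + ⌈p⌉₊ + 1, by omega, by omega⟩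
  set q : ℕ := 2 * m + 2
  have hq0 : q ≠ 0 := by omega
  have hqn : n < q := by omega
  have hpq : p ≤ q := (Nat.le_ceil p).trans (by exact_mod_cast (show ⌈p⌉₊ ≤ q by omega))
  obtain ⟨C, hC0, hC⟩ := exists_decay_pow hh hv_top hv hf hm1
  set μ : Measure (Eu n) := volume.restrict (Metric.ball 0 r)
  set b : ℝ≥0∞ := μ univ ^ (1 / (ENNReal.ofReal p).toReal - 1 / ((q : ℕ) : ℝ≥0∞).toReal)
  have hpq' : ENNReal.ofReal p ≤ (q : ℝ≥0∞) := by
    rw [← ENNReal.ofReal_natCast]; exact ENNReal.ofReal_le_ofReal hpq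
  have hb : b ≠ ∞ := by
    refine ENNReal.rpow_ne_top_of_nonneg ?_ (measure_ne_top _ _)
    rw [ENNReal.toReal_ofReal hp.le, ENNReal.toReal_natCast]
    exact sub_nonneg.2 (one_div_le_one_div_of_le hp hpq)
  have lim1 : Tendsto (fun R : ℝ => C * (R ^ n / R ^ q)) atTop (𝓝 0) := by
    have := (tendsto_pow_div_pow_atTop_zero (𝕜 := ℝ) hqn).const_mul C
    simpa using this
  have lim2 : Tendsto (fun R : ℝ => ENNReal.ofReal ((C * (R ^ n / R ^ q)) ^ (1 / (q : ℝ))) * b)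
      atTop (𝓝 0) := by
    have h1 := lim1.rpow_const (p := 1 / (q : ℝ)) (Or.inr (by positivity))
    rw [Real.zero_rpow (by positivity)] at h1
    have h2 := ENNReal.Tendsto.mul_const (ENNReal.tendsto_ofReal h1) (b := b) (Or.inr hb)
    simpa using h2
  -- `R ≥ 2|r|` places `B_r` inside `B_{R/2}`, where the decay estimate holds.
  obtain ⟨R, hR, hR0, hRr⟩ := (((tendsto_order.1 lim2).2 (ENNReal.ofReal ε)
    (ENNReal.ofReal_pos.2 hε)).and ((eventually_gt_atTop 0).and
      (eventually_ge_atTop (2 * |r|)))).exists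
  refine ⟨R, hR0, (le_abs_self r).trans (by linarith [abs_nonneg r]), fun M M' u w hu hw => ?_⟩
  obtain ⟨L, hL⟩ := exists_relMin_bound hh hv_top hv hf hR0
  have hmem : MemLp (fun x => u x - w x) q (volume.restrict (Metric.ball 0 (R / 2))) :=
    ((hu.memLp_of_bound (hL _ _ hu) q).sub (hw.memLp_of_bound (hL _ _ hw) q)).mono_measure
      (Measure.restrict_mono (Metric.ball_subset_ball (by linarith)) le_rfl)
  have hμ : μ ≤ volume.restrict (Metric.ball 0 (R / 2)) := Measure.restrict_mono
    (Metric.ball_subset_ball (by linarith [le_abs_self r])) le_rfl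
  calc eLpNorm (fun x => u x - w x) (ENNReal.ofReal p) μ
      ≤ eLpNorm (fun x => u x - w x) q μ * b :=
        eLpNorm_le_eLpNorm_mul_rpow_measure_univ hpq' (hmem.1.mono_measure hμ)
    _ ≤ eLpNorm (fun x => u x - w x) q (volume.restrict (Metric.ball 0 (R / 2))) * b := by
        gcongr
    _ ≤ ENNReal.ofReal ((C * (R ^ n / R ^ q)) ^ (1 / (q : ℝ))) * b := by
        gcongr
        exact eLpNorm_nat_le hq0 hmem (hC R hR0 M M' u w hu hw)
    _ ≤ ENNReal.ofReal ε := hR.le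

/-- Gluing a relative minimizer to a function above the obstacle. -/
theorem RelMin.glue (hf : MemLp f 2 (volume.restrict (Metric.ball 0 M)))
    (hu : RelMin h v f M ρ u) (hw : MemBV (Metric.ball 0 R) w)
    (hw2 : MemLp w 2 (volume.restrict (Metric.ball 0 R)))
    (hwv : ∀ᵐ x ∂(volume.restrict (tsupport χ)), v x ≤ (w x : EReal)) (hχ : IsCutoff χ)
    (hχρ : tsupport χ ⊆ Metric.closedBall 0 ρ) (hχR : tsupport χ ⊆ Metric.ball 0 R) :
    MemBV (Metric.ball 0 R) (fun x => w x + χ x * (u x - w x)) ∧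
    (totalVar (Metric.ball 0 R) (fun x => w x + χ x * (u x - w x))).toReal ≤
      (totalVar (Metric.ball 0 R) w).toReal + 2 * (∫ x, ‖fderiv ℝ χ x‖ * |u x - w x|) -
        1 / (2 * h) * ∫ x, χ x * (u x - w x) * (2 * (u x - f x) - χ x * (u x - w x)) := by
  have hA := Metric.isOpen_ball (x := (0 : Eu n)) (ε := M)
  have hB := Metric.isOpen_ball (x := (0 : Eu n)) (ε := R)
  have hχM := hχρ.trans hu.closedBall_subset
  have adm := admissible_exchange hA hB hu.adm hw hw2 hwv hχ hχM hχR isProfile_id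
  obtain ⟨i1, v1⟩ := hu.variation hf (d := fun x => χ x * (u x - w x)) (fun x hx => by
    rw [image_eq_zero_of_notMem_tsupport fun h => hx (hχρ h), zero_mul]) adm
  obtain ⟨-, t2, t3⟩ := totalVar_exchange hA hB hu.adm.2.1 hw hχ hχM hχR isProfile_id
  exact ⟨t2, by linarith⟩

theorem exists_cutoff {r : ℝ} (hr : 0 < r) (hrR : r < R) :
    ∃ (χ : Eu n → ℝ) (ρ : ℝ), IsCutoff χ ∧ ρ < R ∧ tsupport χ ⊆ Metric.closedBall 0 ρ ∧
      (∀ x ∈ Metric.closedBall 0 r, χ x = 1) ∧ ∀ x ∈ Metric.ball 0 r, fderiv ℝ χ x = 0 := by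
  let b : ContDiffBump (0 : Eu n) := ⟨r, (r + R) / 2, hr, by linarith⟩
  refine ⟨b, (r + R) / 2, ⟨b.contDiff, b.hasCompactSupport, fun _ => b.nonneg, fun _ => b.le_one⟩,
    by linarith, b.tsupport_eq.subset, fun x hx => b.one_of_mem_closedBall hx, fun x hx => ?_⟩
  have : (b : Eu n → ℝ) =ᶠ[𝓝 x] fun _ => 1 := by
    filter_upwards [Metric.isOpen_ball.mem_nhds hx] with y hy
    exact b.one_of_mem_closedBall (Metric.ball_subset_closedBall hy)
  rw [this.fderiv_eq]
  simp

/-- Glue `u` to a constant above the obstacle. The constant has no variation, and the remaining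
terms are controlled by the uniform bound on `u` in `B_{R+1}`; on `B_R` the glued function is `u`.
-/
theorem exists_totalVar_bound (hh : 0 < h) (hv_top : ∀ x, v x < ⊤)
    (hv : MemLinftyLoc (fun x => (max (v x) 0).toReal)) (hf : MemLinftyLoc f) (hR : 0 < R) :
    ∃ C : ℝ, ∀ M u, RelMin h v f M (R + 1) u →
      (totalVar (Metric.ball 0 R) u).toReal ≤ C := by
  obtain ⟨L₁, hL₁⟩ := exists_relMin_bound hh hv_top hv hf (show 0 < R + 1 by linarith)
  obtain ⟨K₁, -, hK₁⟩ := hf.exists_bound (R + 1)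
  obtain ⟨K₂, hK₂⟩ := exists_obstacle_bound hv_top hv (R + 1)
  obtain ⟨χ, ρ, hχ, hρ, hχρ, hχ1, -⟩ := exists_cutoff (n := n) hR (lt_add_one R)
  obtain ⟨D, hD⟩ := hχ.exists_bound_fderiv
  have hD0 : 0 ≤ D := (norm_nonneg _).trans (hD 0)
  set L : ℝ := max |L₁| (max |K₁| |K₂|)
  have hL0 : 0 ≤ L := (abs_nonneg _).trans (le_max_left _ _)
  have l1 : L₁ ≤ L := (le_abs_self _).trans (le_max_left _ _)
  have l2 : K₁ ≤ L := (le_abs_self _).trans ((le_max_left _ _).trans (le_max_right _ _))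
  have l3 : |K₂| ≤ L := (le_max_right _ _).trans (le_max_right _ _)
  set V := volume.real (Metric.ball (0 : Eu n) (R + 1))
  refine ⟨2 * ((D * (2 * L)) * V) + 1 / (2 * h) * ((2 * L * (6 * L)) * V), fun M u hu => ?_⟩
  have hχR : tsupport χ ⊆ Metric.ball 0 (R + 1) :=
    hχρ.trans (Metric.closedBall_subset_ball hρ)
  have hχ0 : ∀ x, x ∉ Metric.ball 0 (R + 1) → χ x = 0 := fun x hx =>
    image_eq_zero_of_notMem_tsupport fun h => hx (hχR h)
  obtain ⟨t1, t2⟩ := hu.glue (R := R + 1) (w := fun _ => K₂) (hf.memLp_ball 2 M)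
    (memBV_const measure_ball_lt_top.ne K₂) (memLp_const K₂)
    (ae_restrict_of_ae_restrict_of_subset (hχR.trans Metric.ball_subset_closedBall) hK₂)
    hχ (hχR.trans Metric.ball_subset_closedBall) hχR
  rw [totalVar_const, ENNReal.toReal_zero, zero_add] at t2
  have e : totalVar (Metric.ball 0 R) u =
      totalVar (Metric.ball 0 R) (fun x => K₂ + χ x * (u x - K₂)) := by
    refine totalVar_congr ?_
    filter_upwards [ae_restrict_mem measurableSet_ball] with x hx
    rw [hχ1 x (Metric.ball_subset_closedBall hx)]
    ring
  rw [e]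
  refine (ENNReal.toReal_mono t1.2.ne (totalVar_mono
    (Metric.ball_subset_ball (by linarith)))).trans (t2.trans ?_)
  have hfb : ∀ᵐ x ∂(volume.restrict (Metric.ball 0 (R + 1))), |f x| ≤ K₁ :=
    ae_restrict_of_ae_restrict_of_subset Metric.ball_subset_closedBall hK₁
  have hub := hL₁ M u hu
  have s1 : ∫ x, ‖fderiv ℝ χ x‖ * |u x - K₂| ≤ (D * (2 * L)) * V := by
    rw [← setIntegral_eq_integral_of_forall_compl_eq_zero (μ := volume)
      (s := Metric.ball (0 : Eu n) (R + 1))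
      fun x hx => by
        rw [fderiv_eq_zero_of_notMem_tsupport fun h => hx (hχR h), norm_zero, zero_mul]]
    refine (Real.le_norm_self _).trans (norm_setIntegral_le_of_norm_le_const_ae' (μ := volume)
      measure_ball_lt_top ?_)
    rw [← ae_restrict_iff' measurableSet_ball]
    filter_upwards [hub] with x h1
    rw [norm_mul, norm_norm, Real.norm_eq_abs, abs_abs]
    have := abs_sub (u x) K₂
    exact mul_le_mul (hD x) (by linarith) (abs_nonneg _) hD0
  have s2 : |∫ x, χ x * (u x - K₂) * (2 * (u x - f x) - χ x * (u x - K₂))| ≤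
      (2 * L * (6 * L)) * V := by
    rw [← setIntegral_eq_integral_of_forall_compl_eq_zero (μ := volume)
      (s := Metric.ball (0 : Eu n) (R + 1))
      fun x hx => by rw [hχ0 x hx]; ring]
    rw [← Real.norm_eq_abs]
    refine norm_setIntegral_le_of_norm_le_const_ae' (μ := volume) measure_ball_lt_top ?_
    rw [← ae_restrict_iff' measurableSet_ball]
    filter_upwards [hub, hfb] with x h1 h2
    have h3 := abs_sub (u x) K₂
    have h4 : |χ x * (u x - K₂)| ≤ 2 * L := by
      rw [abs_mul, abs_of_nonneg (hχ.nonneg x)]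
      exact (mul_le_of_le_one_left (abs_nonneg _) (hχ.le_one x)).trans (by linarith)
    have h5 : |2 * (u x - f x) - χ x * (u x - K₂)| ≤ 6 * L := by
      have h6 := abs_sub (2 * (u x - f x)) (χ x * (u x - K₂))
      have h7 := abs_sub (u x) (f x)
      rw [abs_mul, abs_two] at h6
      linarith
    rw [norm_mul]
    exact mul_le_mul h4 h5 (abs_nonneg _) (by positivity)
  have s3 := neg_le_of_abs_le s2
  have s4 : 1 / (2 * h) * (-((2 * L * (6 * L)) * V)) ≤ 1 / (2 * h) *
    ∫ x, χ x * (u x - K₂) * (2 * (u x - f x) - χ x * (u x - K₂)) :=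
    mul_le_mul_of_nonneg_left s3 (by positivity)
  linarith

end Data

end TVObstacle

namespace TVObstacle

/-! ### The limit function and its minimality -/

section Limit

theorem ae_eq_of_tendsto_eLpNorm {α ι : Type*} {mα : MeasurableSpace α} {μ : Measure α}
    {l : Filter ι} [l.NeBot] {p : ℝ≥0∞} (hp : 1 ≤ p) {F : ι → α → ℝ} {u w : α → ℝ}
    (hF : ∀ᶠ i in l, AEStronglyMeasurable (F i) μ) (hu : AEStronglyMeasurable u μ)
    (hw : AEStronglyMeasurable w μ)
    (h₁ : Tendsto (fun i => eLpNorm (fun x => F i x - u x) p μ) l (𝓝 0))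
    (h₂ : Tendsto (fun i => eLpNorm (fun x => F i x - w x) p μ) l (𝓝 0)) : u =ᵐ[μ] w := by
  have h3 : eLpNorm (u - w) p μ ≤ 0 := by
    refine ge_of_tendsto (by simpa using h₂.add h₁) (hF.mono fun i hi => ?_)
    have e : u - w = (fun x => F i x - w x) - fun x => F i x - u x := by
      ext x; simp
    rw [e]
    exact eLpNorm_sub_le (hi.sub hw) (hi.sub hu) hp
  have h4 := (eLpNorm_eq_zero_iff (hu.sub hw) (by positivity)).1 (le_zero_iff.1 h3)
  filter_upwards [h4] with x hx
  exact sub_eq_zero.1 hx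

variable {n : ℕ} {h R r : ℝ} {v : Eu n → EReal} {f u w : Eu n → ℝ}

theorem memLp_obstacleSol (hh : 0 < h) (hv_top : ∀ x, v x < ⊤)
    (hv : MemLinftyLoc (fun x => (max (v x) 0).toReal)) (hf : MemLinftyLoc f) {M : ℝ}
    (hR : R ≤ M) :
    MemLp (obstacleSol h v f (Metric.ball 0 M)) 2 (volume.restrict (Metric.ball 0 R)) :=
  (isObstacleMin_ball hh hv_top hv hf M).1.1.mono_measure
    (Measure.restrict_mono (Metric.ball_subset_ball hR) le_rfl)

/-- The decay estimate makes the minimizers Cauchy. The index is shifted by `⌈r⌉₊` so that every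
term is square integrable on `B_r`. -/
theorem exists_limit_on_ball (hh : 0 < h) (hv_top : ∀ x, v x < ⊤)
    (hv : MemLinftyLoc (fun x => (max (v x) 0).toReal)) (hf : MemLinftyLoc f) (r : ℝ) :
    ∃ U, MemLp U 2 (volume.restrict (Metric.ball 0 r)) ∧
      Tendsto (fun j : ℕ => eLpNorm (fun x => obstacleSol h v f (Metric.ball 0 j) x - U x) 2
        (volume.restrict (Metric.ball 0 r))) atTop (𝓝 0) := by
  have hle : ∀ (s : ℝ) (j k : ℕ), ⌈s⌉₊ ≤ j → s ≤ ((j + k : ℕ) : ℝ) := fun s j k hj =>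
    (Nat.le_ceil s).trans (by exact_mod_cast hj.trans (Nat.le_add_right _ _))
  have : Fact ((1 : ℝ≥0∞) ≤ 2) := ⟨by norm_num⟩
  obtain ⟨U, hU, hlim⟩ := exists_tendsto_eLpNorm_of_cauchy
    (p := 2) (μ := volume.restrict (Metric.ball (0 : Eu n) r))
    (F := fun j : ℕ => obstacleSol h v f (Metric.ball 0 ((j + ⌈r⌉₊ : ℕ) : ℝ)))
    (fun j => memLp_obstacleSol hh hv_top hv hf
      (by rw [add_comm]; exact hle r _ j le_rfl)) (fun ε hε => by
    obtain ⟨R, -, -, hR⟩ := exists_decay_eLpNorm hh hv_top hv hf two_pos r hε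
    have hrel : ∀ j : ℕ, ⌈R⌉₊ + 1 ≤ j → RelMin h v f ((j + ⌈r⌉₊ : ℕ) : ℝ) R
        (obstacleSol h v f (Metric.ball 0 ((j + ⌈r⌉₊ : ℕ) : ℝ))) := fun j hj =>
      relMin_obstacleSol hh hv_top hv hf ((Nat.le_ceil R).trans_lt (by exact_mod_cast by omega))
    refine ⟨⌈R⌉₊ + 1, fun i hi j hj => ?_⟩
    have := hR _ _ _ _ (hrel i hi) (hrel j hj)
    rwa [ENNReal.ofReal_ofNat] at this)
  exact ⟨U, hU, (tendsto_add_atTop_iff_nat ⌈r⌉₊).1 hlim⟩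

/-- `u` is the limit of the minimizers on balls in `L²_loc`. -/
def IsL2Limit (h : ℝ) (v : Eu n → EReal) (f u : Eu n → ℝ) : Prop :=
  ∀ r, MemLp u 2 (volume.restrict (Metric.ball 0 r)) ∧
    Tendsto (fun j : ℕ => eLpNorm (fun x => obstacleSol h v f (Metric.ball 0 j) x - u x) 2
      (volume.restrict (Metric.ball 0 r))) atTop (𝓝 0)

theorem exists_limit (hh : 0 < h) (hv_top : ∀ x, v x < ⊤)
    (hv : MemLinftyLoc (fun x => (max (v x) 0).toReal)) (hf : MemLinftyLoc f) :
    ∃ u : Eu n → ℝ, IsL2Limit h v f u := by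
  choose U hU hlim using fun N : ℕ => exists_limit_on_ball hh hv_top hv hf ((N : ℝ) + 1)
  have key : ∀ᵐ x : Eu n, ∀ k N : ℕ, k ≤ N → x ∈ Metric.ball (0 : Eu n) (k + 1) →
      U k x = U N x := by
    rw [ae_all_iff]; intro k
    rw [ae_all_iff]; intro N
    rw [eventually_imp_distrib_left]; intro hkN
    rw [← ae_restrict_iff' measurableSet_ball]
    have hm : (volume.restrict (Metric.ball (0 : Eu n) (k + 1))) ≤
        volume.restrict (Metric.ball (0 : Eu n) (N + 1)) :=
      Measure.restrict_mono (Metric.ball_subset_ball (by gcongr)) le_rfl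
    refine ae_eq_of_tendsto_eLpNorm (p := 2) (by norm_num) ?_ (hU k).1
      ((hU N).1.mono_measure hm) (hlim k)
      (tendsto_of_tendsto_of_tendsto_of_le_of_le tendsto_const_nhds (hlim N)
        (fun _ => zero_le) fun j => eLpNorm_mono_measure _ hm)
    filter_upwards [eventually_ge_atTop (k + 1)] with j hj
    exact (memLp_obstacleSol hh hv_top hv hf (by exact_mod_cast hj)).1
  -- The limits on nested balls agree almost everywhere; at each point the first ball containing it
  -- is used.
  refine ⟨fun x => U ⌊‖x‖⌋₊ x, fun r => ?_⟩
  have hr : r ≤ (⌈r⌉₊ : ℝ) + 1 := (Nat.le_ceil r).trans (by linarith)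
  have hm : (volume.restrict (Metric.ball (0 : Eu n) r)) ≤
      volume.restrict (Metric.ball (0 : Eu n) (⌈r⌉₊ + 1)) :=
    Measure.restrict_mono (Metric.ball_subset_ball hr) le_rfl
  have e : U ⌈r⌉₊ =ᵐ[volume.restrict (Metric.ball (0 : Eu n) r)] fun x => U ⌊‖x‖⌋₊ x := by
    filter_upwards [ae_restrict_of_ae key, ae_restrict_mem measurableSet_ball] with x hx hxr
    rw [mem_ball_zero_iff] at hxr
    refine (hx _ _ ?_ ?_).symm
    · exact (Nat.floor_le_floor hxr.le).trans (Nat.floor_le_ceil r)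
    · rw [mem_ball_zero_iff]
      exact Nat.lt_floor_add_one _
  refine ⟨((hU _).mono_measure hm).ae_eq e, tendsto_of_tendsto_of_tendsto_of_le_of_le
    tendsto_const_nhds (hlim ⌈r⌉₊) (fun _ => zero_le) fun j => ?_⟩
  refine le_trans (eLpNorm_congr_ae ?_).le (eLpNorm_mono_measure _ hm)
  filter_upwards [e] with x hx
  rw [hx]

theorem eventually_relMin_obstacleSol (hh : 0 < h) (hv_top : ∀ x, v x < ⊤)
    (hv : MemLinftyLoc (fun x => (max (v x) 0).toReal)) (hf : MemLinftyLoc f) (R : ℝ) :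
    ∀ᶠ j : ℕ in atTop, RelMin h v f j R (obstacleSol h v f (Metric.ball 0 j)) :=
  (tendsto_natCast_atTop_atTop.eventually_gt_atTop R).mono fun _ hj =>
    relMin_obstacleSol hh hv_top hv hf hj

theorem eventually_memLp_obstacleSol (hh : 0 < h) (hv_top : ∀ x, v x < ⊤)
    (hv : MemLinftyLoc (fun x => (max (v x) 0).toReal)) (hf : MemLinftyLoc f) (R : ℝ) :
    ∀ᶠ j : ℕ in atTop, MemLp (obstacleSol h v f (Metric.ball 0 j)) 2
      (volume.restrict (Metric.ball 0 R)) :=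
  (tendsto_natCast_atTop_atTop.eventually_ge_atTop R).mono fun _ hj =>
    memLp_obstacleSol hh hv_top hv hf hj

theorem IsL2Limit.tendsto_one (hu : IsL2Limit h v f u) (hh : 0 < h) (hv_top : ∀ x, v x < ⊤)
    (hv : MemLinftyLoc (fun x => (max (v x) 0).toReal)) (hf : MemLinftyLoc f) (r : ℝ) :
    Tendsto (fun j : ℕ => eLpNorm (fun x => obstacleSol h v f (Metric.ball 0 j) x - u x) 1
      (volume.restrict (Metric.ball 0 r))) atTop (𝓝 0) :=
  tendsto_eLpNorm_of_exponent_le (q := 2) (by norm_num) one_ne_zero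
    ((eventually_memLp_obstacleSol hh hv_top hv hf r).mono fun _ hj => hj.1.sub (hu r).1.1)
    (hu r).2

theorem IsL2Limit.memLinftyLoc (hu : IsL2Limit h v f u) (hh : 0 < h) (hv_top : ∀ x, v x < ⊤)
    (hv : MemLinftyLoc (fun x => (max (v x) 0).toReal)) (hf : MemLinftyLoc f) :
    MemLinftyLoc u := by
  intro K hK
  obtain ⟨R₀, hR₀⟩ := hK.isBounded.subset_ball (0 : Eu n)
  set R := max R₀ 1
  have hKR : K ⊆ Metric.ball 0 R := hR₀.trans (Metric.ball_subset_ball (le_max_left _ _))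
  obtain ⟨L, hL⟩ := exists_relMin_bound hh hv_top hv hf (R := R) (by positivity)
  have hb := (eventually_relMin_obstacleSol hh hv_top hv hf R).mono fun j hj => hL _ _ hj
  have hm := (eventually_memLp_obstacleSol hh hv_top hv hf R).mono fun j hj => hj.1
  have h1 := ae_le_of_tendsto_eLpNorm (v := fun _ => ((-L : ℝ) : EReal)) two_ne_zero hm
    (hu R).1.1 (hu R).2 (hb.mono fun j hj => hj.mono fun x hx =>
      EReal.coe_le_coe_iff.2 (neg_le_of_abs_le hx))
  have h2 := ae_le_of_tendsto_eLpNorm (v := fun _ => ((-L : ℝ) : EReal)) two_ne_zero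
    (hm.mono fun j hj => hj.neg) (hu R).1.1.neg (by
      refine (hu R).2.congr fun j => ?_
      rw [← eLpNorm_neg]
      congr 1
      ext x
      simp only [Pi.neg_apply]
      ring) (hb.mono fun j hj => hj.mono fun x hx =>
      EReal.coe_le_coe_iff.2 (neg_le_neg (le_of_abs_le hx)))
  have hμ : volume.restrict K ≤ volume.restrict (Metric.ball 0 R) :=
    Measure.restrict_mono hKR le_rfl
  refine (MemLp.of_bound (hu R).1.1 L ?_).mono_measure hμ
  filter_upwards [h1, h2] with x h3 h4
  exact abs_le.2 ⟨EReal.coe_le_coe_iff.1 h3, neg_le_neg_iff.1 (EReal.coe_le_coe_iff.1 h4)⟩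

theorem ae_of_forall_ae_ball {p : Eu n → Prop}
    (hp : ∀ R : ℝ, 0 < R → ∀ᵐ x ∂(volume.restrict (Metric.ball 0 R)), p x) : ∀ᵐ x, p x := by
  have h1 : ∀ᵐ x : Eu n, ∀ N : ℕ, x ∈ Metric.ball (0 : Eu n) (N + 1) → p x := by
    rw [ae_all_iff]
    intro N
    rw [← ae_restrict_iff' measurableSet_ball]
    exact hp _ (by positivity)
  filter_upwards [h1] with x hx
  exact hx ⌊‖x‖⌋₊ (by rw [mem_ball_zero_iff]; exact Nat.lt_floor_add_one _)

theorem IsL2Limit.ae_le (hu : IsL2Limit h v f u) (hh : 0 < h) (hv_top : ∀ x, v x < ⊤)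
    (hv : MemLinftyLoc (fun x => (max (v x) 0).toReal)) (hf : MemLinftyLoc f) :
    ∀ᵐ x, v x ≤ (u x : EReal) :=
  ae_of_forall_ae_ball fun R _ => ae_le_of_tendsto_eLpNorm two_ne_zero
    ((eventually_memLp_obstacleSol hh hv_top hv hf R).mono fun _ hj => hj.1)
    (hu R).1.1 (hu R).2 ((eventually_relMin_obstacleSol hh hv_top hv hf R).mono fun _ hj =>
      ae_restrict_of_ae_restrict_of_subset (Metric.ball_subset_ball hj.lt.le) hj.adm.2.2)

theorem IsL2Limit.memBVLoc (hu : IsL2Limit h v f u) (hh : 0 < h) (hv_top : ∀ x, v x < ⊤)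
    (hv : MemLinftyLoc (fun x => (max (v x) 0).toReal)) (hf : MemLinftyLoc f) :
    MemBVLoc u := by
  intro A _ hA
  obtain ⟨R₀, hR₀⟩ := hA.subset_ball (0 : Eu n)
  set R := max R₀ 1
  obtain ⟨C, hC⟩ := exists_totalVar_bound hh hv_top hv hf (R := R) (by positivity)
  have hrel := eventually_relMin_obstacleSol hh hv_top hv hf (R + 1)
  refine (totalVar_le_of_tendsto (A := Metric.ball 0 R) ((hu R).1.integrable (by norm_num))
    (hrel.mono fun j hj => hj.adm.2.1.mono (Metric.ball_subset_ball (by linarith [hj.lt])))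
    (hu.tendsto_one hh hv_top hv hf R) (hrel.mono fun j hj => hC _ _ hj)
    tendsto_const_nhds).1.mono (hR₀.trans (Metric.ball_subset_ball (le_max_left _ _)))

/-- Glue the minimizer `S j` into the competitor `u + φ` with a cutoff `χ` equal to one on the
support of `φ`. The glued functions converge to `u`, and the cost of gluing vanishes because it is
paid only where `φ = 0` and hence `S j - (u + φ) = S j - u` tends to zero. Lower semicontinuity
gives the claim. -/
theorem IsL2Limit.isLocalMin (hu : IsL2Limit h v f u) (hh : 0 < h) (hv_top : ∀ x, v x < ⊤)
    (hv : MemLinftyLoc (fun x => (max (v x) 0).toReal)) (hf : MemLinftyLoc f) :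
    IsLocalMin h v f u := by
  intro R hR φ hφ hφR hφv
  have hu1 : MemBV (Metric.ball 0 R) u :=
    hu.memBVLoc hh hv_top hv hf _ Metric.isOpen_ball Metric.isBounded_ball
  have hw1 : MemBV (Metric.ball 0 R) (fun x => u x + φ x) := by
    simpa using (toReal_totalVar_lincomb 1 1 zero_le_one zero_le_one hu1
      (hφ.mono (subset_univ _))).1
  have hfB := hf.memLp_ball 2 R
  -- `φ` is merely in `BV`, so the competitor need not be square integrable; if it is not, its
  -- energy is infinite.
  by_cases hI : ∫⁻ x in Metric.ball 0 R, ENNReal.ofReal ((u x + φ x - f x) ^ 2) = ∞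
  · have : energy h f (Metric.ball 0 R) (fun x => u x + φ x) = ∞ := by
      rw [energy, hI, ENNReal.mul_top (by simpa using hh), add_top]
    rw [this]
    exact le_top
  have hwf : MemLp (fun x => u x + φ x - f x) 2 (volume.restrict (Metric.ball 0 R)) := by
    have hm : AEStronglyMeasurable (fun x => u x + φ x - f x)
      (volume.restrict (Metric.ball 0 R)) := hw1.1.1.sub hfB.1
    refine (memLp_two_iff_integrable_sq hm).2 ⟨hm.pow 2, ?_⟩
    rw [hasFiniteIntegral_iff_ofReal (ae_of_all _ fun x => sq_nonneg _)]
    exact lt_top_iff_ne_top.2 hI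
  have hw2 : MemLp (fun x => u x + φ x) 2 (volume.restrict (Metric.ball 0 R)) := by
    refine (hwf.add hfB).ae_eq (ae_of_all _ fun x => ?_)
    simp
  obtain ⟨r₀, hr₀, hφr₀⟩ := exists_lt_subset_ball (isClosed_tsupport φ) hφR
  -- The support of `φ` stays away from the boundary of `B_R`; the maximum only ensures `r > 0`.
  set r := max r₀ (R / 2)
  have hr0 : 0 < r := lt_of_lt_of_le (by positivity) (le_max_right _ _)
  have hrR : r < R := max_lt hr₀ (by linarith)
  have hφr : ∀ x, x ∉ Metric.ball 0 r → φ x = 0 := fun x hx =>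
    image_eq_zero_of_notMem_tsupport fun h' =>
      hx (Metric.ball_subset_ball (le_max_left _ _) (hφr₀ h'))
  obtain ⟨χ, ρ, hχ, hρ, hχρ, hχ1, hχ'⟩ := exists_cutoff (n := n) hr0 hrR
  have hχR : tsupport χ ⊆ Metric.ball 0 R := hχρ.trans (Metric.closedBall_subset_ball hρ)
  have hχ0 : ∀ x, x ∉ Metric.ball 0 R → χ x = 0 := fun x hx =>
    image_eq_zero_of_notMem_tsupport fun h => hx (hχR h)
  have hχφ : ∀ x, χ x * φ x = φ x := fun x => by
    by_cases hx : x ∈ Metric.ball 0 r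
    · rw [hχ1 x (Metric.ball_subset_closedBall hx), one_mul]
    · rw [hφr x hx, mul_zero]
  set μ := volume.restrict (Metric.ball (0 : Eu n) R)
  set S : ℕ → Eu n → ℝ := fun j => obstacleSol h v f (Metric.ball 0 j)
  have hrel : ∀ᶠ j : ℕ in atTop, RelMin h v f j ρ (S j) :=
    (eventually_relMin_obstacleSol hh hv_top hv hf R).mono fun j hj => hj.mono hρ.le
  have hS2 : ∀ᶠ j : ℕ in atTop, MemLp (S j) 2 μ := eventually_memLp_obstacleSol hh hv_top hv hf R
  have hglue := hrel.mono fun j hj => hj.glue (hf.memLp_ball 2 j) hw1 hw2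
    (ae_restrict_of_ae hφv) hχ hχρ hχR
  have lim1 : Tendsto (fun j => ∫ x, ‖fderiv ℝ χ x‖ * |S j x - (u x + φ x)|) atTop (𝓝 0) := by
    obtain ⟨D, hD⟩ := hχ.exists_bound_fderiv
    have h1 := tendsto_setIntegral_mul_of_eLpNorm (μ := μ) (l := atTop)
      (f := fun j x => |S j x - u x|) (u := fun _ => 0) (b := fun x => ‖fderiv ℝ χ x‖) (C := D)
      hχ.continuous_fderiv.norm.aestronglyMeasurable (fun x => by rw [norm_norm]; exact hD x)
      (integrable_zero _ _ _)
      (hS2.mono fun j hj => ((hj.sub (hu R).1).integrable (by norm_num)).abs)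
      ((hu.tendsto_one hh hv_top hv hf R).congr fun j => by
        simp only [sub_zero]
        exact (eLpNorm_norm _).symm)
    simp only [zero_mul, integral_zero] at h1
    refine h1.congr fun j => ?_
    rw [← setIntegral_eq_integral_of_forall_compl_eq_zero (μ := volume)
      (s := Metric.ball (0 : Eu n) R) fun x hx => by
        rw [fderiv_eq_zero_of_notMem_tsupport fun h => hx (hχR h), norm_zero, zero_mul]]
    congr 1
    ext x
    by_cases hx : x ∈ Metric.ball 0 r
    · rw [hχ' x hx, norm_zero, zero_mul, mul_zero]
    · rw [hφr x hx, add_zero, mul_comm]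
  have hG : ∀ᶠ j in atTop, MemLp (fun x => S j x - f x) 2 μ := hS2.mono fun j hj => hj.sub hfB
  have hH : ∀ᶠ j in atTop, MemLp (fun x => S j x - χ x * (S j x - (u x + φ x)) - f x) 2 μ :=
    hS2.mono fun j hj => (hj.sub ((memLp_cutoff_mul_profile hχ isProfile_id hχR
      (hj.sub hw2)).restrict _)).sub hfB
  have limG := tendsto_integral_sq hG ((hu R).1.sub hfB) (by
    refine (hu R).2.congr fun j => ?_
    congr 1
    ext x
    simp only [Pi.sub_apply]
    ring)
  -- Since `χ φ = φ`, the difference from the limit is `(1 - χ)(S j - u)`.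
  have limH := tendsto_integral_sq hH hwf (by
    refine tendsto_of_tendsto_of_tendsto_of_le_of_le tendsto_const_nhds (hu R).2
      (fun _ => zero_le) fun j => eLpNorm_mono fun x => ?_
    have e : S j x - χ x * (S j x - (u x + φ x)) - f x - (u x + φ x - f x) =
        (1 - χ x) * (S j x - u x) := by linear_combination hχφ x
    rw [e, norm_mul]
    refine mul_le_of_le_one_left (norm_nonneg _) ?_
    rw [Real.norm_eq_abs, abs_of_nonneg (by linarith [hχ.le_one x])]
    linarith [hχ.nonneg x])
  have lim2 : Tendsto (fun j => ∫ x, χ x * (S j x - (u x + φ x)) *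
      (2 * (S j x - f x) - χ x * (S j x - (u x + φ x)))) atTop
      (𝓝 ((∫ x, (u x - f x) ^ 2 ∂μ) - ∫ x, (u x + φ x - f x) ^ 2 ∂μ)) := by
    refine (limG.sub limH).congr' ?_
    filter_upwards [hG, hH] with j h1 h2
    rw [← integral_sub h1.integrable_sq h2.integrable_sq,
      ← setIntegral_eq_integral_of_forall_compl_eq_zero (μ := volume)
      (s := Metric.ball (0 : Eu n) R) fun x hx => by rw [hχ0 x hx]; ring]
    congr 1
    ext x
    ring
  have main := (totalVar_le_of_tendsto hu1.1 (hglue.mono fun j hj => hj.1) (by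
      refine tendsto_of_tendsto_of_tendsto_of_le_of_le tendsto_const_nhds
        (hu.tendsto_one hh hv_top hv hf R) (fun _ => zero_le) fun j => eLpNorm_mono fun x => ?_
      have e : u x + φ x + χ x * (S j x - (u x + φ x)) - u x = χ x * (S j x - u x) := by
        linear_combination - hχφ x
      rw [e, norm_mul]
      refine mul_le_of_le_one_left (norm_nonneg _) ?_
      rw [Real.norm_eq_abs, abs_of_nonneg (hχ.nonneg x)]
      exact hχ.le_one x) (hglue.mono fun j hj => hj.2)
    (((lim1.const_mul 2).const_add _).sub (lim2.const_mul (1 / (2 * h))))).2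
  rw [energy_eq_ofReal hh hu1.2 ((hu R).1.sub hfB), energy_eq_ofReal hh hw1.2 hwf]
  refine ENNReal.ofReal_le_ofReal ?_
  rw [renergy, renergy]
  linarith

end Limit

end TVObstacle

namespace TVObstacle

/-! ### Local minimizers are the global limit -/

section Characterization

variable {n : ℕ} {h R ρ : ℝ} {v : Eu n → EReal} {f u w w₁ : Eu n → ℝ} {A : Set (Eu n)}

theorem energy_congr (huw : u =ᵐ[volume.restrict A] w) : energy h f A u = energy h f A w := by
  rw [energy, energy, totalVar_congr huw]
  congr 2
  refine lintegral_congr_ae ?_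
  filter_upwards [huw] with x hx
  rw [hx]

theorem IsLocalMin.congr (hu : IsLocalMin h v f u) (huw : u =ᵐ[volume] w) :
    IsLocalMin h v f w := by
  intro R hR φ hφ hφR hφv
  have e : (fun x => u x + φ x) =ᵐ[volume] fun x => w x + φ x := by
    filter_upwards [huw] with x hx
    rw [hx]
  rw [← energy_congr (ae_restrict_of_ae huw), ← energy_congr (ae_restrict_of_ae e)]
  refine hu R hR φ hφ hφR ?_
  filter_upwards [huw, hφv] with x hx hx'
  rwa [hx]

/-- A function of bounded variation in a ball that vanishes near its boundary extends by zero. -/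
theorem MemBV.indicator_closedBall (hw : MemBV (Metric.ball 0 R) w) (hρ0 : 0 < ρ) (hρ : ρ < R)
    (hw0 : ∀ x, x ∉ Metric.closedBall 0 ρ → w x = 0) : MemBV univ w := by
  have hsub : Metric.closedBall (0 : Eu n) ρ ⊆ Metric.ball 0 R :=
    Metric.closedBall_subset_ball hρ
  have hint : Integrable w := by
    rw [← integrableOn_iff_integrable_of_support_subset (s := Metric.ball (0 : Eu n) R)]
    · exact hw.1
    · exact fun x hx => by_contra fun h' => hx (hw0 x fun h'' => h' (hsub h''))
  refine ⟨hint.integrableOn, totalVar_lt_top (c := (totalVar (Metric.ball 0 R) w).toReal)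
    fun z hz => ?_⟩
  -- The cutoff equals one on a neighbourhood of the closed ball of radius `ρ`, so multiplying by it
  -- leaves the divergence of `z` unchanged wherever `w` may be nonzero.
  obtain ⟨χ, ρ', hχ, hρ', hχρ', hχ1, hχ'⟩ := exists_cutoff (n := n) (r := (ρ + R) / 2) (R := R)
    (by linarith) (by linarith)
  have hχz : (fun x => χ x • z x) ∈ testFields (Metric.ball (0 : Eu n) R) :=
    ⟨hχ.contDiff.smul hz.1, hχ.hasCompactSupport.smul_right,
      (tsupport_smul_subset_left χ z).trans
        (hχρ'.trans (Metric.closedBall_subset_ball hρ')), fun x => by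
        rw [norm_smul, Real.norm_eq_abs, abs_of_nonneg (hχ.nonneg x)]
        exact mul_le_one₀ (hχ.le_one x) (norm_nonneg _) (hz.2.2.2 x)⟩
  refine le_trans (le_of_eq ?_) (integral_le_totalVar hw.2 hχz)
  rw [setIntegral_mul_vdiv hχz, setIntegral_univ]
  congr 1
  ext x
  by_cases hx : x ∈ Metric.closedBall 0 ρ
  · congr 1
    refine vdiv_congr ?_
    have hx' : x ∈ Metric.ball (0 : Eu n) ((ρ + R) / 2) :=
      Metric.closedBall_subset_ball (by linarith) hx
    filter_upwards [Metric.isOpen_ball.mem_nhds hx'] with y hy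
    rw [hχ1 y (Metric.ball_subset_closedBall hy), one_smul]
  · rw [hw0 x hx, zero_mul, zero_mul]

/-- A competitor that agrees with `w` outside the smaller closed ball differs from it by a
perturbation compactly supported in `B_R`, which extends by zero to a function in `BV(ℝⁿ)`. -/
theorem IsLocalMin.relMin (hw : IsLocalMin h v f w) (hh : 0 < h) (hf : MemLinftyLoc f)
    (hwL : MemLinftyLoc w) (hwBV : MemBVLoc w) (hwv : ∀ᵐ x, v x ≤ (w x : EReal))
    (hρ0 : 0 < ρ) (hρ : ρ < R) : RelMin h v f R ρ w := by
  classical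
  have hwR := hwBV _ (Metric.isOpen_ball (x := 0) (ε := R)) Metric.isBounded_ball
  have adm : Admissible v (Metric.ball 0 R) w :=
    ⟨hwL.memLp_ball 2 R, hwR, ae_restrict_of_ae hwv⟩
  refine ⟨hρ, adm, fun w₁ hw₁ he => ?_⟩
  set φ : Eu n → ℝ := (Metric.closedBall 0 ρ).indicator fun x => w₁ x - w x
  have hφ0 : ∀ x, x ∉ Metric.closedBall 0 ρ → φ x = 0 := fun x hx => indicator_of_notMem hx _
  have hφe : ∀ x, w x + φ x = w₁ x := fun x => by
    by_cases hx : x ∈ Metric.closedBall 0 ρ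
    · simp [φ, indicator_of_mem hx]
    · rw [hφ0 x hx, he x hx, add_zero]
  have hφB : MemBV (Metric.ball 0 R) φ :=
    (toReal_totalVar_lincomb 1 1 zero_le_one zero_le_one hw₁.2.1 hwR.neg).1.congr
      (ae_of_all _ fun x => by simp only []; linarith [hφe x])
  have hφR : tsupport φ ⊆ Metric.ball 0 R :=
    (closure_minimal (Function.support_subset_iff'.2 hφ0)
      Metric.isClosed_closedBall).trans (Metric.closedBall_subset_ball hρ)
  have key := hw R (hρ0.trans hρ) φ (hφB.indicator_closedBall hρ0 hρ hφ0) hφR (by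
    filter_upwards [hwv, (ae_restrict_iff' measurableSet_ball).1 hw₁.2.2] with x h1 h2
    by_cases hx : x ∈ Metric.ball 0 R
    · rw [hφe x]
      exact h2 hx
    · rwa [hφ0 x fun h' => hx (Metric.closedBall_subset_ball hρ h'), add_zero])
  rw [funext hφe] at key
  exact (adm.energy_le_iff hh (hf.memLp_ball 2 R) hw₁).1 key

/-- Both `w` and the minimizer on `B_M` are relative minimizers at the scale `R₀ < M`, so the decay
estimate compares them directly. -/
theorem IsLocalMin.isGlobalLimit (hw : IsLocalMin h v f w) (hh : 0 < h)
    (hv_top : ∀ x, v x < ⊤) (hv : MemLinftyLoc (fun x => (max (v x) 0).toReal))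
    (hf : MemLinftyLoc f) (hwL : MemLinftyLoc w) (hwBV : MemBVLoc w)
    (hwv : ∀ᵐ x, v x ≤ (w x : EReal)) : IsGlobalLimit h v f w := by
  intro R _ p hp
  rw [ENNReal.tendsto_nhds_zero]
  intro ε hε
  -- The tolerance `ε` may be infinite, while the decay estimate takes a real one.
  have hε1 : min ε 1 ≠ ∞ := (min_le_right _ _).trans_lt ENNReal.one_lt_top |>.ne
  have hε0 : 0 < (min ε 1).toReal := ENNReal.toReal_pos (lt_min hε one_pos).ne' hε1
  obtain ⟨R₀, hR₀, -, hdec⟩ := exists_decay_eLpNorm hh hv_top hv hf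
    ((Nat.cast_nonneg n).trans_lt hp) R hε0
  filter_upwards [eventually_gt_atTop R₀] with M hM
  refine (hdec _ _ _ _ (hw.relMin hh hf hwL hwBV hwv hR₀ (lt_add_one R₀))
    (relMin_obstacleSol hh hv_top hv hf hM)).trans ?_
  rw [ENNReal.ofReal_toReal hε1]
  exact min_le_left _ _

theorem IsGlobalLimit.ae_eq (hu : IsGlobalLimit h v f u) (hw : IsGlobalLimit h v f w) (hh : 0 < h)
    (hv_top : ∀ x, v x < ⊤) (hv : MemLinftyLoc (fun x => (max (v x) 0).toReal))
    (hf : MemLinftyLoc f) (huL : MemLinftyLoc u) (hwL : MemLinftyLoc w) : w =ᵐ[volume] u := by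
  refine ae_of_forall_ae_ball fun R hR => ?_
  have hp : (n : ℝ) < n + 1 := lt_add_one _
  refine ae_eq_of_tendsto_eLpNorm (p := ENNReal.ofReal (n + 1)) (l := atTop)
    (F := fun M : ℝ => obstacleSol h v f (Metric.ball 0 M)) ?_ ?_ (hwL.memLp_ball 2 R).1
    (huL.memLp_ball 2 R).1 ((hw R hR _ hp).congr fun M => eLpNorm_sub_comm w _ _ _)
    ((hu R hR _ hp).congr fun M => eLpNorm_sub_comm u _ _ _)
  · rw [← ENNReal.ofReal_one]
    exact ENNReal.ofReal_le_ofReal (by linarith [Nat.cast_nonneg (α := ℝ) n])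
  · filter_upwards [eventually_ge_atTop R] with M hM
    exact (memLp_obstacleSol hh hv_top hv hf hM).1

end Characterization

end TVObstacle

theorem mainTheorem6 (n : ℕ) (h : ℝ) (hh : 0 < h)
    (v : EuclideanSpace ℝ (Fin n) → EReal) (hv : AEMeasurable v volume)
    (hv_top : ∀ x, v x < ⊤)
    (hv_loc : TVObstacle.MemLinftyLoc (fun x => (max (v x) 0).toReal))
    (f : EuclideanSpace ℝ (Fin n) → ℝ) (hf : TVObstacle.MemLinftyLoc f) :
    -- the minimizers on balls are well defined
    (∀ M : ℝ, 0 < M →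
      TVObstacle.IsObstacleMin h v f (Metric.ball 0 M)
        (TVObstacle.obstacleSol h v f (Metric.ball 0 M)) ∧
      ∀ w, TVObstacle.IsObstacleMin h v f (Metric.ball 0 M) w →
        w =ᵐ[volume.restrict (Metric.ball 0 M)]
          TVObstacle.obstacleSol h v f (Metric.ball 0 M)) ∧
    ∃ u : EuclideanSpace ℝ (Fin n) → ℝ,
      (TVObstacle.MemLinftyLoc u ∧ TVObstacle.MemBVLoc u ∧
        TVObstacle.IsGlobalLimit h v f u) ∧
      -- uniqueness
      (∀ w : EuclideanSpace ℝ (Fin n) → ℝ,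
        TVObstacle.MemLinftyLoc w → TVObstacle.MemBVLoc w →
        TVObstacle.IsGlobalLimit h v f w → w =ᵐ[volume] u) ∧
      -- characterization
      (∀ w : EuclideanSpace ℝ (Fin n) → ℝ,
        TVObstacle.MemLinftyLoc w → TVObstacle.MemBVLoc w →
        (w =ᵐ[volume] u ↔
          (∀ᵐ x, v x ≤ (w x : EReal)) ∧ TVObstacle.IsLocalMin h v f w)) := by
  obtain ⟨u, hu⟩ := TVObstacle.exists_limit hh hv_top hv_loc hf
  have huL := hu.memLinftyLoc hh hv_top hv_loc hf
  have huBV := hu.memBVLoc hh hv_top hv_loc hf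
  have huv := hu.ae_le hh hv_top hv_loc hf
  have humin := hu.isLocalMin hh hv_top hv_loc hf
  have hulim := humin.isGlobalLimit hh hv_top hv_loc hf huL huBV huv
  refine ⟨fun M _ => ⟨TVObstacle.isObstacleMin_ball hh hv_top hv_loc hf M, fun w hw =>
    hw.ae_eq hh (hf.memLp_ball 2 M) (TVObstacle.isObstacleMin_ball hh hv_top hv_loc hf M)⟩,
    u, ⟨huL, huBV, hulim⟩, fun w hwL _ hwlim =>
      hulim.ae_eq hwlim hh hv_top hv_loc hf huL hwL, fun w hwL hwBV => ⟨fun hwu => ?_, ?_⟩⟩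
  · refine ⟨?_, humin.congr hwu.symm⟩
    filter_upwards [hwu, huv] with x hx hx'
    rwa [hx]
  · rintro ⟨hwv, hwmin⟩
    exact hulim.ae_eq (hwmin.isGlobalLimit hh hv_top hv_loc hf hwL hwBV hwv) hh hv_top hv_loc hf
      huL hwL
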